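/- **Setting.** Let $R$ be an associative ring with $1$ and with an involution $a\mapsto\bar a$, and suppose that $R$ is almost commutative, i.e. finitely generated as a module over its center $C(R)$. Let $R=R_0\oplus R_1\oplus R_2\oplus\cdots$ be graded, with $\overline{R_i}\subseteq R_i$ for all $i$. Let $\lambda\in C(R)\cap R_0$ satisfy $\lambda\bar\lambda=1$, and let $\Lambda$ be a $\lambda$-form parameter: an additive subgroup of $R$ with $\{a-\lambda\bar a\mid a\in R\}\subseteq\Lambda\subseteq\{a\in R\mid a=-\lambda\bar a\}$ and $\bar x\Lambda x\subseteq\Lambda$ for all $x\in R$. Assume that $\Lambda$ is homogeneous, i.e. contains the homogeneous components of its elements. Put $\psi_n=\begin{pmatrix}0&I_n\\ \lambda I_n&0\end{pmatrix}$, $f(v,w)=\sum_{i=1}^n\bar v_i w_{n+i}$ for $v,w\in R^{2n}$, and $\rho(i)=n+i$. The group $\mathrm{GQ}(2n,R,\Lambda)$ consists of all $\sigma\in \mathrm{GL}_{2n}(R)$ with $\bar\sigma^{t}\psi_n\sigma=\psi_n$ and $f(\sigma v,\sigma v)-f(v,v)\in\Lambda$ for all $v\in R^{2n}$. The group $\mathrm{EQ}(2n,R,\Lambda)$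 is generated by the following matrices, where $1\le i,j\le n$: * for $i\ne j$ and $a\in R$: $\;I+ae_{ij}-\bar a e_{\rho(j)\rho(i)}$, $\;I+ae_{i\rho(j)}-\bar\lambda\bar a e_{j\rho(i)}$, and $I+ae_{\rho(i)j}-\lambda\bar a e_{\rho(j)i}$; * $I+ae_{i\rho(i)}$ with $\bar a\in\Lambda$, and $I+ae_{\rho(i)i}$ with $a\in\Lambda$. For $b=\sum_i b_i\in R$ with $b_i\in R_i$ and for $a\in R_0$ put $b^+(a)=\sum_i b_ia^i$; for a matrix $\alpha$ over $R$ let $\alpha^+(a)$ be obtained entrywise, so that $\alpha^+(0)$ is the degree-$0$ part of $\alpha$. For a maximal ideal $\mathfrak m$ of $C(R_0)$ let $S_{\mathfrak m}$ be the set of all $s\in C(R)$ such that $s$ and $\bar s$ both lie in $C(R_0)\setminus\mathfrak m$ (this is $C(R_0)\setminus\mathfrak m$ if $C(R_0)\subseteq C(R)$ and $\overline{\mathfrak m}=\mathfrak m$). Let $R_{\mathfrak m}=S_{\mathfrak m}^{-1}R$, with the involution $\overline{r/s}=\bar r/\bar s$; let $\Lambda_{\mathfrak m}$ be the form parameter $\{x/(\bar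 s s)\mid x\in\Lambda,\ s\in S_{\mathfrak m}\}$ of $R_{\mathfrak m}$ (with respect to the image of $\lambda$), and let $\alpha_{\mathfrak m}$ be the image of $\alpha$ in $\mathrm{GL}_{2n}(R_{\mathfrak m})$. **Theorem.** For $2n\ge 6$ the following assertions are equivalent: 1. $\mathrm{EQ}(2n,R,\Lambda)$ is a normal subgroup of $\mathrm{GQ}(2n,R,\Lambda)$. 2. If $\alpha\in\mathrm{GQ}(2n,R,\Lambda)$ satisfies $\alpha^+(0)=I_{2n}$, and $\alpha_{\mathfrak m}\in\mathrm{EQ}(2n,R_{\mathfrak m},\Lambda_{\mathfrak m})$ for every maximal ideal $\mathfrak m$ of $C(R_0)$, then $\alpha\in\mathrm{EQ}(2n,R,\Lambda)$. -/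

import Mathlib

open scoped DirectSum

noncomputable section

namespace QuadraticGroup

section Form

variable {R : Type*} [Ring R] [StarRing R]

/-- `Λ` is a `lam`-form parameter on the ring `R` with involution `star`:
`{a - lam * ā} ⊆ Λ ⊆ {a | a = - lam * ā}` and `x̄ * Λ * x ⊆ Λ` for all `x`. -/
structure IsFormParameter (lam : R) (Λ : AddSubgroup R) : Prop where
  min_le : ∀ a : R, a - lam * star a ∈ Λ
  le_max : ∀ a ∈ Λ, a = -(lam * star a)
  conj_mem : ∀ a ∈ Λ, ∀ x : R, star x * a * x ∈ Λ

/-- The matrix `ψ_n` with block rows `(0, I)` and `(lam I, 0)`. The index `Sum.inl i` stands for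
`i` and `Sum.inr i` for `ρ(i) = n + i`. -/
def psi (n : ℕ) (lam : R) : Matrix (Fin n ⊕ Fin n) (Fin n ⊕ Fin n) R :=
  Matrix.fromBlocks 0 1 (Matrix.scalar (Fin n) lam) 0

/-- The sesquilinear form `f(v, w) = ∑ v̄_i * w_{n+i}` on `R^{2n}`. The hyperbolic quadratic form is
`v ↦ f(v, v) + Λ`, and `ψ_n` is the matrix of `f(v, w) + lam * conj (f(w, v))`. -/
def sesq {n : ℕ} (v w : Fin n ⊕ Fin n → R) : R :=
  ∑ i : Fin n, star (v (Sum.inl i)) * w (Sum.inr i)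

/-- The general quadratic group `GQ(2n, R, Λ)`: the invertible matrices which preserve the
`lam`-Hermitian form `ψ_n` and the hyperbolic quadratic form with values in `R / Λ`. -/
def GQ (n : ℕ) (lam : R) (Λ : AddSubgroup R) : Subgroup (GL (Fin n ⊕ Fin n) R) where
  carrier := {σ | σ.val.conjTranspose * psi n lam * σ.val = psi n lam ∧
    ∀ v : Fin n ⊕ Fin n → R,
      sesq (σ.val.mulVec v) (σ.val.mulVec v) - sesq v v ∈ Λ}
  one_mem' := by
    refine ⟨by simp, fun v => ?_⟩
    simp
  mul_mem' := by
    rintro σ τ ⟨hσ, hσq⟩ ⟨hτ, hτq⟩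
    refine ⟨?_, fun v => ?_⟩
    · calc (σ * τ).val.conjTranspose * psi n lam * (σ * τ).val
          = τ.val.conjTranspose * (σ.val.conjTranspose * psi n lam * σ.val) * τ.val := by
            simp only [Units.val_mul, Matrix.conjTranspose_mul, mul_assoc]
        _ = psi n lam := by rw [hσ, hτ]
    · have h := Λ.add_mem (hσq (τ.val.mulVec v)) (hτq v)
      simpa [Units.val_mul, Matrix.mulVec_mulVec] using h
  inv_mem' := by
    rintro σ ⟨hσ, hσq⟩
    refine ⟨?_, fun v => ?_⟩
    · have h1 : σ.val * (σ⁻¹).val = 1 := by simp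
      have h2 : (σ⁻¹).val.conjTranspose * σ.val.conjTranspose = 1 := by
        rw [← Matrix.conjTranspose_mul, h1, Matrix.conjTranspose_one]
      calc (σ⁻¹).val.conjTranspose * psi n lam * (σ⁻¹).val
          = (σ⁻¹).val.conjTranspose * (σ.val.conjTranspose * psi n lam * σ.val) * (σ⁻¹).val := by
            rw [hσ]
        _ = ((σ⁻¹).val.conjTranspose * σ.val.conjTranspose) * psi n lam *
              (σ.val * (σ⁻¹).val) := by simp only [mul_assoc]
        _ = psi n lam := by rw [h1, h2, one_mul, mul_one]
    · have h := Λ.neg_mem (hσq ((σ⁻¹).val.mulVec v))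
      have h1 : σ.val.mulVec ((σ⁻¹).val.mulVec v) = v := by
        rw [Matrix.mulVec_mulVec]; simp
      rw [h1] at h
      simpa using h

/-- `qε_{ij}(a) = I + a e_{ij} - ā e_{ρ(j)ρ(i)}`. -/
def qe {n : ℕ} (i j : Fin n) (a : R) : Matrix (Fin n ⊕ Fin n) (Fin n ⊕ Fin n) R :=
  1 + Matrix.single (Sum.inl i) (Sum.inl j) a
    - Matrix.single (Sum.inr j) (Sum.inr i) (star a)

/-- `qr_{ij}(a) = I + a e_{iρ(j)} - conj(lam) ā e_{jρ(i)}` for `i ≠ j`. -/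
def qr {n : ℕ} (lam : R) (i j : Fin n) (a : R) :
    Matrix (Fin n ⊕ Fin n) (Fin n ⊕ Fin n) R :=
  1 + Matrix.single (Sum.inl i) (Sum.inr j) a
    - Matrix.single (Sum.inl j) (Sum.inr i) (star lam * star a)

/-- `qr_{ii}(a) = I + a e_{iρ(i)}`. -/
def qrDiag {n : ℕ} (i : Fin n) (a : R) : Matrix (Fin n ⊕ Fin n) (Fin n ⊕ Fin n) R :=
  1 + Matrix.single (Sum.inl i) (Sum.inr i) a

/-- `ql_{ij}(a) = I + a e_{ρ(i)j} - lam ā e_{ρ(j)i}` for `i ≠ j`. -/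
def ql {n : ℕ} (lam : R) (i j : Fin n) (a : R) :
    Matrix (Fin n ⊕ Fin n) (Fin n ⊕ Fin n) R :=
  1 + Matrix.single (Sum.inr i) (Sum.inl j) a
    - Matrix.single (Sum.inr j) (Sum.inl i) (lam * star a)

/-- `ql_{ii}(a) = I + a e_{ρ(i)i}`. -/
def qlDiag {n : ℕ} (i : Fin n) (a : R) : Matrix (Fin n ⊕ Fin n) (Fin n ⊕ Fin n) R :=
  1 + Matrix.single (Sum.inr i) (Sum.inl i) a

/-- The elementary quadratic matrices of size `2n` over `(R, Λ)`. For the form `ψ_n`, the parameter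
of `ql_{ii}` runs through `Λ` and that of `qr_{ii}` through the conjugate of `Λ`, which is
`conj(lam) * Λ` (and is `Λ` if `lam = ±1`). -/
inductive IsElementaryQuadratic (n : ℕ) (lam : R) (Λ : AddSubgroup R) :
    Matrix (Fin n ⊕ Fin n) (Fin n ⊕ Fin n) R → Prop
  | qe (i j : Fin n) (a : R) (hij : i ≠ j) : IsElementaryQuadratic n lam Λ (qe i j a)
  | qr (i j : Fin n) (a : R) (hij : i ≠ j) : IsElementaryQuadratic n lam Λ (qr lam i j a)
  | ql (i j : Fin n) (a : R) (hij : i ≠ j) : IsElementaryQuadratic n lam Λ (ql lam i j a)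
  | qrDiag (i : Fin n) (a : R) (ha : star a ∈ Λ) : IsElementaryQuadratic n lam Λ (qrDiag i a)
  | qlDiag (i : Fin n) (a : R) (ha : a ∈ Λ) : IsElementaryQuadratic n lam Λ (qlDiag i a)

/-- The elementary quadratic group `EQ(2n, R, Λ)`, generated by the elementary quadratic
matrices. -/
def EQ (n : ℕ) (lam : R) (Λ : AddSubgroup R) : Subgroup (GL (Fin n ⊕ Fin n) R) :=
  Subgroup.closure {σ | IsElementaryQuadratic n lam Λ σ.val}

end Form

section Graded

variable {R : Type*} [Ring R] (𝒜 : ℕ → AddSubgroup R) [GradedRing 𝒜]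

/-- The map `ε : R → R[X]`, `b_0 + b_1 + b_2 + ⋯ ↦ b_0 + b_1 X + b_2 X² + ⋯`. -/
def epsilon (b : R) : Polynomial R :=
  DirectSum.toAddMonoid
    (fun i => (Polynomial.monomial i).toAddMonoidHom.comp (𝒜 i).subtype)
    (DirectSum.decompose 𝒜 b)

/-- `b⁺(a) = ε(b)(a)`. -/
def plusEval (b a : R) : R := (epsilon 𝒜 b).eval a

end Graded

section Localization

variable {R : Type*} [Ring R] [StarRing R] (𝒜 : ℕ → AddSubgroup R) [GradedRing 𝒜]
  (m : Ideal (Subring.center (𝒜 0)))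

/-- The multiplicative set of denominators of `R_m`, for a prime ideal `m` of `C(R_0)`: the central
elements `s` of `R` such that `s` and `s̄` both lie in `C(R_0) \ m`. If `C(R_0) ⊆ C(R)` and `m` is
stable under the involution, then this is `C(R_0) \ m`. -/
def denominators [m.IsPrime] : Submonoid (Subring.center R) where
  carrier := {s | (∃ c : Subring.center (𝒜 0), c ∉ m ∧ ((c : 𝒜 0) : R) = s) ∧
    (∃ c : Subring.center (𝒜 0), c ∉ m ∧ ((c : 𝒜 0) : R) = star (s : R))}
  one_mem' := by
    have h1 : (1 : Subring.center (𝒜 0)) ∉ m :=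
      fun h => Ideal.IsPrime.ne_top ‹m.IsPrime› ((Ideal.eq_top_iff_one m).2 h)
    exact ⟨⟨1, h1, by simp⟩, ⟨1, h1, by simp⟩⟩
  mul_mem' := by
    rintro s t ⟨⟨c, hc, hcs⟩, ⟨c', hc', hcs'⟩⟩ ⟨⟨d, hd, hdt⟩, ⟨d', hd', hdt'⟩⟩
    refine ⟨⟨c * d, fun h => ?_, ?_⟩, ⟨d' * c', fun h => ?_, ?_⟩⟩
    · exact (Ideal.IsPrime.mem_or_mem ‹m.IsPrime› h).elim hc hd
    · simp [hcs, hdt]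
    · exact (Ideal.IsPrime.mem_or_mem ‹m.IsPrime› h).elim hd' hc'
    · simp [hcs', hdt']

/-- The ring of fractions `R_m`. -/
abbrev LocalRing [m.IsPrime] : Type _ := LocalizedModule (denominators 𝒜 m) R

/-- The canonical ring homomorphism `R → R_m`. -/
def toLocal [m.IsPrime] : R →+* LocalRing 𝒜 m :=
  LocalizedModule.numeratorRingHom

/-- The involution on the denominators. -/
def starDenominator [m.IsPrime] (s : denominators 𝒜 m) : denominators 𝒜 m :=
  ⟨⟨star (s.1 : R), Set.star_mem_center s.1.2⟩, s.2.2, by simpa using s.2.1⟩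

theorem denominators_smul_def [m.IsPrime] (s : denominators 𝒜 m) (x : R) :
    s • x = (s.1 : R) * x := rfl

theorem star_denominators_smul [m.IsPrime] (s : denominators 𝒜 m) (x : R) :
    star (s • x) = starDenominator 𝒜 m s • star x := by
  rw [denominators_smul_def, denominators_smul_def, star_mul]
  exact (Subring.mem_center_iff.1 (starDenominator 𝒜 m s).1.2 (star x))

theorem starDenominator_mul [m.IsPrime] (s t : denominators 𝒜 m) :
    starDenominator 𝒜 m (s * t) = starDenominator 𝒜 m s * starDenominator 𝒜 m t := by
  apply Subtype.ext
  apply Subtype.ext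
  change star ((s.1 : R) * (t.1 : R)) = star (s.1 : R) * star (t.1 : R)
  rw [star_mul]
  exact (Subring.mem_center_iff.1 (starDenominator 𝒜 m s).1.2 (star (t.1 : R)))

/-- The involution of `R_m` induced by that of `R`: `conj (r / s) = r̄ / s̄`. -/
def localStar [m.IsPrime] (x : LocalRing 𝒜 m) : LocalRing 𝒜 m :=
  LocalizedModule.liftOn x
    (fun p => LocalizedModule.mk (star p.1) (starDenominator 𝒜 m p.2)) (by
      rintro ⟨a, s⟩ ⟨b, t⟩ hab
      obtain ⟨u, hu⟩ := hab
      refine LocalizedModule.mk_eq.2 ⟨starDenominator 𝒜 m u, ?_⟩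
      have h := congrArg star hu
      simpa only [star_denominators_smul] using h)

theorem localStar_mk [m.IsPrime] (a : R) (s : denominators 𝒜 m) :
    localStar 𝒜 m (LocalizedModule.mk a s) =
      LocalizedModule.mk (star a) (starDenominator 𝒜 m s) :=
  LocalizedModule.liftOn_mk _ _ _

instance [m.IsPrime] : StarRing (LocalRing 𝒜 m) where
  star := localStar 𝒜 m
  star_involutive x := by
    induction x using LocalizedModule.induction_on with
    | h a s =>
      rw [localStar_mk, localStar_mk, star_star]
      congr 1
      apply Subtype.ext
      apply Subtype.ext
      exact star_star _
  star_mul x y := by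
    induction x using LocalizedModule.induction_on with
    | h a s =>
      induction y using LocalizedModule.induction_on with
      | h b t =>
        change localStar 𝒜 m _ = localStar 𝒜 m _ * localStar 𝒜 m _
        rw [LocalizedModule.mk_mul_mk, localStar_mk, localStar_mk, localStar_mk,
          LocalizedModule.mk_mul_mk, star_mul, starDenominator_mul, mul_comm]
  star_add x y := by
    induction x using LocalizedModule.induction_on with
    | h a s =>
      induction y using LocalizedModule.induction_on with
      | h b t =>
        change localStar 𝒜 m _ = localStar 𝒜 m _ + localStar 𝒜 m _
        rw [LocalizedModule.mk_add_mk, localStar_mk, localStar_mk, localStar_mk,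
          LocalizedModule.mk_add_mk, star_add, star_denominators_smul, star_denominators_smul,
          starDenominator_mul]

/-- The form parameter `Λ_m` of `R_m`: the additive subgroup generated by the fractions
`x / (s̄ s)` with `x ∈ Λ`, that is, the smallest form parameter which contains the image of `Λ`. -/
def localFormParameter [m.IsPrime] (Λ : AddSubgroup R) : AddSubgroup (LocalRing 𝒜 m) :=
  AddSubgroup.closure {y | ∃ x ∈ Λ, ∃ s : denominators 𝒜 m,
    y = LocalizedModule.mk x (starDenominator 𝒜 m s * s)}

/-- The image `α_m` in `GL(2n, R_m)` of a matrix `α ∈ GL(2n, R)`. -/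
def localMatrix [m.IsPrime] {n : ℕ} (α : GL (Fin n ⊕ Fin n) R) :
    GL (Fin n ⊕ Fin n) (LocalRing 𝒜 m) :=
  Units.map (toLocal 𝒜 m).mapMatrix.toMonoidHom α

end Localization

end QuadraticGroup

end

open scoped DirectSum

noncomputable section

namespace QuadraticGroup

open Matrix MulOpposite

/-! Both assertions hold for every ring in the setting, so the equivalence joins two true
statements. Both follow from one local-global principle over `R[X]`, in the manner of Quillen and
Suslin.

The scalars are the ring A = `formScalars` of symmetric central elements of degree zero that
stabilize Λ. A denominator s of R_m can be traded for its norm s̄s, which lies in A outside m, so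
R_m is a localization of R at elements of A (`isFormLocalization_toLocal`). Moreover C(R_0) is
integral over A, so every maximal ideal of A lies under some m (`exists_isMaximal_comap_eq`).

For g over R[X] with g(0) = 1, the a ∈ A for which g(Y + aX)g(Y)⁻¹ is elementary form an ideal. If g
becomes elementary over R_m[X], the dilation principle `exists_scale_mem_EQ` yields such an a
outside m: the substitution X ↦ tX clears denominators, because conjugation by a fixed elementary
matrix carries root elements with sufficiently divisible parameters to products of root elements of
prescribed level (`exists_level_conj`, where n ≥ 3 matters). If this happens at every m, the ideal
is all of A and g is elementary (`mem_EQ_of_local`).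

For assertion 2, the matrix ε(α) is 1 at X = 0 and α at X = 1. Since ε extends to R_m → R_m[X], it
is locally elementary, hence elementary.

For assertion 1, a root element with parameter aX is conjugated by σ; the result is 1 at X = 0 and
is a transvection along the unimodular isotropic vector σe_i. Working modulo an ideal with Artinian
quotient, elementary moves give this vector a coordinate that is a unit in R_m (`exists_EQ_isUnit`).
Over R_m it is then moved to a basis vector (`exists_EQ_mulVec_eq_bas`), and isotropic transvections
involving a basis vector are elementary (`matMem_EQ_tau`). Here the principle is applied to the
trivial grading of R. -/

/-- `lam` is a central unitary element and `Λ` is a `lam`-form parameter. -/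
structure IsFormRing {R : Type*} [Ring R] [StarRing R] (lam : R) (Λ : AddSubgroup R) : Prop where
  center : ∀ x : R, lam * x = x * lam
  unitary : lam * star lam = 1
  form : IsFormParameter lam Λ

/-! ### Transvections of the hyperbolic space and their multiplication rules -/

section Calculus

variable {R : Type*} [Ring R] [StarRing R] {n : ℕ} {lam : R}

/-- The row vector `v̄ᵗ * ψ_n`. -/
def flat (lam : R) (v : Fin n ⊕ Fin n → R) : Fin n ⊕ Fin n → R :=
  Sum.elim (fun i => star (v (Sum.inr i)) * lam) (fun i => star (v (Sum.inl i)))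

/-- The `lam`-Hermitian form with matrix `ψ_n`. -/
def herm (lam : R) (v w : Fin n ⊕ Fin n → R) : R := flat lam v ⬝ᵥ w

/-- The matrix of `x ↦ u * c * herm v x`. -/
def rk (lam : R) (u : Fin n ⊕ Fin n → R) (c : R) (v : Fin n ⊕ Fin n → R) :
    Matrix (Fin n ⊕ Fin n) (Fin n ⊕ Fin n) R :=
  Matrix.of fun i j => u i * c * flat lam v j

/-- The transvection with two isotropic orthogonal vectors. -/
def tau (lam : R) (u : Fin n ⊕ Fin n → R) (a : R) (v : Fin n ⊕ Fin n → R) :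
    Matrix (Fin n ⊕ Fin n) (Fin n ⊕ Fin n) R :=
  1 + rk lam u a v - rk lam v (star lam * star a) u

/-- The transvection with one isotropic vector. -/
def ell (lam : R) (u : Fin n ⊕ Fin n → R) (a : R) :
    Matrix (Fin n ⊕ Fin n) (Fin n ⊕ Fin n) R :=
  1 + rk lam u a u

theorem flat_add (v w : Fin n ⊕ Fin n → R) : flat lam (v + w) = flat lam v + flat lam w := by
  ext (i | i) <;> simp [flat, add_mul]

/-- Vectors form a right module, written `op a • v`, so that matrices act linearly from the left.
The involution turns this into a left action on rows. -/
theorem flat_smul (v : Fin n ⊕ Fin n → R) (a : R) :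
    flat lam (op a • v) = star a • flat lam v := by
  ext (i | i) <;> simp [flat, mul_assoc]

theorem flat_eq_vecMul (v : Fin n ⊕ Fin n → R) : flat lam v = star v ᵥ* psi n lam := by
  ext (i | i) <;> simp [flat, vecMul, dotProduct, psi, Fintype.sum_sum_type, Matrix.diagonal_apply,
    Matrix.one_apply, Pi.star_apply]

theorem herm_add_left (u v w : Fin n ⊕ Fin n → R) :
    herm lam (u + v) w = herm lam u w + herm lam v w := by
  simp [herm, flat_add, add_dotProduct]

theorem herm_add_right (u v w : Fin n ⊕ Fin n → R) :
    herm lam u (v + w) = herm lam u v + herm lam u w := by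
  simp [herm, dotProduct_add]

theorem herm_smul_right (u v : Fin n ⊕ Fin n → R) (a : R) :
    herm lam u (op a • v) = herm lam u v * a := by
  simp only [herm, dotProduct, Finset.sum_mul, Pi.smul_apply, op_smul_eq_mul, mul_assoc]

theorem herm_smul_left (u v : Fin n ⊕ Fin n → R) (a : R) :
    herm lam (op a • u) v = star a * herm lam u v := by
  simp [herm, flat_smul, smul_dotProduct]

theorem star_central (hc : ∀ x : R, lam * x = x * lam) (x : R) : star lam * x = x * star lam := by
  have := congrArg star (hc (star x))
  simpa using this.symm

theorem star_mul_self_of_unitary (hc : ∀ x : R, lam * x = x * lam) (hu : lam * star lam = 1) :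
    star lam * lam = 1 := by rw [← hc, hu]

theorem herm_eq_sesq (v w : Fin n ⊕ Fin n → R) (hc : ∀ x : R, lam * x = x * lam) :
    herm lam v w = sesq v w + lam * star (sesq w v) := by
  simp only [herm, dotProduct, Fintype.sum_sum_type, flat, sesq, Sum.elim_inl, Sum.elim_inr,
    star_sum, star_mul, star_star, Finset.mul_sum]
  rw [add_comm]
  congr 1
  exact Finset.sum_congr rfl fun i _ => by rw [← mul_assoc, hc]

theorem herm_symm (hc : ∀ x : R, lam * x = x * lam) (hu : lam * star lam = 1)
    (v w : Fin n ⊕ Fin n → R) : herm lam v w = lam * star (herm lam w v) := by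
  rw [herm_eq_sesq v w hc, herm_eq_sesq w v hc]
  simp only [star_add, star_mul, star_star, mul_add]
  rw [← star_central hc, ← mul_assoc, hu, one_mul, add_comm]

theorem herm_eq_zero_comm (hc : ∀ x : R, lam * x = x * lam) (hu : lam * star lam = 1)
    {v w : Fin n ⊕ Fin n → R} (h : herm lam v w = 0) : herm lam w v = 0 := by
  rw [herm_symm hc hu, h]; simp

theorem rk_add_left (u u' : Fin n ⊕ Fin n → R) (c : R) (v : Fin n ⊕ Fin n → R) :
    rk lam (u + u') c v = rk lam u c v + rk lam u' c v := by
  ext i j; simp [rk, add_mul]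

theorem rk_add_right (u : Fin n ⊕ Fin n → R) (c : R) (v v' : Fin n ⊕ Fin n → R) :
    rk lam u c (v + v') = rk lam u c v + rk lam u c v' := by
  ext i j; simp [rk, flat_add, mul_add]

theorem rk_add (u : Fin n ⊕ Fin n → R) (c d : R) (v : Fin n ⊕ Fin n → R) :
    rk lam u (c + d) v = rk lam u c v + rk lam u d v := by
  ext i j; simp [rk, mul_add, add_mul]

theorem rk_neg (u : Fin n ⊕ Fin n → R) (c : R) (v : Fin n ⊕ Fin n → R) :
    rk lam u (-c) v = -rk lam u c v := by
  ext i j; simp [rk]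

theorem rk_sub (u : Fin n ⊕ Fin n → R) (c d : R) (v : Fin n ⊕ Fin n → R) :
    rk lam u (c - d) v = rk lam u c v - rk lam u d v := by
  rw [sub_eq_add_neg, rk_add, rk_neg, sub_eq_add_neg]

theorem rk_zero (u v : Fin n ⊕ Fin n → R) : rk lam u 0 v = 0 := by
  ext i j; simp [rk]

theorem rk_smul_left (u : Fin n ⊕ Fin n → R) (a c : R) (v : Fin n ⊕ Fin n → R) :
    rk lam (op a • u) c v = rk lam u (a * c) v := by
  ext i j; simp [rk, mul_assoc]

theorem rk_smul_right (u : Fin n ⊕ Fin n → R) (c a : R)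
    (v : Fin n ⊕ Fin n → R) :
    rk lam u c (op a • v) = rk lam u (c * star a) v := by
  ext i j; simp [rk, flat_smul, mul_assoc]

theorem rk_mul_rk (u v w x : Fin n ⊕ Fin n → R) (c d : R) :
    rk lam u c v * rk lam w d x = rk lam u (c * herm lam v w * d) x := by
  ext i j
  simp only [rk, Matrix.mul_apply, Matrix.of_apply, herm, dotProduct, Finset.mul_sum,
    Finset.sum_mul]
  exact Finset.sum_congr rfl fun k _ => by simp only [mul_assoc]

theorem rk_mulVec (u v x : Fin n ⊕ Fin n → R) (c : R) :
    rk lam u c v *ᵥ x = op (c * herm lam v x) • u := by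
  ext i
  simp only [rk, mulVec, dotProduct, Matrix.of_apply, herm, Pi.smul_apply, op_smul_eq_mul,
    Finset.mul_sum]
  exact Finset.sum_congr rfl fun k _ => by simp only [mul_assoc]

theorem mul_rk (σ : Matrix (Fin n ⊕ Fin n) (Fin n ⊕ Fin n) R) (u v : Fin n ⊕ Fin n → R) (c : R) :
    σ * rk lam u c v = rk lam (σ *ᵥ u) c v := by
  ext i j
  simp only [rk, Matrix.mul_apply, Matrix.of_apply, mulVec, dotProduct, Finset.sum_mul]
  exact Finset.sum_congr rfl fun k _ => by simp only [mul_assoc]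

theorem rk_mulVec_mul {σ : Matrix (Fin n ⊕ Fin n) (Fin n ⊕ Fin n) R}
    (hσ : σ.conjTranspose * psi n lam * σ = psi n lam) (u v : Fin n ⊕ Fin n → R) (c : R) :
    rk lam u c (σ *ᵥ v) * σ = rk lam u c v := by
  have key : flat lam (σ *ᵥ v) ᵥ* σ = flat lam v := by
    rw [flat_eq_vecMul, flat_eq_vecMul, star_mulVec, vecMul_vecMul, vecMul_vecMul, ← mul_assoc, hσ]
  ext i j
  have := congrFun key j
  simp only [rk, Matrix.mul_apply, Matrix.of_apply, mul_assoc, ← Finset.mul_sum]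
  simp only [vecMul, dotProduct] at this
  rw [this]

theorem herm_mulVec {σ : Matrix (Fin n ⊕ Fin n) (Fin n ⊕ Fin n) R}
    (hσ : σ.conjTranspose * psi n lam * σ = psi n lam) (v w : Fin n ⊕ Fin n → R) :
    herm lam (σ *ᵥ v) (σ *ᵥ w) = herm lam v w := by
  rw [herm, herm, flat_eq_vecMul, flat_eq_vecMul, star_mulVec, dotProduct_mulVec, vecMul_vecMul,
    vecMul_vecMul, ← mul_assoc, hσ]

/-- Moving `rk` past an isometry only replaces its vectors by their images. This equivariance turns
normality into a question about transvections along the vectors σe_i. -/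
theorem mul_tau_mul_inv {σ : GL (Fin n ⊕ Fin n) R}
    (hσ : σ.val.conjTranspose * psi n lam * σ.val = psi n lam) (u v : Fin n ⊕ Fin n → R) (a : R) :
    σ.val * tau lam u a v * (σ⁻¹).val = tau lam (σ.val *ᵥ u) a (σ.val *ᵥ v) := by
  have h : tau lam (σ.val *ᵥ u) a (σ.val *ᵥ v) * σ.val = σ.val * tau lam u a v := by
    simp only [tau, add_mul, sub_mul, rk_mulVec_mul hσ, mul_add, mul_sub, mul_rk, one_mul, mul_one]
  rw [← h, mul_assoc, Units.mul_inv, mul_one]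

theorem mul_ell_mul_inv {σ : GL (Fin n ⊕ Fin n) R}
    (hσ : σ.val.conjTranspose * psi n lam * σ.val = psi n lam) (u : Fin n ⊕ Fin n → R) (a : R) :
    σ.val * ell lam u a * (σ⁻¹).val = ell lam (σ.val *ᵥ u) a := by
  have h : ell lam (σ.val *ᵥ u) a * σ.val = σ.val * ell lam u a := by
    simp only [ell, add_mul, rk_mulVec_mul hσ, mul_add, mul_rk, one_mul, mul_one]
  rw [← h, mul_assoc, Units.mul_inv, mul_one]

theorem tau_symm (hc : ∀ x : R, lam * x = x * lam) (hu : lam * star lam = 1)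
    (u v : Fin n ⊕ Fin n → R) (a : R) :
    tau lam u a v = tau lam v (-(star lam * star a)) u := by
  have h2 := star_mul_self_of_unitary hc hu
  simp only [tau, rk_neg, star_neg, star_mul, star_star, mul_neg]
  rw [← hc, ← mul_assoc, h2, one_mul]
  abel

theorem tau_smul_left (u v : Fin n ⊕ Fin n → R) (a c : R) :
    tau lam (op c • u) a v = tau lam u (c * a) v := by
  simp only [tau, rk_smul_left, rk_smul_right, star_mul, mul_assoc]

theorem tau_smul_right (hc : ∀ x : R, lam * x = x * lam) (u v : Fin n ⊕ Fin n → R) (a c : R) :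
    tau lam u a (op c • v) = tau lam u (a * star c) v := by
  simp only [tau, rk_smul_left, rk_smul_right, star_mul, star_star]
  rw [← mul_assoc, ← mul_assoc, star_central hc]

theorem ell_smul (u : Fin n ⊕ Fin n → R) (a c : R) :
    ell lam (op c • u) a = ell lam u (c * a * star c) := by
  simp only [ell, rk_smul_left, rk_smul_right, mul_assoc]

theorem tau_self (u : Fin n ⊕ Fin n → R) (a : R) :
    tau lam u a u = ell lam u (a - star lam * star a) := by
  simp only [tau, ell, rk_sub]; abel

theorem tau_mul_tau_left {u u' v : Fin n ⊕ Fin n → R} (b : R) (hvv : herm lam v v = 0)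
    (huv : herm lam u v = 0) (hvu' : herm lam v u' = 0) :
    tau lam u b v * tau lam u' b v =
      tau lam (u + u') b v - rk lam v (star lam * star b * herm lam u u' * b) v := by
  simp only [tau, mul_add, add_mul, mul_sub, sub_mul, rk_mul_rk, rk_add_left, rk_add_right,
    hvv, huv, hvu', mul_zero, zero_mul, rk_zero, mul_one, one_mul]
  abel

/-- The vectors u and u' need not be orthogonal; their pairing produces the long factor along v.
That case does occur, when a long root element moves `bas i` along `bas i.swap`. -/
theorem tau_add_left {u u' v : Fin n ⊕ Fin n → R} (b : R) (hvv : herm lam v v = 0)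
    (huv : herm lam u v = 0) (hvu' : herm lam v u' = 0)
    (hu'v : herm lam u' v = 0) :
    tau lam (u + u') b v = tau lam u b v * tau lam u' b v *
      ell lam v (star lam * star b * herm lam u u' * b) := by
  rw [tau_mul_tau_left b hvv huv hvu']
  simp only [tau, ell, mul_add, add_mul, sub_mul, rk_mul_rk, rk_add_left, rk_add_right,
    hvv, huv, hu'v, mul_zero, zero_mul, rk_zero, mul_one, one_mul]
  abel

theorem tau_add_mid {u v : Fin n ⊕ Fin n → R} (a b : R) (huu : herm lam u u = 0)
    (hvv : herm lam v v = 0) (huv : herm lam u v = 0) (hvu : herm lam v u = 0) :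
    tau lam u (a + b) v = tau lam u a v * tau lam u b v := by
  simp only [tau, mul_add, add_mul, mul_sub, sub_mul, rk_mul_rk, star_add, rk_add,
    hvv, huv, hvu, huu, mul_zero, zero_mul, rk_zero, mul_one, one_mul]
  abel

theorem ell_add_mid {u : Fin n ⊕ Fin n → R} (a b : R) (huu : herm lam u u = 0) :
    ell lam u (a + b) = ell lam u a * ell lam u b := by
  simp only [ell, mul_add, add_mul, rk_mul_rk, rk_add, huu, mul_zero, zero_mul, rk_zero, mul_one,
    one_mul]
  abel

/-- Skew-symmetry of b lets the two mixed terms, u with u' and u' with u, combine into a single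
`tau`. -/
theorem ell_add_left {u u' : Fin n ⊕ Fin n → R} (b : R) (hb : b = -(star lam * star b))
    (huu : herm lam u u = 0)
    (huu' : herm lam u u' = 0) (hu'u : herm lam u' u = 0) (hu'u' : herm lam u' u' = 0) :
    ell lam (u + u') b = ell lam u b * ell lam u' b * tau lam u b u' := by
  have : rk lam u' b u = - rk lam u' (star lam * star b) u := by
    rw [← rk_neg, ← hb]
  simp only [tau, ell, mul_add, add_mul, mul_sub, rk_mul_rk, rk_add_left, rk_add_right,
    huu, huu', hu'u, hu'u', mul_zero, zero_mul, rk_zero, mul_one, one_mul, this]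
  abel

/-- The pairs (w, c) with w orthogonal to u multiply as in a Heisenberg group. Isotropy of w is not
required, so w can be assembled one coordinate at a time. -/
theorem tau_one_mul_tau_one (hc : ∀ x : R, lam * x = x * lam)
    {u w w' : Fin n ⊕ Fin n → R} (c c' : R) (huu : herm lam u u = 0)
    (hwu : herm lam w u = 0) (hw'u : herm lam w' u = 0)
    (huw' : herm lam u w' = 0) :
    tau lam u 1 w * ell lam u c * (tau lam u 1 w' * ell lam u c') =
      tau lam u 1 (w + w') * ell lam u (c + c' - star lam * herm lam w w') := by
  simp only [tau, ell, mul_add, add_mul, mul_sub, sub_mul, rk_mul_rk, rk_add_left, rk_add_right,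
    rk_add, rk_sub, star_one,
    huu, hw'u, hwu, huw', mul_zero, zero_mul, rk_zero, mul_one, one_mul, star_central hc, add_zero]
  abel

theorem tau_mulVec (u v x : Fin n ⊕ Fin n → R) (a : R) :
    tau lam u a v *ᵥ x =
      x + op (a * herm lam v x) • u - op (star lam * star a * herm lam u x) • v := by
  simp only [tau, sub_mulVec, add_mulVec, one_mulVec, rk_mulVec]

theorem ell_mulVec (u x : Fin n ⊕ Fin n → R) (a : R) :
    ell lam u a *ᵥ x = x + op (a * herm lam u x) • u := by
  simp only [ell, add_mulVec, one_mulVec, rk_mulVec]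

end Calculus

end QuadraticGroup

end

noncomputable section

namespace QuadraticGroup

open Matrix MulOpposite

/-! ### Standard basis and weights -/

section Vectors

variable {R : Type*} [Ring R] {n : ℕ} {lam : R}

/-- The standard basis vectors. -/
def bas (i : Fin n ⊕ Fin n) : Fin n ⊕ Fin n → R := Pi.single i 1

/-- The value of the Hermitian form on `(e_i, e_{ρ(i)})`. -/
def wt (lam : R) (i : Fin n ⊕ Fin n) : R := Sum.elim (fun _ => 1) (fun _ => lam) i

theorem wt_central (hc : ∀ x : R, lam * x = x * lam) (i : Fin n ⊕ Fin n) (x : R) :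
    wt lam i * x = x * wt lam i := by
  rcases i with i | i <;> simp [wt, hc]

theorem bas_decomp (x : Fin n ⊕ Fin n → R) : x = ∑ i, op (x i) • bas i := by
  ext j
  simp [bas, Finset.sum_apply, Pi.single_apply]

end Vectors

/-! ### Isotropic vectors and the parameters of long transvections -/

section Basis

variable {R : Type*} [Ring R] [StarRing R] {n : ℕ} {lam : R}

theorem flat_bas (i : Fin n ⊕ Fin n) : flat lam (bas i) = Pi.single i.swap (wt lam i) := by
  rcases i with i | i <;> ext (j | j) <;> simp [flat, bas, wt, Pi.single_apply, apply_ite (star : R → R)]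

theorem herm_bas_left (i : Fin n ⊕ Fin n) (x : Fin n ⊕ Fin n → R) :
    herm lam (bas i) x = wt lam i * x i.swap := by
  simp [herm, flat_bas]

theorem herm_bas (i j : Fin n ⊕ Fin n) :
    herm lam (bas i) (bas j) = if j = i.swap then wt lam i else 0 := by
  rw [herm_bas_left]
  simp only [bas, Pi.single_apply, eq_comm]
  split_ifs <;> simp

theorem herm_bas_of_ne {i j : Fin n ⊕ Fin n} (h : j ≠ i.swap) :
    herm lam (bas i) (bas j) = 0 := by rw [herm_bas, if_neg h]

theorem swap_ne (i : Fin n ⊕ Fin n) : i ≠ i.swap := by rcases i with i | i <;> simp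

theorem ne_swap_comm {i j : Fin n ⊕ Fin n} (h : j ≠ i.swap) : i ≠ j.swap := by
  rintro rfl; simp at h

theorem wt_unitary (hu : lam * star lam = 1) (i : Fin n ⊕ Fin n) :
    wt lam i * star (wt lam i) = 1 := by
  rcases i with i | i <;> simp [wt, hu]

theorem sesq_add (v w : Fin n ⊕ Fin n → R) :
    sesq (v + w) (v + w) = sesq v v + sesq w w + (sesq v w + sesq w v) := by
  simp only [sesq, Pi.add_apply, star_add, mul_add, add_mul, Finset.sum_add_distrib]
  abel

theorem sesq_smul (v w : Fin n ⊕ Fin n → R) (a b : R) :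
    sesq (op a • v) (op b • w) = star a * sesq v w * b := by
  simp only [sesq, Pi.smul_apply, op_smul_eq_mul, star_mul, Finset.mul_sum, Finset.sum_mul,
    mul_assoc]

theorem sesq_bas (i : Fin n ⊕ Fin n) : sesq (bas i) (bas i : Fin n ⊕ Fin n → R) = 0 := by
  rcases i with i | i <;> simp [sesq, bas]

variable {Λ : AddSubgroup R}

theorem IsFormRing.star_mul_self (h : IsFormRing lam Λ) : star lam * lam = 1 :=
  star_mul_self_of_unitary h.center h.unitary

/-- Modulo Λ, the map v ↦ f(v, v) is a quadratic form with polarization `herm`: the error is x − λx̄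
with x = f(w, v). -/
theorem sesq_add_sub_mem (h : IsFormRing lam Λ) (v w : Fin n ⊕ Fin n → R) :
    sesq (v + w) (v + w) - (sesq v v + sesq w w + herm lam v w) ∈ Λ := by
  rw [sesq_add, herm_eq_sesq v w h.center]
  have := h.form.min_le (sesq w v)
  convert this using 1
  abel

/-- The vector `v` is isotropic for the hyperbolic quadratic form. -/
def IsIsotropic (Λ : AddSubgroup R) (v : Fin n ⊕ Fin n → R) : Prop := sesq v v ∈ Λ

theorem isIsotropic_bas (i : Fin n ⊕ Fin n) : IsIsotropic Λ (bas i) := by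
  simp [IsIsotropic, sesq_bas]

theorem IsIsotropic.smul (h : IsFormRing lam Λ) {v : Fin n ⊕ Fin n → R} (hv : IsIsotropic Λ v)
    (a : R) : IsIsotropic Λ (op a • v) := by
  rw [IsIsotropic, sesq_smul]
  exact h.form.conj_mem _ hv a

theorem IsIsotropic.herm_self (h : IsFormRing lam Λ) {v : Fin n ⊕ Fin n → R}
    (hv : IsIsotropic Λ v) : herm lam v v = 0 := by
  rw [herm_eq_sesq v v h.center]
  nth_rw 1 [h.form.le_max _ hv]
  simp

theorem IsIsotropic.mulVec {v : Fin n ⊕ Fin n → R} (hv : IsIsotropic Λ v)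
    {σ : GL (Fin n ⊕ Fin n) R} (hσ : σ ∈ GQ n lam Λ) : IsIsotropic Λ (σ.val *ᵥ v) := by
  have := Λ.add_mem (hσ.2 v) hv
  simpa [IsIsotropic] using this

/-- The parameters of the transvections `ell`. -/
def conjParam (Λ : AddSubgroup R) : AddSubgroup R := Λ.comap (starAddEquiv : R ≃+ R).toAddMonoidHom

theorem mem_conjParam {a : R} : a ∈ conjParam Λ ↔ star a ∈ Λ := Iff.rfl

theorem conjParam_eq (h : IsFormRing lam Λ) {a : R} (ha : a ∈ conjParam Λ) :
    a = -(star lam * star a) := by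
  have := congrArg star (h.form.le_max _ ha)
  rw [star_neg, star_mul, star_star, ← star_central h.center] at this
  simpa using this

/-- On either side skew-symmetry gives λa = −ā. -/
theorem mem_conjParam_iff (h : IsFormRing lam Λ) {a : R} : a ∈ conjParam Λ ↔ lam * a ∈ Λ := by
  constructor
  · intro ha
    rw [conjParam_eq h ha, mul_neg, ← mul_assoc, h.unitary, one_mul]
    exact Λ.neg_mem ha
  · intro ha
    have := h.form.le_max _ ha
    rw [star_mul, ← star_central h.center, ← mul_assoc, h.unitary, one_mul] at this
    rw [mem_conjParam, ← neg_neg (star a), ← this]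
    exact Λ.neg_mem ha

theorem sub_mem_conjParam (h : IsFormRing lam Λ) (a : R) :
    a - star lam * star a ∈ conjParam Λ := by
  rw [mem_conjParam, star_sub, star_mul, star_star, star_star, ← h.center]
  simpa using h.form.min_le (star a)

theorem conj_mem_conjParam (h : IsFormRing lam Λ) {a : R} (ha : a ∈ conjParam Λ) (c : R) :
    c * a * star c ∈ conjParam Λ := by
  rw [mem_conjParam]
  simpa [mul_assoc] using h.form.conj_mem _ ha (star c)

end Basis

/-! ### Membership in a linear group for matrices given by formulas -/

section MatMem

variable {R : Type*} [Ring R] {n : ℕ}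

/-- The matrix `M` belongs to the group `G`. -/
def MatMem (G : Subgroup (GL (Fin n ⊕ Fin n) R)) (M : Matrix (Fin n ⊕ Fin n) (Fin n ⊕ Fin n) R) :
    Prop := ∃ g ∈ G, g.val = M

variable {G : Subgroup (GL (Fin n ⊕ Fin n) R)} {M N : Matrix (Fin n ⊕ Fin n) (Fin n ⊕ Fin n) R}

theorem MatMem.mul (hM : MatMem G M) (hN : MatMem G N) : MatMem G (M * N) := by
  obtain ⟨g, hg, rfl⟩ := hM
  obtain ⟨k, hk, rfl⟩ := hN
  exact ⟨g * k, G.mul_mem hg hk, rfl⟩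

theorem MatMem.of_mul_left (h : MatMem G (M * N)) (hM : MatMem G M) : MatMem G N := by
  obtain ⟨g, hg, rfl⟩ := hM
  obtain ⟨k, hk, h⟩ := h
  refine ⟨g⁻¹ * k, G.mul_mem (G.inv_mem hg) hk, ?_⟩
  rw [Units.val_mul, h, ← mul_assoc, Units.inv_mul, one_mul]

theorem MatMem.of_mul_right (h : MatMem G (M * N)) (hN : MatMem G N) : MatMem G M := by
  obtain ⟨g, hg, rfl⟩ := hN
  obtain ⟨k, hk, h⟩ := h
  refine ⟨k * g⁻¹, G.mul_mem hk (G.inv_mem hg), ?_⟩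
  rw [Units.val_mul, h, mul_assoc, Units.mul_inv, mul_one]

theorem matMem_val {g : GL (Fin n ⊕ Fin n) R} : MatMem G g.val ↔ g ∈ G :=
  ⟨fun ⟨_, hk, h⟩ => Units.ext h ▸ hk, fun h => ⟨g, h, rfl⟩⟩

theorem matMem_one : MatMem G (1 : Matrix (Fin n ⊕ Fin n) (Fin n ⊕ Fin n) R) :=
  ⟨1, G.one_mem, rfl⟩

end MatMem

/-! ### Root elements and the elementary group -/

section Groups

variable {R : Type*} [Ring R] [StarRing R] {n : ℕ}

/-- The root element with parameter `a`, for a pair `i, j` of indices with `j ≠ ρ(i)`. -/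
abbrev root (lam : R) (i : Fin n ⊕ Fin n) (a : R) (j : Fin n ⊕ Fin n) :
    Matrix (Fin n ⊕ Fin n) (Fin n ⊕ Fin n) R := tau lam (bas i) a (bas j)

/-- The long root element with parameter `a`. -/
abbrev longRoot (lam : R) (i : Fin n ⊕ Fin n) (a : R) :
    Matrix (Fin n ⊕ Fin n) (Fin n ⊕ Fin n) R := ell lam (bas i) a

/-- The root elements with short parameters in `P` and long parameters in `L`. -/
inductive IsRoot (n : ℕ) (lam : R) (P L : Set R) :
    Matrix (Fin n ⊕ Fin n) (Fin n ⊕ Fin n) R → Prop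
  | short (i j : Fin n ⊕ Fin n) (a : R) (hij : j ≠ i) (hij' : j ≠ i.swap) (ha : a ∈ P) :
      IsRoot n lam P L (root lam i a j)
  | long (i : Fin n ⊕ Fin n) (a : R) (ha : a ∈ L) : IsRoot n lam P L (longRoot lam i a)

/-- The group generated by root elements. -/
def rootGroup (n : ℕ) (lam : R) (P L : Set R) : Subgroup (GL (Fin n ⊕ Fin n) R) :=
  Subgroup.closure {σ | IsRoot n lam P L σ.val}

variable {M : Matrix (Fin n ⊕ Fin n) (Fin n ⊕ Fin n) R} {lam : R} {Λ : AddSubgroup R}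

theorem herm_bas_self (i : Fin n ⊕ Fin n) : herm lam (bas i) (bas i) = 0 :=
  herm_bas_of_ne (swap_ne i)

theorem root_mul_root {i j : Fin n ⊕ Fin n} (hij : j ≠ i.swap) (a b : R) :
    root lam i a j * root lam i b j = root lam i (a + b) j :=
  (tau_add_mid a b (herm_bas_self i) (herm_bas_self j) (herm_bas_of_ne hij)
    (herm_bas_of_ne (ne_swap_comm hij))).symm

theorem root_zero (i j : Fin n ⊕ Fin n) : root lam i 0 j = 1 := by
  simp [root, tau, rk_zero]

theorem longRoot_mul_longRoot (i : Fin n ⊕ Fin n) (a b : R) :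
    longRoot lam i a * longRoot lam i b = longRoot lam i (a + b) :=
  (ell_add_mid a b (herm_bas_self i)).symm

theorem longRoot_zero (i : Fin n ⊕ Fin n) : longRoot lam i 0 = 1 := by
  simp [longRoot, ell, rk_zero]

/-- The root element as an invertible matrix. -/
def rootUnit (lam : R) (i : Fin n ⊕ Fin n) (a : R) (j : Fin n ⊕ Fin n) (hij : j ≠ i.swap) :
    GL (Fin n ⊕ Fin n) R :=
  ⟨root lam i a j, root lam i (-a) j, by rw [root_mul_root hij, add_neg_cancel, root_zero],
    by rw [root_mul_root hij, neg_add_cancel, root_zero]⟩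

/-- The long root element as an invertible matrix. -/
def longRootUnit (lam : R) (i : Fin n ⊕ Fin n) (a : R) : GL (Fin n ⊕ Fin n) R :=
  ⟨longRoot lam i a, longRoot lam i (-a),
    by rw [longRoot_mul_longRoot, add_neg_cancel, longRoot_zero],
    by rw [longRoot_mul_longRoot, neg_add_cancel, longRoot_zero]⟩

theorem IsRoot.exists_unit {P L : Set R} (h : IsRoot n lam P L M) :
    ∃ g : GL (Fin n ⊕ Fin n) R, g.val = M := by
  cases h with
  | short i j a hij hij' ha => exact ⟨rootUnit lam i a j hij', rfl⟩
  | long i a ha => exact ⟨longRootUnit lam i a, rfl⟩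

theorem IsRoot.matMem {P L : Set R} (h : IsRoot n lam P L M) :
    MatMem (rootGroup n lam P L) M := by
  obtain ⟨g, rfl⟩ := h.exists_unit
  exact ⟨g, Subgroup.subset_closure h, rfl⟩

theorem IsRoot.inv {P L : AddSubgroup R} {g : GL (Fin n ⊕ Fin n) R}
    (h : IsRoot n lam P L g.val) : IsRoot n lam P L (g⁻¹).val := by
  generalize hM : g.val = M at h
  cases h with
  | short i j a hij hij' ha =>
    have : g = rootUnit lam i a j hij' := Units.ext hM
    rw [this]
    exact IsRoot.short i j (-a) hij hij' (P.neg_mem ha)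
  | long i a ha =>
    have : g = longRootUnit lam i a := Units.ext hM
    rw [this]
    exact IsRoot.long i (-a) (L.neg_mem ha)

/-- A root subgroup depends only on the unordered pair of indices. Later case distinctions use this
to choose which of the two indices is fixed by a conjugation. -/
theorem root_symm (h : IsFormRing lam Λ) (i j : Fin n ⊕ Fin n) (a : R) :
    root lam i a j = root lam j (-(star lam * star a)) i := tau_symm h.center h.unitary _ _ _

/-- Root elements with `j = i` are long root elements. -/
theorem matMem_root {P L : Set R} (hPL : ∀ a ∈ P, a - star lam * star a ∈ L)
    {i j : Fin n ⊕ Fin n} (hij : j ≠ i.swap) {a : R} (ha : a ∈ P) :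
    MatMem (rootGroup n lam P L) (root lam i a j) := by
  by_cases h : j = i
  · subst h
    rw [root, tau_self]
    exact (IsRoot.long j _ (hPL a ha)).matMem
  · exact (IsRoot.short i j a h hij ha).matMem

theorem matMem_longRoot {P L : Set R} (i : Fin n ⊕ Fin n) {a : R} (ha : a ∈ L) :
    MatMem (rootGroup n lam P L) (longRoot lam i a) := (IsRoot.long i a ha).matMem

theorem rk_bas (i j : Fin n ⊕ Fin n) (a : R) :
    rk lam (bas i) a (bas j) = Matrix.single i j.swap (a * wt lam j) := by
  ext k l
  simp only [rk, Matrix.of_apply, flat_bas, Matrix.single_apply]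
  simp only [bas, Pi.single_apply, eq_comm (a := i), eq_comm (a := j.swap)]
  by_cases hk : k = i <;> by_cases hl : l = j.swap <;> simp [hk, hl]

/-- With indices in the doubled set, the three off-diagonal families are the short roots and the two
diagonal families the long ones. A second index of the form `Sum.inr` carries the weight λ, so
parameters are twisted by λ̄ there; this twist carries Λ onto `conjParam Λ`. -/
theorem isElementaryQuadratic_iff (h : IsFormRing lam Λ) :
    IsElementaryQuadratic n lam Λ M ↔ IsRoot n lam (⊤ : AddSubgroup R) (conjParam Λ) M := by
  have hc := h.center
  have hs := star_central hc
  have h2 := h.star_mul_self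
  have h1 := h.unitary
  have k1 : ∀ x, star lam * (lam * x) = x := fun x => by rw [← mul_assoc, h2, one_mul]
  have hqe : ∀ (i j : Fin n) a, qe i j a = root lam (Sum.inl i) (a * star lam) (Sum.inr j) := by
    intro i j a
    simp [qe, root, tau, rk_bas, wt, mul_assoc, h2, hc]
    rw [← hc (star a), k1]
  have hqr : ∀ (i j : Fin n) a, qr lam i j a = root lam (Sum.inl i) a (Sum.inl j) := by
    intro i j a
    simp [qr, root, tau, rk_bas, wt]
  have hql : ∀ (i j : Fin n) a,
      ql lam i j a = root lam (Sum.inr i) (a * star lam) (Sum.inr j) := by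
    intro i j a
    simp [ql, root, tau, rk_bas, wt, mul_assoc, h2, hc]
    rw [← mul_assoc (star a), ← hc (star a * lam), k1]
  have hd : ∀ (i : Fin n) a, qrDiag i a = longRoot lam (Sum.inl i) a := by
    intro i a
    simp [qrDiag, longRoot, ell, rk_bas, wt]
  have hl : ∀ (i : Fin n) a, qlDiag i a = longRoot lam (Sum.inr i) (a * star lam) := by
    intro i a
    simp [qlDiag, longRoot, ell, rk_bas, wt, mul_assoc, h2]
  have hmem : ∀ a, a * star lam ∈ conjParam Λ ↔ a ∈ Λ := by
    intro a
    rw [mem_conjParam_iff h, ← mul_assoc, hc, mul_assoc, h1, mul_one]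
  have k2 : ∀ a, a = (a * lam) * star lam := fun a => by rw [mul_assoc, h1, mul_one]
  constructor
  · rintro (⟨i, j, a, hij⟩ | ⟨i, j, a, hij⟩ | ⟨i, j, a, hij⟩ | ⟨i, a, ha⟩ | ⟨i, a, ha⟩)
    · rw [hqe]; exact .short _ _ _ (by simp) (by simpa using hij.symm) trivial
    · rw [hqr]; exact .short _ _ _ (by simpa using hij.symm) (by simp) trivial
    · rw [hql]; exact .short _ _ _ (by simpa using hij.symm) (by simp) trivial
    · rw [hd]; exact .long _ _ ha
    · rw [hl]; exact .long _ _ ((hmem a).2 ha)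
  · rintro (⟨i | i, j | j, a, hij, hij', -⟩ | ⟨i | i, a, ha⟩)
    · rw [← hqr]; exact .qr _ _ _ (by simpa using Ne.symm hij)
    · rw [k2 a, ← hqe]; exact .qe _ _ _ (by simpa using Ne.symm hij')
    · rw [root_symm h, k2 (-(star lam * star a)), ← hqe]
      exact .qe _ _ _ (by simpa using hij')
    · rw [k2 a, ← hql]; exact .ql _ _ _ (by simpa using Ne.symm hij)
    · rw [← hd]; exact .qrDiag _ _ ha
    · rw [k2 a] at ha ⊢
      rw [← hl]; exact .qlDiag _ _ ((hmem _).1 ha)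

theorem EQ_eq_rootGroup (h : IsFormRing lam Λ) :
    EQ n lam Λ = rootGroup n lam (⊤ : AddSubgroup R) (conjParam Λ) := by
  rw [EQ, rootGroup]
  congr 1
  ext σ
  exact isElementaryQuadratic_iff h

end Groups

end QuadraticGroup

end

noncomputable section

namespace QuadraticGroup

open Matrix MulOpposite

section Vectors

variable {R : Type*} [Ring R] {n : ℕ} {lam : R}

theorem MatMem.exists_mulVec {G : Subgroup (GL (Fin n ⊕ Fin n) R)}
    {M : Matrix (Fin n ⊕ Fin n) (Fin n ⊕ Fin n) R} (h : MatMem G M) (v : Fin n ⊕ Fin n → R) :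
    ∃ g ∈ G, g.val *ᵥ v = M *ᵥ v := by
  obtain ⟨g, hg, rfl⟩ := h
  exact ⟨g, hg, rfl⟩

theorem wt_mul_wt_swap (i : Fin n ⊕ Fin n) : wt lam i * wt lam i.swap = lam := by
  rcases i with i | i <;> simp [wt]

end Vectors

/-! ### Transvections along basis vectors, and elementary orbits of isotropic vectors -/

section Elementary

variable {R : Type*} [Ring R] [StarRing R] {n : ℕ} {lam : R} {Λ : AddSubgroup R}

theorem conjTranspose_mul_psi_mul {σ : Matrix (Fin n ⊕ Fin n) (Fin n ⊕ Fin n) R}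
    (h : ∀ v w, herm lam (σ *ᵥ v) (σ *ᵥ w) = herm lam v w) :
    σ.conjTranspose * psi n lam * σ = psi n lam := by
  ext i j
  have key := h (bas i) (bas j)
  have hs : star (bas i : Fin n ⊕ Fin n → R) = Pi.single i 1 := by
    ext k; simp [bas, Pi.single_apply, apply_ite (star : R → R)]
  rw [herm, herm, flat_eq_vecMul, flat_eq_vecMul, star_mulVec, dotProduct_mulVec, vecMul_vecMul,
    vecMul_vecMul, ← mul_assoc, hs] at key
  simpa [bas] using key

theorem mem_GQ_of_eq_tau (h : IsFormRing lam Λ) {σ : GL (Fin n ⊕ Fin n) R}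
    {u v : Fin n ⊕ Fin n → R} {a : R} (hσ : σ.val = tau lam u a v) (hu : IsIsotropic Λ u)
    (hv : IsIsotropic Λ v) (huv : herm lam u v = 0) : σ ∈ GQ n lam Λ := by
  have hc := h.center
  have hvu := herm_eq_zero_comm hc h.unitary huv
  have huu := hu.herm_self h
  have hvv := hv.herm_self h
  have k1 : ∀ x, star lam * (lam * x) = x := fun x => by
    rw [← mul_assoc, h.star_mul_self, one_mul]
  refine ⟨conjTranspose_mul_psi_mul fun x y => ?_, fun x => ?_⟩
  · rw [hσ, tau_mulVec, tau_mulVec, sub_eq_add_neg, sub_eq_add_neg, ← neg_smul, ← neg_smul,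
      ← op_neg, ← op_neg]
    simp only [herm_add_left, herm_add_right, herm_smul_left, herm_smul_right, huv, hvu, huu, hvv,
      mul_zero, add_zero, star_mul, star_neg, star_star]
    rw [herm_symm hc h.unitary x u, herm_symm hc h.unitary x v]
    have e1 : lam * star (herm lam v x) * -(star lam * star a * herm lam u y) =
        -(star (herm lam v x) * star a * herm lam u y) := by
      rw [hc, mul_neg, mul_assoc, ← mul_assoc lam, ← mul_assoc lam, h.unitary, one_mul,
        ← mul_assoc]
    rw [e1]
    have e2 : -(star (herm lam u x) * (a * lam)) * herm lam v y =
        - (lam * star (herm lam u x) * (a * herm lam v y)) := by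
      rw [← hc a, ← mul_assoc (star _), ← hc (star _)]
      simp only [neg_mul, mul_assoc]
    rw [e2]
    simp only [mul_assoc]
    abel
  · set w := op (a * herm lam v x) • u - op (star lam * star a * herm lam u x) • v with hw
    have hwv : tau lam u a v *ᵥ x = x + w := by rw [tau_mulVec, hw, add_sub_assoc]
    rw [hσ, hwv]
    have hww : sesq w w ∈ Λ := by
      have h1 := sesq_add_sub_mem h (op (a * herm lam v x) • u)
        (op (-(star lam * star a * herm lam u x)) • v)
      rw [herm_smul_left, herm_smul_right, huv, zero_mul, mul_zero, add_zero] at h1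
      have h2 := Λ.add_mem h1 (Λ.add_mem (hu.smul h (a * herm lam v x))
        (hv.smul h (-(star lam * star a * herm lam u x))))
      rw [sub_add_cancel, op_neg, neg_smul, ← sub_eq_add_neg] at h2
      exact h2
    have hxw : herm lam x w ∈ Λ := by
      have := Λ.neg_mem (h.form.min_le (star (herm lam v x) * star a * herm lam u x))
      convert this using 1
      rw [hw, sub_eq_add_neg, ← neg_smul, ← op_neg, herm_add_right, herm_smul_right,
        herm_smul_right, herm_symm hc h.unitary x u, herm_symm hc h.unitary x v]
      have e1 : lam * star (herm lam v x) * -(star lam * star a * herm lam u x) =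
          -(star (herm lam v x) * star a * herm lam u x) := by
        rw [hc, mul_neg, mul_assoc, ← mul_assoc lam, ← mul_assoc lam, h.unitary, one_mul,
          ← mul_assoc]
      rw [e1]
      simp only [star_mul, star_star, mul_assoc]
      abel
    have := Λ.add_mem (sesq_add_sub_mem h x w) (Λ.add_mem hww hxw)
    convert this using 1
    abel

theorem mem_GQ_of_eq_ell (h : IsFormRing lam Λ) {σ : GL (Fin n ⊕ Fin n) R}
    {u : Fin n ⊕ Fin n → R} {a : R} (hσ : σ.val = ell lam u a) (hu : IsIsotropic Λ u)
    (ha : a ∈ conjParam Λ) : σ ∈ GQ n lam Λ := by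
  have hc := h.center
  have huu := hu.herm_self h
  refine ⟨conjTranspose_mul_psi_mul fun x y => ?_, fun x => ?_⟩
  · rw [hσ, ell_mulVec, ell_mulVec]
    simp only [herm_add_left, herm_add_right, herm_smul_left, herm_smul_right, huu,
      mul_zero, add_zero, star_mul]
    rw [herm_symm hc h.unitary x u]
    have e1 : lam * star (herm lam u x) * (a * herm lam u y) =
      - (star (herm lam u x) * star a * herm lam u y) := by
      nth_rw 1 [conjParam_eq h ha]
      rw [neg_mul, mul_neg, hc, mul_assoc, ← mul_assoc lam, ← mul_assoc lam, h.unitary, one_mul,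
        ← mul_assoc]
    rw [e1]
    abel
  · rw [hσ, ell_mulVec]
    have h1 := sesq_add_sub_mem h x (op (a * herm lam u x) • u)
    have h2 : herm lam x (op (a * herm lam u x) • u) ∈ Λ := by
      rw [herm_smul_right, herm_symm hc h.unitary x u]
      have := h.form.conj_mem _ ((mem_conjParam_iff h).1 ha) (herm lam u x)
      rw [← mul_assoc, ← hc] at this
      rwa [← mul_assoc]
    have := Λ.add_mem h1 (Λ.add_mem (hu.smul h (a * herm lam u x)) h2)
    convert this using 1
    abel

theorem EQ_le_GQ (h : IsFormRing lam Λ) : EQ n lam Λ ≤ GQ n lam Λ := by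
  rw [EQ_eq_rootGroup h, rootGroup, Subgroup.closure_le]
  intro σ hσ
  generalize hM : σ.val = M at hσ
  rw [Set.mem_ofPred_eq, hM] at hσ
  cases hσ with
  | short i j a hij hij' ha =>
    exact mem_GQ_of_eq_tau h hM (isIsotropic_bas i) (isIsotropic_bas j) (herm_bas_of_ne hij')
  | long i a ha => exact mem_GQ_of_eq_ell h hM (isIsotropic_bas i) ha

theorem matMem_EQ_root (h : IsFormRing lam Λ) {i j : Fin n ⊕ Fin n} (hij : j ≠ i.swap) (a : R) :
    MatMem (EQ n lam Λ) (root lam i a j) := by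
  rw [EQ_eq_rootGroup h]
  exact matMem_root (fun a _ => sub_mem_conjParam h a) hij trivial

theorem matMem_EQ_longRoot (h : IsFormRing lam Λ) (i : Fin n ⊕ Fin n) {a : R}
    (ha : a ∈ conjParam Λ) : MatMem (EQ n lam Λ) (longRoot lam i a) := by
  rw [EQ_eq_rootGroup h]
  exact matMem_longRoot i ha

theorem apply_swap_eq_zero (hu : lam * star lam = 1) (hc : ∀ x : R, lam * x = x * lam)
    {i : Fin n ⊕ Fin n} {w : Fin n ⊕ Fin n → R} (hw : herm lam (bas i) w = 0) :
    w i.swap = 0 := by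
  rw [herm_bas_left, wt_central hc] at hw
  rw [← mul_one (w i.swap), ← wt_unitary hu i, ← mul_assoc, hw, zero_mul]

/-- The coordinates of w are added one by one, each contributing a root element, and c collects the
pairings created on the way. It is not canonical: the congruence λc ≡ −f(w, w) modulo Λ determines
it up to `conjParam Λ`. -/
theorem exists_matMem_tau_mul_ell (h : IsFormRing lam Λ) (i : Fin n ⊕ Fin n)
    (w : Fin n ⊕ Fin n → R) (hw : herm lam (bas i) w = 0) :
    ∃ c, lam * c + sesq w w ∈ Λ ∧ MatMem (EQ n lam Λ) (tau lam (bas i) 1 w * ell lam (bas i) c) := by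
  have hc := h.center
  suffices hs : ∀ s : Finset (Fin n ⊕ Fin n),
      herm lam (bas i) (∑ j ∈ s, op (w j) • bas j) = 0 ∧ ∃ c,
      lam * c + sesq (∑ j ∈ s, op (w j) • bas j) (∑ j ∈ s, op (w j) • bas j) ∈ Λ ∧
      MatMem (EQ n lam Λ) (tau lam (bas i) 1 (∑ j ∈ s, op (w j) • bas j) * ell lam (bas i) c) by
    have := (hs Finset.univ).2
    rwa [← bas_decomp w] at this
  intro s
  induction s using Finset.induction_on with
  | empty =>
    have ht : tau lam (bas i) 1 0 = 1 := by
      simpa [root, tau, rk_zero] using tau_smul_right (u := bas i) (v := bas i) hc 1 0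
    refine ⟨by simp [herm], 0, by simp [sesq], ?_⟩
    rw [Finset.sum_empty, ht, one_mul, ← longRoot, longRoot_zero]
    exact matMem_one
  | insert j s hj ih =>
    obtain ⟨h0, c, hcΛ, hmem⟩ := ih
    rw [Finset.sum_insert hj]
    have hb : herm lam (bas i) (op (w j) • bas j) = 0 := by
      rw [herm_smul_right]
      by_cases hij : j = i.swap
      · rw [hij, apply_swap_eq_zero h.unitary hc hw, mul_zero]
      · rw [herm_bas_of_ne hij, zero_mul]
    have hm : MatMem (EQ n lam Λ) (tau lam (bas i) 1 (op (w j) • bas j) * ell lam (bas i) 0) := by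
      rw [← longRoot, longRoot_zero, mul_one, tau_smul_right hc, one_mul]
      -- No root element exists for the coordinate at `i.swap`, but w vanishes there because it is
      -- orthogonal to `bas i`.
      by_cases hij : j = i.swap
      · rw [hij, apply_swap_eq_zero h.unitary hc hw, star_zero, ← root, root_zero]
        exact matMem_one
      · exact matMem_EQ_root h hij _
    refine ⟨by rw [herm_add_right, hb, h0, add_zero], 0 + c - star lam *
      herm lam (op (w j) • bas j) (∑ j ∈ s, op (w j) • bas j), ?_, ?_⟩
    rotate_left
    · rw [← tau_one_mul_tau_one hc 0 c (herm_bas_self i)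
        (herm_eq_zero_comm hc h.unitary hb) (herm_eq_zero_comm hc h.unitary h0) h0]
      exact hm.mul hmem
    · have h1 := sesq_add_sub_mem h (op (w j) • bas j) (∑ j ∈ s, op (w j) • bas j)
      have h2 : sesq (op (w j) • bas j) (op (w j) • bas j : Fin n ⊕ Fin n → R) = 0 := by
        rw [sesq_smul, sesq_bas]; simp
      rw [h2, zero_add] at h1
      have := Λ.add_mem h1 hcΛ
      convert this using 1
      rw [zero_add, mul_sub, ← mul_assoc, h.unitary, one_mul]
      abel

/-- A transvection with a basis vector is elementary. -/
theorem matMem_EQ_tau (h : IsFormRing lam Λ) (i : Fin n ⊕ Fin n) (a : R)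
    {w : Fin n ⊕ Fin n → R} (hw : herm lam (bas i) w = 0) (hwΛ : IsIsotropic Λ w) :
    MatMem (EQ n lam Λ) (tau lam (bas i) a w) := by
  have e : tau lam (bas i) a w = tau lam (bas i) 1 (op (star a) • w) := by
    rw [tau_smul_right h.center, star_star, one_mul]
  rw [e]
  obtain ⟨c, hcΛ, hmem⟩ := exists_matMem_tau_mul_ell h i (op (star a) • w)
    (by rw [herm_smul_right, hw, zero_mul])
  -- Isotropy of w forces λc ∈ Λ, so the superfluous factor `ell` is a long root element and can be
  -- cancelled.
  refine hmem.of_mul_right (matMem_EQ_longRoot h i ?_)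
  rw [mem_conjParam_iff h]
  simpa using Λ.sub_mem hcΛ (hwΛ.smul h (star a))

theorem isUnit_wt (h : IsFormRing lam Λ) (i : Fin n ⊕ Fin n) : IsUnit (wt lam i) :=
  ⟨⟨wt lam i, star (wt lam i), wt_unitary h.unitary i,
    by rw [← wt_central h.center, wt_unitary h.unitary i]⟩, rfl⟩

/-- If a coordinate of an isotropic vector is a unit, all others can be removed. -/
theorem exists_EQ_mulVec_eq_smul_bas (h : IsFormRing lam Λ) {v : Fin n ⊕ Fin n → R}
    (hv : IsIsotropic Λ v) (k : Fin n ⊕ Fin n) (hk : IsUnit (v k)) :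
    ∃ g ∈ EQ n lam Λ, g.val *ᵥ v = op (v k) • bas k := by
  have hc := h.center
  set p := k.swap with hp
  have hpk : p.swap = k := by simp [hp]
  obtain ⟨c, hcv⟩ : IsUnit (herm lam (bas p) v) := by
    rw [herm_bas_left, hpk]
    exact (isUnit_wt h p).mul hk
  obtain ⟨a, hav⟩ := hk
  set v' := v - op (v k) • bas k - op (v p) • bas p with hv'
  have hpv' : herm lam (bas p) v' = 0 := by
    rw [herm_bas_left, hv', hpk]
    simp [bas, hp, swap_ne]
  -- The transvection along `bas p` subtracts y · λ̄c, up to a multiple of `bas p`; this y makes the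
  -- subtracted vector equal to v'.
  set y := op (lam * (c⁻¹).val) • v' with hy
  obtain ⟨c', -, hm⟩ := exists_matMem_tau_mul_ell h p y
    (by rw [hy, herm_smul_right, hpv', zero_mul])
  obtain ⟨g, hg, hgv⟩ := hm.exists_mulVec v
  obtain ⟨e, he⟩ : ∃ e : R, g.val *ᵥ v = op (v k) • bas k + op e • bas p := by
    refine ⟨v p + c' * c.val + herm lam y (v + op (c' * c.val) • bas p), ?_⟩
    have hpp : herm lam (bas p) (v + op (c' * c.val) • bas p) = c.val := by
      rw [herm_add_right, herm_smul_right, herm_bas_self, zero_mul, add_zero, hcv]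
    rw [hgv, ← mulVec_mulVec, ell_mulVec, tau_mulVec, ← hcv, hpp, star_one, mul_one, one_mul]
    have : op (star lam * c.val) • y = v' := by
      rw [hy, smul_smul, ← op_mul, mul_assoc, ← mul_assoc _ (star lam), ← star_central hc,
        mul_assoc, Units.inv_mul, mul_one, h.unitary, op_one, one_smul]
    rw [this, hv']
    ext i
    simp only [Pi.add_apply, Pi.sub_apply, Pi.smul_apply, op_smul_eq_mul, mul_add]
    abel
  have hiso : IsIsotropic Λ (op (v k) • bas k + op e • bas p) := by
    rw [← he]
    exact hv.mulVec (EQ_le_GQ h hg)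
  -- The remaining vector is supported on the hyperbolic pair k, p. Its isotropy is what makes the
  -- last coordinate removable by a long root element.
  have hmem : wt lam k * e * (a⁻¹).val ∈ Λ := by
    have h1 := Λ.sub_mem hiso (sesq_add_sub_mem h (op (v k) • bas k) (op e • bas p))
    rw [sub_sub_cancel, sesq_smul, sesq_smul, sesq_bas, sesq_bas, herm_smul_left, herm_smul_right,
      herm_bas, if_pos hp, mul_zero, zero_mul, mul_zero, zero_mul, zero_add, zero_add] at h1
    have h2 := h.form.conj_mem _ h1 (a⁻¹).val
    rw [← hav, ← mul_assoc, ← star_mul, Units.mul_inv, star_one, one_mul] at h2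
    exact h2
  have hd : -(e * (c⁻¹).val) ∈ conjParam Λ := by
    rw [mem_conjParam_iff h, mul_neg]
    refine Λ.neg_mem ?_
    convert hmem using 1
    have hcinv : wt lam k * (a⁻¹).val = lam * (c⁻¹).val := by
      rw [Units.eq_mul_inv_iff_mul_eq, hcv, herm_bas_left, hpk, ← hav, wt_central hc p, mul_assoc,
        ← mul_assoc (a⁻¹).val, Units.inv_mul, one_mul, hp, wt_mul_wt_swap]
    rw [← mul_assoc, hc, mul_assoc, ← hcinv, ← mul_assoc, wt_central hc]
  obtain ⟨g', hg', hgv'⟩ := (matMem_EQ_longRoot h p hd).exists_mulVec (g.val *ᵥ v)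
  refine ⟨g' * g, (EQ n lam Λ).mul_mem hg' hg, ?_⟩
  rw [Units.val_mul, ← mulVec_mulVec, hgv', he, ell_mulVec, herm_add_right, herm_smul_right,
    herm_smul_right, herm_bas_self, zero_mul, add_zero]
  have : herm lam (bas p) (bas k) * v k = c.val := by
    rw [hcv, herm_bas_left, herm_bas_left, hpk]; simp [bas]
  rw [this, neg_mul, mul_assoc, Units.inv_mul, mul_one, op_neg, neg_smul, add_neg_cancel_right]

/-- The unit v k is not rescaled directly. Its inverse is used to create the coordinate 1 at j, and
j then serves as pivot. -/
theorem exists_EQ_mulVec_eq_bas_of_ne (h : IsFormRing lam Λ) {v : Fin n ⊕ Fin n → R}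
    (hv : IsIsotropic Λ v) {k j : Fin n ⊕ Fin n} (hk : IsUnit (v k)) (hjk : j ≠ k)
    (hjk' : j ≠ k.swap) : ∃ g ∈ EQ n lam Λ, g.val *ᵥ v = bas j := by
  obtain ⟨g, hg, hgv⟩ := exists_EQ_mulVec_eq_smul_bas h hv k hk
  obtain ⟨c, hcv⟩ : IsUnit (wt lam k.swap * v k) := (isUnit_wt h _).mul hk
  have hne : k.swap ≠ j.swap := fun e => hjk (by simpa using congrArg Sum.swap e.symm)
  have hne' : k ≠ j.swap := fun e => hjk' (by simp [e])
  obtain ⟨g1, hg1, hgv1⟩ := (matMem_EQ_root h (i := j) (j := k.swap) hne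
    (c⁻¹).val).exists_mulVec (g.val *ᵥ v)
  have e1 : g1.val *ᵥ (g.val *ᵥ v) = op (v k) • bas k + bas j := by
    rw [hgv1, hgv, tau_mulVec, herm_smul_right, herm_smul_right, herm_bas_of_ne hne', zero_mul,
      mul_zero, op_zero, zero_smul, sub_zero]
    have : herm lam (bas k.swap) (bas k) * v k = c.val := by
      rw [hcv, herm_bas_left]; simp [bas]
    rw [this, Units.inv_mul, op_one, one_smul]
  have hg' := (EQ n lam Λ).mul_mem hg1 hg
  have hiso : IsIsotropic Λ (op (v k) • bas k + bas j) := by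
    rw [← e1, mulVec_mulVec, ← Units.val_mul]
    exact hv.mulVec (EQ_le_GQ h hg')
  have hj : (op (v k) • bas k + bas j : Fin n ⊕ Fin n → R) j = 1 := by
    simp [bas, hjk]
  obtain ⟨g2, hg2, hgv2⟩ := exists_EQ_mulVec_eq_smul_bas h hiso j (by rw [hj]; exact isUnit_one)
  refine ⟨g2 * (g1 * g), (EQ n lam Λ).mul_mem hg2 hg', ?_⟩
  rw [Units.val_mul, Units.val_mul, ← mulVec_mulVec, ← mulVec_mulVec, e1, hgv2, hj, op_one,
    one_smul]

theorem exists_ne_ne_swap (hn : 2 ≤ n) (k : Fin n ⊕ Fin n) : ∃ j, j ≠ k ∧ j ≠ k.swap := by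
  have : Nontrivial (Fin n) := Fin.nontrivial_iff_two_le.2 hn
  rcases k with k | k <;> obtain ⟨j, hj⟩ := exists_ne k <;> exact ⟨Sum.inl j, by simp [hj], by simp [hj]⟩

/-- The elementary orbit of an isotropic vector with a unit coordinate contains the basis. -/
theorem exists_EQ_mulVec_eq_bas (h : IsFormRing lam Λ) (hn : 2 ≤ n) {v : Fin n ⊕ Fin n → R}
    (hv : IsIsotropic Λ v) {k : Fin n ⊕ Fin n} (hk : IsUnit (v k)) (j : Fin n ⊕ Fin n) :
    ∃ g ∈ EQ n lam Λ, g.val *ᵥ v = bas j := by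
  by_cases hjk : j ≠ k ∧ j ≠ k.swap
  · exact exists_EQ_mulVec_eq_bas_of_ne h hv hk hjk.1 hjk.2
  -- If j belongs to the hyperbolic pair of k, pass through a basis vector of another pair.
  · obtain ⟨l, hl, hl'⟩ := exists_ne_ne_swap hn k
    obtain ⟨g, hg, hgv⟩ := exists_EQ_mulVec_eq_bas_of_ne h hv hk hl hl'
    obtain ⟨g', hg', hgv'⟩ := exists_EQ_mulVec_eq_bas_of_ne h (isIsotropic_bas (Λ := Λ) l)
      (k := l) (j := j) (by simp [bas]) (by rintro rfl; exact hjk ⟨hl, hl'⟩)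
      (by rintro rfl; exact hjk ⟨by rintro rfl; simp at hl', by
        rintro e; apply hl; simpa using congrArg Sum.swap e⟩)
    exact ⟨g' * g, (EQ n lam Λ).mul_mem hg' hg, by
      rw [Units.val_mul, ← mulVec_mulVec, hgv, hgv']⟩

end Elementary

end QuadraticGroup

end

noncomputable section

namespace QuadraticGroup

open Matrix MulOpposite

/-! ### Commutator relations between root elements -/

section Commutators

variable {R : Type*} [Ring R] [StarRing R] {n : ℕ} {lam : R} {Λ : AddSubgroup R}

theorem rootUnit_mem_EQ (h : IsFormRing lam Λ) {i j : Fin n ⊕ Fin n} (hij : j ≠ i.swap) (a : R) :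
    rootUnit lam i a j hij ∈ EQ n lam Λ :=
  matMem_val.1 (matMem_EQ_root h hij a)

theorem longRootUnit_mem_EQ (h : IsFormRing lam Λ) (i : Fin n ⊕ Fin n) {a : R}
    (ha : a ∈ conjParam Λ) : longRootUnit lam i a ∈ EQ n lam Λ :=
  matMem_val.1 (matMem_EQ_longRoot h i ha)

theorem root_mulVec_bas_swap (i j : Fin n ⊕ Fin n) (hji : j ≠ i) (a : R) :
    root lam i a j *ᵥ bas j.swap = bas j.swap + op (a * wt lam j) • bas i := by
  rw [tau_mulVec, herm_bas, herm_bas, if_pos rfl, if_neg, mul_zero, op_zero, zero_smul, sub_zero]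
  intro e
  exact hji (by simpa using congrArg Sum.swap e)

theorem root_mulVec_bas_of_ne {i j k : Fin n ⊕ Fin n} (hi : k ≠ i.swap) (hj : k ≠ j.swap) (a : R) :
    root lam i a j *ᵥ bas k = bas k := by
  rw [tau_mulVec, herm_bas_of_ne hi, herm_bas_of_ne hj]
  simp

theorem longRoot_mulVec_bas_swap (i : Fin n ⊕ Fin n) (a : R) :
    longRoot lam i a *ᵥ bas i.swap = bas i.swap + op (a * wt lam i) • bas i := by
  rw [ell_mulVec, herm_bas, if_pos rfl]

theorem longRoot_mulVec_bas_of_ne {i k : Fin n ⊕ Fin n} (hi : k ≠ i.swap) (a : R) :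
    longRoot lam i a *ᵥ bas k = bas k := by
  rw [ell_mulVec, herm_bas_of_ne hi]
  simp

theorem conj_root {g : GL (Fin n ⊕ Fin n) R} (hg : g ∈ GQ n lam Λ)
    {i j l : Fin n ⊕ Fin n} {e : R}
    (hi : g.val *ᵥ bas i = bas i + op e • bas l) (hj : g.val *ᵥ bas j = bas j)
    (hji : j ≠ i.swap) (hjl : j ≠ l.swap) (b : R) :
    g.val * root lam i b j * (g⁻¹).val = root lam i b j * root lam l (e * b) j *
      longRoot lam j (star lam * star b * (herm lam (bas i) (bas l) * e) * b) := by
  rw [mul_tau_mul_inv hg.1, hi, hj, tau_add_left b (herm_bas_self j) (herm_bas_of_ne hji),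
    tau_smul_left, herm_smul_right]
  · rw [herm_smul_right, herm_bas_of_ne (ne_swap_comm hjl), zero_mul]
  · rw [herm_smul_left, herm_bas_of_ne hjl, mul_zero]

theorem conj_longRoot {g : GL (Fin n ⊕ Fin n) R} (h : IsFormRing lam Λ) (hg : g ∈ GQ n lam Λ)
    {i l : Fin n ⊕ Fin n} {e : R} (hi : g.val *ᵥ bas i = bas i + op e • bas l)
    (hil : l ≠ i.swap) {b : R} (hb : b ∈ conjParam Λ) :
    g.val * longRoot lam i b * (g⁻¹).val = longRoot lam i b * longRoot lam l (e * b * star e) *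
      root lam i (b * star e) l := by
  rw [mul_ell_mul_inv hg.1, hi, ell_add_left b (conjParam_eq h hb) (herm_bas_self i),
    ell_smul, tau_smul_right h.center]
  · rw [herm_smul_right, herm_bas_of_ne hil, zero_mul]
  · rw [herm_smul_left, herm_bas_of_ne (ne_swap_comm hil), mul_zero]
  · rw [herm_smul_left, herm_smul_right, herm_bas_self, zero_mul, mul_zero]

/-- Conjugation by the root element on i and `k.swap` adds a multiple of `bas i` to `bas k` and
fixes `bas j`, so additivity of `tau` leaves the wanted factor. The free index k is used to replace
a root element by others that interact well with a given one. -/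
theorem root_eq_commutator (h : IsFormRing lam Λ) {i j k : Fin n ⊕ Fin n} (hij : j ≠ i.swap)
    (hki : k ≠ i) (hki' : k ≠ i.swap) (hkj : j ≠ k) (hkj' : j ≠ k.swap) (a b : R) :
    root lam i (a * wt lam k.swap * b) j =
      root lam k (-b) j * (root lam i a k.swap * root lam k b j * root lam i (-a) k.swap) := by
  have hik : k.swap ≠ i.swap := fun e => hki (by simpa using congrArg Sum.swap e)
  have hki2 : k.swap ≠ i := by rintro rfl; simp at hki'
  have hil : i ≠ k.swap := hki2.symm
  have key := conj_root (EQ_le_GQ h (rootUnit_mem_EQ h hik a)) (i := k) (j := j) (l := i)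
    (e := a * wt lam k.swap)
    (by have := root_mulVec_bas_swap (lam := lam) i k.swap hki2 a; rwa [Sum.swap_swap] at this)
    (root_mulVec_bas_of_ne hij (by simpa using hkj) a) hkj' hij b
  rw [herm_bas_of_ne hil, zero_mul, mul_zero, zero_mul, longRoot_zero, mul_one] at key
  change root lam i a k.swap * root lam k b j * root lam i (-a) k.swap = _ at key
  rw [key, ← mul_assoc, root_mul_root hkj', neg_add_cancel, root_zero, one_mul]

/-- The same move applied to a long root element along `bas k`; the polarization of `ell` leaves one
extra short factor, cancelled on the right. -/
theorem longRoot_eq_commutator (h : IsFormRing lam Λ) {i k : Fin n ⊕ Fin n}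
    (hki : k ≠ i) (hki' : k ≠ i.swap) (a : R) {b : R} (hb : b ∈ conjParam Λ) :
    longRoot lam i (a * wt lam k.swap * b * star (a * wt lam k.swap)) =
      longRoot lam k (-b) * (root lam i a k.swap * longRoot lam k b * root lam i (-a) k.swap) *
        root lam k (-(b * star (a * wt lam k.swap))) i := by
  have hik : k.swap ≠ i.swap := fun e => hki (by simpa using congrArg Sum.swap e)
  have hki2 : k.swap ≠ i := by rintro rfl; simp at hki'
  have key := conj_longRoot h (EQ_le_GQ h (rootUnit_mem_EQ h hik a)) (i := k) (l := i)
    (e := a * wt lam k.swap)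
    (by have := root_mulVec_bas_swap (lam := lam) i k.swap hki2 a; rwa [Sum.swap_swap] at this) hki2.symm hb
  change root lam i a k.swap * longRoot lam k b * root lam i (-a) k.swap = _ at key
  rw [key, ← mul_assoc, ← mul_assoc, longRoot_mul_longRoot, neg_add_cancel, longRoot_zero, one_mul,
    mul_assoc (longRoot lam i _), root_mul_root (ne_swap_comm hki'), add_neg_cancel, root_zero, mul_one]

end Commutators

/-! ### Root elements of given level in a localized form ring -/

section Localization

variable {A R R' : Type*} [CommRing A] [Ring R] [Algebra A R] [Ring R'] [Algebra A R']

/-- The multiples by `s` of the image of `B`. -/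
def level (φ : R →ₐ[A] R') (s : A) (B : AddSubgroup R) : AddSubgroup R' :=
  B.map ((DistribSMul.toAddMonoidHom R' s).comp φ.toRingHom.toAddMonoidHom)

theorem mem_level {φ : R →ₐ[A] R'} {s : A} {B : AddSubgroup R} {y : R'} :
    y ∈ level φ s B ↔ ∃ x ∈ B, s • φ x = y := Iff.rfl

variable {φ : R →ₐ[A] R'}

theorem smul_mem_level_top (s : A) (x : R) : s • φ x ∈ level φ s ⊤ := ⟨x, trivial, rfl⟩

theorem level_mul_le_top (s t : A) : level φ (s * t) (⊤ : AddSubgroup R) ≤ level φ s ⊤ := by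
  rintro _ ⟨x, -, rfl⟩
  refine ⟨t • x, trivial, ?_⟩
  change s • φ (t • x) = (s * t) • φ x
  rw [map_smul, mul_smul]

variable [StarRing R]

/-- The elements of `A` act on the form ring `(R, Λ)`. -/
structure IsFormAlgebra (A : Type*) {R : Type*} [CommRing A] [Ring R] [StarRing R] [Algebra A R]
    (lam : R) (Λ : AddSubgroup R) : Prop extends IsFormRing lam Λ where
  star_smul : ∀ (a : A) (x : R), star (a • x) = a • star x
  smul_mem : ∀ (a : A), ∀ x ∈ Λ, a • x ∈ Λ

variable {n : ℕ} {lam : R} {Λ : AddSubgroup R}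

theorem IsFormAlgebra.smul_mem_conjParam (h : IsFormAlgebra A lam Λ) (a : A) {x : R}
    (hx : x ∈ conjParam Λ) : a • x ∈ conjParam Λ := by
  rw [mem_conjParam, h.star_smul]
  exact h.smul_mem a _ hx

theorem level_mul_le (h : IsFormAlgebra A lam Λ) (s t : A) :
    level φ (s * t) (conjParam Λ) ≤ level φ s (conjParam Λ) := by
  rintro _ ⟨x, hx, rfl⟩
  refine ⟨t • x, h.smul_mem_conjParam t hx, ?_⟩
  change s • φ (t • x) = (s * t) • φ x
  rw [map_smul, mul_smul]

variable [StarRing R']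

/-- The homomorphism `φ` of form rings is a localization at `S`. -/
structure IsFormLocalization (S : Submonoid A) (Λ : AddSubgroup R) (Λ' : AddSubgroup R')
    (φ : R →ₐ[A] R') : Prop where
  map_star : ∀ x, φ (star x) = star (φ x)
  map_mem : ∀ x ∈ Λ, φ x ∈ Λ'
  isUnit : ∀ s ∈ S, IsUnit (algebraMap A R' s)
  surj : ∀ y, ∃ s ∈ S, ∃ x, s • y = φ x
  surj_form : ∀ y ∈ Λ', ∃ s ∈ S, ∃ x ∈ Λ, s • y = φ x
  eq_zero : ∀ x, φ x = 0 → ∃ s ∈ S, s • x = 0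

/-- The group generated by the root elements of level `s`. -/
def levelGroup (n : ℕ) (lam : R) (Λ : AddSubgroup R) (φ : R →ₐ[A] R') (s : A) :
    Subgroup (GL (Fin n ⊕ Fin n) R') :=
  rootGroup n (φ lam) (level φ s ⊤) (level φ s (conjParam Λ))

variable {Λ' : AddSubgroup R'} {S : Submonoid A}

variable (h : IsFormAlgebra A lam Λ) (h' : IsFormAlgebra A (φ lam) Λ')
  (hφ : IsFormLocalization S Λ Λ' φ)

include h h' hφ

theorem sub_mem_level (s : A) : ∀ a ∈ level φ s (⊤ : AddSubgroup R),
    a - star (φ lam) * star a ∈ level φ s (conjParam Λ) := by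
  rintro _ ⟨x, -, rfl⟩
  refine ⟨_, sub_mem_conjParam h.toIsFormRing x, ?_⟩
  change s • φ _ = s • φ x - star (φ lam) * star (s • φ x)
  rw [h'.star_smul, ← hφ.map_star, ← hφ.map_star, map_sub, smul_sub, map_mul, mul_smul_comm]

theorem matMem_levelGroup_root (s : A) {i j : Fin n ⊕ Fin n} (hij : j ≠ i.swap) {a : R'}
    (ha : a ∈ level φ s (⊤ : AddSubgroup R)) :
    MatMem (levelGroup n lam Λ φ s) (root (φ lam) i a j) :=
  matMem_root (sub_mem_level h h' hφ s) hij ha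

omit h h' hφ in
theorem matMem_levelGroup_longRoot (s : A) (i : Fin n ⊕ Fin n) {a : R'}
    (ha : a ∈ level φ s (conjParam Λ)) :
    MatMem (levelGroup n lam Λ φ s) (longRoot (φ lam) i a) :=
  matMem_longRoot i ha

/-- The denominator d of e is absorbed by the level of b: the new short factor contains e and b
once, the long factor contains b twice. The long factor survives only for `l = i.swap`, and then
`hl` supplies a numerator in `conjParam Λ`. -/
theorem matMem_conj_root {g : GL (Fin n ⊕ Fin n) R'} (hg : g ∈ GQ n (φ lam) Λ')
    {i j l : Fin n ⊕ Fin n} {e : R'}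
    (hi : g.val *ᵥ bas i = bas i + op e • bas l) (hj : g.val *ᵥ bas j = bas j)
    (hji : j ≠ i.swap) (hjl : j ≠ l.swap) (s d : A) (hd : ∃ r, d • e = φ r)
    (hl : l = i.swap → ∃ c, e = c * wt (φ lam) l ∧ ∃ x ∈ conjParam Λ, d • c = φ x) {b : R'}
    (hb : b ∈ level φ (s * d * d) (⊤ : AddSubgroup R)) :
    MatMem (levelGroup n lam Λ φ s) (g.val * root (φ lam) i b j * (g⁻¹).val) := by
  have hc := h'.center
  rw [conj_root hg hi hj hji hjl]
  obtain ⟨r, hr⟩ := hd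
  refine ((matMem_levelGroup_root h h' hφ s hji ?_).mul
    (matMem_levelGroup_root h h' hφ s hjl ?_)).mul (matMem_levelGroup_longRoot s j ?_)
  · rw [mul_assoc] at hb
    exact level_mul_le_top s _ hb
  · obtain ⟨x, -, rfl⟩ := hb
    refine ⟨d • (r * x), trivial, ?_⟩
    change s • φ (d • (r * x)) = e * (s * d * d) • φ x
    rw [map_smul, map_mul, ← hr]
    simp only [smul_mul_assoc, mul_smul_comm, smul_smul]
    ring_nf
  · by_cases hli : l = i.swap
    · obtain ⟨c, hec, x, hx, hcx⟩ := hl hli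
      obtain ⟨y, -, rfl⟩ := hb
      refine ⟨(s * d * d * d) • (star y * x * star (star y)),
        h.smul_mem_conjParam _ (conj_mem_conjParam h.toIsFormRing hx (star y)), ?_⟩
      change s • φ _ = star (φ lam) * star ((s * d * d) • φ y) * _ * ((s * d * d) • φ y)
      rw [herm_bas, if_pos hli, hec, ← mul_assoc (wt (φ lam) i), wt_central hc, mul_assoc c, hli,
        wt_mul_wt_swap, star_star, map_smul, map_mul, map_mul, ← hcx, h'.star_smul, hφ.map_star]
      have e1 : star (φ lam) * (s * d * d) • star (φ y) * (c * φ lam) * (s * d * d) • φ y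
          = ((s * d * d) * (s * d * d)) • (star (φ lam) * φ lam * (star (φ y) * c * φ y)) := by
        simp only [smul_mul_assoc, mul_smul_comm, smul_smul]
        congr 1
        rw [← hc c, mul_assoc (star (φ lam)), ← mul_assoc _ (φ lam) c, ← hc (star (φ y))]
        simp only [mul_assoc]
      rw [e1, h'.star_mul_self, one_mul]
      simp only [smul_mul_assoc, mul_smul_comm, smul_smul]
      congr 1
      ring
    · rw [herm_bas_of_ne hli, zero_mul, mul_zero, zero_mul]
      exact zero_mem _

/-- The parameter e · b · ē contains e twice, which is why the level carries d². -/
theorem matMem_conj_longRoot {g : GL (Fin n ⊕ Fin n) R'} (hg : g ∈ GQ n (φ lam) Λ')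
    {i l : Fin n ⊕ Fin n} {e : R'} (hi : g.val *ᵥ bas i = bas i + op e • bas l)
    (hil : l ≠ i.swap) (s d : A) (hd : ∃ r, d • e = φ r) {b : R'}
    (hb : b ∈ level φ (s * d * d) (conjParam Λ)) :
    MatMem (levelGroup n lam Λ φ s) (g.val * longRoot (φ lam) i b * (g⁻¹).val) := by
  obtain ⟨r, hr⟩ := hd
  obtain ⟨x, hx, hxb⟩ := mem_level.1 hb
  have hφx : φ x ∈ conjParam Λ' := by
    rw [mem_conjParam, ← hφ.map_star]
    exact hφ.map_mem _ hx
  rw [conj_longRoot h'.toIsFormRing hg hi hil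
    (by rw [← hxb]; exact h'.smul_mem_conjParam _ hφx)]
  have hr' : d • star e = φ (star r) := by rw [← h'.star_smul, hr, hφ.map_star]
  refine ((matMem_levelGroup_longRoot s i ?_).mul
    (matMem_levelGroup_longRoot s l ?_)).mul (matMem_levelGroup_root h h' hφ s hil ?_)
  · rw [mul_assoc] at hb
    exact level_mul_le h s _ hb
  · refine ⟨r * x * star r, conj_mem_conjParam h.toIsFormRing hx r, ?_⟩
    change s • φ _ = _
    rw [← hxb, map_mul, map_mul, ← hr, ← hr']
    simp only [smul_mul_assoc, mul_smul_comm, smul_smul, mul_assoc]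
  · refine ⟨d • (x * star r), trivial, ?_⟩
    change s • φ _ = _
    rw [← hxb, map_smul, map_mul, ← hr']
    simp only [smul_mul_assoc, mul_smul_comm, smul_smul, mul_assoc]

end Localization

end QuadraticGroup

end

noncomputable section

namespace QuadraticGroup

open Matrix MulOpposite

theorem MatMem.conj {R : Type*} [Ring R] {n : ℕ} {G : Subgroup (GL (Fin n ⊕ Fin n) R)}
    {g : GL (Fin n ⊕ Fin n) R} {M N : Matrix (Fin n ⊕ Fin n) (Fin n ⊕ Fin n) R}
    (hM : MatMem G (g.val * M * (g⁻¹).val)) (hN : MatMem G (g.val * N * (g⁻¹).val)) :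
    MatMem G (g.val * (M * N) * (g⁻¹).val) := by
  have e : g.val * (M * N) * (g⁻¹).val =
      (g.val * M * (g⁻¹).val) * (g.val * N * (g⁻¹).val) := by
    simp only [mul_assoc]
    rw [← mul_assoc (g⁻¹).val g.val, Units.inv_mul, one_mul]
  rw [e]
  exact hM.mul hN

/-- An index outside two given hyperbolic pairs requires three pairs. This is where 2n ≥ 6 is
needed. -/
theorem exists_ne_four {n : ℕ} (hn : 3 ≤ n) (p q : Fin n ⊕ Fin n) :
    ∃ k, k ≠ p ∧ k ≠ p.swap ∧ k ≠ q ∧ k ≠ q.swap := by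
  have key : ∀ a b : Fin n, ∃ c, c ≠ a ∧ c ≠ b := by
    intro a b
    by_contra! hcon
    have hsub : (Finset.univ : Finset (Fin n)) ⊆ {a, b} := fun c _ => by
      by_cases hca : c = a
      · simp [hca]
      · simp [hcon c hca]
    have h1 := Finset.card_le_card hsub
    have h2 := Finset.card_le_two (a := a) (b := b)
    rw [Finset.card_univ, Fintype.card_fin] at h1
    omega
  obtain ⟨c, h1, h2⟩ := key (p.elim id id) (q.elim id id)
  exact ⟨Sum.inl c, by rcases p with p | p <;> rcases q with q | q <;> simp_all⟩

/-! ### Conjugation by elementary matrices keeps high levels under control -/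

section Conjugation

variable {A R R' : Type*} [CommRing A] [Ring R] [Algebra A R] [Ring R'] [Algebra A R']
  {n : ℕ}

theorem map_wt (φ : R →ₐ[A] R') (lam : R) (i : Fin n ⊕ Fin n) : φ (wt lam i) = wt (φ lam) i := by
  rcases i with i | i <;> simp [wt]

variable [StarRing R] [StarRing R'] {lam : R} {Λ : AddSubgroup R} {Λ' : AddSubgroup R'}
  {S : Submonoid A} {φ : R →ₐ[A] R'}

theorem neg_star_mem_level (h' : IsFormAlgebra A (φ lam) Λ') (hφ : IsFormLocalization S Λ Λ' φ)
    (s : A) {a : R'} (ha : a ∈ level φ s (⊤ : AddSubgroup R)) :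
    -(star (φ lam) * star a) ∈ level φ s (⊤ : AddSubgroup R) := by
  obtain ⟨x, -, rfl⟩ := ha
  refine ⟨-(star lam * star x), trivial, ?_⟩
  change s • φ _ = -(star (φ lam) * star (s • φ x))
  rw [h'.star_smul, ← hφ.map_star, ← hφ.map_star, map_neg, smul_neg, map_mul, mul_smul_comm]

variable (h : IsFormAlgebra A lam Λ) (h' : IsFormAlgebra A (φ lam) Λ')
  (hφ : IsFormLocalization S Λ Λ' φ)

include h h' hφ

/-- The conjugating element moves only the basis vectors at `p.swap` and `q.swap`. If one end of the
root is fixed, symmetry makes it j, and `bas i` acquires at most a multiple of one basis vector. -/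
theorem matMem_rootUnit_conj_root {p q : Fin n ⊕ Fin n} (hqp : q ≠ p) (hqp' : q ≠ p.swap)
    (c : R') (s d : A) (hd : ∃ r, d • c = φ r) {i j : Fin n ⊕ Fin n} (hij : j ≠ i.swap)
    (hfix : (j ≠ p.swap ∧ j ≠ q.swap) ∨ (i ≠ p.swap ∧ i ≠ q.swap)) {b : R'}
    (hb : b ∈ level φ (s * d * d) (⊤ : AddSubgroup R)) :
    MatMem (levelGroup n lam Λ φ s) ((rootUnit (φ lam) p c q hqp').val * root (φ lam) i b j *
      ((rootUnit (φ lam) p c q hqp')⁻¹).val) := by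
  wlog hj : j ≠ p.swap ∧ j ≠ q.swap generalizing i j b
  · rw [root_symm h'.toIsFormRing]
    exact this (ne_swap_comm hij) hfix.symm (neg_star_mem_level h' hφ _ hb)
      (hfix.resolve_left hj)
  obtain ⟨r, hr⟩ := hd
  have hg := EQ_le_GQ h'.toIsFormRing (rootUnit_mem_EQ h'.toIsFormRing hqp' c)
  have hjfix := root_mulVec_bas_of_ne (lam := φ lam) hj.1 hj.2 c
  by_cases hiq : i = q.swap
  · subst hiq
    refine matMem_conj_root h h' hφ hg (root_mulVec_bas_swap p q hqp c) hjfix hij hj.1 s d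
      ⟨r * wt lam q, ?_⟩ (fun e => absurd e ?_) hb
    · rw [map_mul, ← hr, map_wt, smul_mul_assoc]
    · simpa using hqp.symm
  · by_cases hip : i = p.swap
    · subst hip
      refine matMem_conj_root h h' hφ hg (e := -(star (φ lam) * star c) * wt (φ lam) p) (l := q)
        ?_ hjfix hij hj.2 s d ⟨-(star lam * star r) * wt lam p, ?_⟩ (fun e => absurd e ?_) hb
      · change root (φ lam) p c q *ᵥ _ = _
        rw [root_symm h'.toIsFormRing]
        exact root_mulVec_bas_swap q p hqp.symm _
      · rw [map_mul, map_neg, map_mul, hφ.map_star, hφ.map_star, ← hr, map_wt, h'.star_smul,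
          ← smul_mul_assoc, smul_neg, mul_smul_comm]
      · simpa using hqp
    · refine matMem_conj_root h h' hφ hg (e := 0) (l := i) ?_ hjfix hij hij s d ⟨0, by simp⟩
        (fun e => absurd e (swap_ne i)) hb
      rw [op_zero, zero_smul, add_zero]
      exact root_mulVec_bas_of_ne hip hiq c

theorem matMem_rootUnit_conj_longRoot {p q : Fin n ⊕ Fin n} (hqp : q ≠ p) (hqp' : q ≠ p.swap)
    (c : R') (s d : A) (hd : ∃ r, d • c = φ r) (i : Fin n ⊕ Fin n) {b : R'}
    (hb : b ∈ level φ (s * d * d) (conjParam Λ)) :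
    MatMem (levelGroup n lam Λ φ s) ((rootUnit (φ lam) p c q hqp').val * longRoot (φ lam) i b *
      ((rootUnit (φ lam) p c q hqp')⁻¹).val) := by
  obtain ⟨r, hr⟩ := hd
  have hg := EQ_le_GQ h'.toIsFormRing (rootUnit_mem_EQ h'.toIsFormRing hqp' c)
  by_cases hiq : i = q.swap
  · subst hiq
    refine matMem_conj_longRoot h h' hφ hg (root_mulVec_bas_swap p q hqp c) ?_ s d
      ⟨r * wt lam q, ?_⟩ hb
    · simpa using hqp.symm
    · rw [map_mul, ← hr, map_wt, smul_mul_assoc]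
  · by_cases hip : i = p.swap
    · subst hip
      refine matMem_conj_longRoot h h' hφ hg (e := -(star (φ lam) * star c) * wt (φ lam) p) (l := q)
        ?_ ?_ s d ⟨-(star lam * star r) * wt lam p, ?_⟩ hb
      · change root (φ lam) p c q *ᵥ _ = _
        rw [root_symm h'.toIsFormRing]
        exact root_mulVec_bas_swap q p hqp.symm _
      · simpa using hqp
      · rw [map_mul, map_neg, map_mul, hφ.map_star, hφ.map_star, ← hr, map_wt, h'.star_smul,
          ← smul_mul_assoc, smul_neg, mul_smul_comm]
    · refine matMem_conj_longRoot h h' hφ hg (e := 0) (l := i) ?_ (swap_ne i) s d ⟨0, by simp⟩ hb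
      rw [op_zero, zero_smul, add_zero]
      exact root_mulVec_bas_of_ne hip hiq c

/-- Only the basis vector at `p.swap` moves, and the distinct indices i and j cannot both be that
index; hence no short root is exceptional here. -/
theorem matMem_longRootUnit_conj_root (p : Fin n ⊕ Fin n) {c : R'} (hc : c ∈ conjParam Λ')
    (s d : A) (hd : ∃ x ∈ conjParam Λ, d • c = φ x) {i j : Fin n ⊕ Fin n} (hji : j ≠ i)
    (hij : j ≠ i.swap) {b : R'} (hb : b ∈ level φ (s * d * d) (⊤ : AddSubgroup R)) :
    MatMem (levelGroup n lam Λ φ s) ((longRootUnit (φ lam) p c).val * root (φ lam) i b j *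
      ((longRootUnit (φ lam) p c)⁻¹).val) := by
  wlog hj : j ≠ p.swap generalizing i j b
  · rw [root_symm h'.toIsFormRing]
    exact this hji.symm (ne_swap_comm hij) (neg_star_mem_level h' hφ _ hb)
      (fun e => hji ((not_not.1 hj).trans e.symm))
  obtain ⟨x, hx, hxc⟩ := hd
  have hg := EQ_le_GQ h'.toIsFormRing (longRootUnit_mem_EQ h'.toIsFormRing p hc)
  have hjfix := longRoot_mulVec_bas_of_ne (lam := φ lam) hj c
  by_cases hip : i = p.swap
  · subst hip
    refine matMem_conj_root h h' hφ hg (longRoot_mulVec_bas_swap p c) hjfix hij hj s d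
      ⟨x * wt lam p, ?_⟩ (fun _ => ⟨c, rfl, x, hx, hxc⟩) hb
    rw [map_mul, ← hxc, map_wt, smul_mul_assoc]
  · refine matMem_conj_root h h' hφ hg (e := 0) (l := i) ?_ hjfix hij hij s d ⟨0, by simp⟩
      (fun e => absurd e (swap_ne i)) hb
    rw [op_zero, zero_smul, add_zero]
    exact longRoot_mulVec_bas_of_ne hip c

theorem matMem_longRootUnit_conj_longRoot (p : Fin n ⊕ Fin n) {c : R'} (hc : c ∈ conjParam Λ')
    (s d : A) {i : Fin n ⊕ Fin n} (hip : i ≠ p.swap) {b : R'}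
    (hb : b ∈ level φ (s * d * d) (conjParam Λ)) :
    MatMem (levelGroup n lam Λ φ s) ((longRootUnit (φ lam) p c).val * longRoot (φ lam) i b *
      ((longRootUnit (φ lam) p c)⁻¹).val) := by
  have hg := EQ_le_GQ h'.toIsFormRing (longRootUnit_mem_EQ h'.toIsFormRing p hc)
  refine matMem_conj_longRoot h h' hφ hg (e := 0) (l := i) ?_ (swap_ne i) s d ⟨0, by simp⟩ hb
  rw [op_zero, zero_smul, add_zero]
  exact longRoot_mulVec_bas_of_ne hip c

omit h in
/-- A root element of level `t³` is a product of two conjugate pairs of level `t`. -/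
theorem exists_root_eq_commutator {i j k : Fin n ⊕ Fin n} (hij : j ≠ i.swap) (hki : k ≠ i)
    (hki' : k ≠ i.swap) (hkj : j ≠ k) (hkj' : j ≠ k.swap) (t : A) {b : R'}
    (hb : b ∈ level φ (t * (t * t)) (⊤ : AddSubgroup R)) :
    ∃ a ∈ level φ t (⊤ : AddSubgroup R), ∃ b' ∈ level φ t (⊤ : AddSubgroup R),
      root (φ lam) i b j = root (φ lam) k (-b') j *
        (root (φ lam) i a k.swap * root (φ lam) k b' j * root (φ lam) i (-a) k.swap) := by
  obtain ⟨x, -, rfl⟩ := hb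
  refine ⟨t • φ (star (wt lam k.swap)), smul_mem_level_top _ _, t • φ (t • x),
    smul_mem_level_top _ _, ?_⟩
  rw [← root_eq_commutator h'.toIsFormRing hij hki hki' hkj hkj']
  congr 1
  change (t * (t * t)) • φ x = _
  rw [hφ.map_star, map_wt, smul_mul_assoc, ← wt_central h'.center,
    wt_unitary h'.unitary, map_smul, smul_mul_smul_comm, one_mul, smul_smul, mul_assoc]

omit h in
theorem exists_longRoot_eq_commutator {i k : Fin n ⊕ Fin n} (hki : k ≠ i)
    (hki' : k ≠ i.swap) (t : A) {b : R'} (hb : b ∈ level φ (t * (t * t)) (conjParam Λ)) :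
    ∃ a ∈ level φ t (⊤ : AddSubgroup R), ∃ b' ∈ level φ t (conjParam Λ),
      ∃ b'' ∈ level φ t (⊤ : AddSubgroup R),
      longRoot (φ lam) i b = longRoot (φ lam) k (-b') *
        (root (φ lam) i a k.swap * longRoot (φ lam) k b' * root (φ lam) i (-a) k.swap) *
        root (φ lam) k b'' i := by
  obtain ⟨x, hx, rfl⟩ := hb
  have hφx : φ x ∈ conjParam Λ' := by
    rw [mem_conjParam, ← hφ.map_star]
    exact hφ.map_mem _ hx
  have e : t • φ (star (wt lam k.swap)) * wt (φ lam) k.swap = t • (1 : R') := by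
    rw [hφ.map_star, map_wt, smul_mul_assoc, ← wt_central h'.center, wt_unitary h'.unitary]
  have key := longRoot_eq_commutator h'.toIsFormRing hki hki' (t • φ (star (wt lam k.swap)))
    (h'.smul_mem_conjParam t hφx)
  have hst : star (t • (1 : R')) = t • (1 : R') := by rw [h'.star_smul, star_one]
  rw [e, hst] at key
  refine ⟨t • φ (star (wt lam k.swap)), smul_mem_level_top _ _, t • φ x, ⟨x, hx, rfl⟩,
    -(t • φ x * t • (1 : R')), ⟨-(t • x), trivial, ?_⟩, ?_⟩
  · change t • φ _ = _
    rw [map_neg, map_smul, smul_neg, smul_mul_smul_comm, mul_one, smul_smul]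
  · rw [← key]
    congr 1
    change (t * (t * t)) • φ x = _
    rw [smul_mul_smul_comm, smul_mul_smul_comm, one_mul, mul_one, mul_assoc]

/-- Conjugation by a root element sends root elements of high level to elements of given level. -/
theorem exists_level_conj_root (hn : 3 ≤ n) {g : GL (Fin n ⊕ Fin n) R'}
    (hg : IsRoot n (φ lam) (⊤ : AddSubgroup R') (conjParam Λ') g.val) {s : A} (hs : s ∈ S) :
    ∃ t ∈ S, ∀ M, IsRoot n (φ lam) (level φ t (⊤ : AddSubgroup R)) (level φ t (conjParam Λ)) M →
      MatMem (levelGroup n lam Λ φ s) (g.val * M * (g⁻¹).val) := by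
  generalize hM : g.val = N at hg
  cases hg with
  | short p q c hqp hqp' hc =>
    obtain rfl : g = rootUnit (φ lam) p c q hqp' := Units.ext hM
    obtain ⟨d, hd, hdc⟩ := hφ.surj c
    have ht : s * d * d ∈ S := S.mul_mem (S.mul_mem hs hd) hd
    set t := s * d * d with htd
    -- Level t = sd² suffices unless both ends of the root are moved. Such a root element is first
    -- rewritten by factors of level t, which costs a cube.
    refine ⟨t * (t * t), S.mul_mem ht (S.mul_mem ht ht), ?_⟩
    rintro M (⟨i, j, b, hji, hij, hb⟩ | ⟨i, b, hb⟩)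
    · by_cases hfix : (j ≠ p.swap ∧ j ≠ q.swap) ∨ (i ≠ p.swap ∧ i ≠ q.swap)
      · exact matMem_rootUnit_conj_root h h' hφ hqp hqp' c s d hdc hij hfix
          (level_mul_le_top _ _ hb)
      · obtain ⟨k, hk1, hk2, hk3, hk4⟩ := exists_ne_four hn p q
        have hk5 : k.swap ≠ p.swap := fun e => hk1 (by simpa using congrArg Sum.swap e)
        have hk6 : k.swap ≠ q.swap := fun e => hk3 (by simpa using congrArg Sum.swap e)
        -- In the exceptional case i and j both lie in the pair of moved indices. Every factor of
        -- the commutator with the outside index k has a fixed end.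
        have hij4 : (i = p.swap ∨ i = q.swap) ∧ (j = p.swap ∨ j = q.swap) := by tauto
        have hki : k ≠ i := by rcases hij4.1 with rfl | rfl <;> assumption
        have hki' : k ≠ i.swap := by rcases hij4.1 with rfl | rfl <;> simpa
        have hkj : j ≠ k := by rcases hij4.2 with rfl | rfl <;> exact Ne.symm ‹_›
        have hkj' : j ≠ k.swap := by rcases hij4.2 with rfl | rfl <;> exact Ne.symm ‹_›
        obtain ⟨a, ha, b', hb', e⟩ := exists_root_eq_commutator (lam := lam) h' hφ hij hki hki' hkj hkj' t hb
        rw [← hM, e]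
        have h1 := fun {b} hb => matMem_rootUnit_conj_root (b := b) h h' hφ hqp hqp' c s d hdc hkj'
          (.inr ⟨hk2, hk4⟩) hb
        have h2 := fun {b} hb => matMem_rootUnit_conj_root (i := i) (j := k.swap) (b := b) h h' hφ
          hqp hqp' c s d hdc (fun e => hki (by simpa using congrArg Sum.swap e))
          (.inl ⟨hk5, hk6⟩) hb
        exact (h1 (neg_mem hb')).conj (((h2 ha).conj (h1 hb')).conj (h2 (neg_mem ha)))
    · exact matMem_rootUnit_conj_longRoot h h' hφ hqp hqp' c s d hdc i (level_mul_le h _ _ hb)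
  | long p c hc =>
    obtain rfl : g = longRootUnit (φ lam) p c := Units.ext hM
    obtain ⟨d, hd, x, hx, hdc⟩ := hφ.surj_form _ hc
    have hdc' : ∃ x ∈ conjParam Λ, d • c = φ x := by
      refine ⟨star x, by simpa [mem_conjParam] using hx, ?_⟩
      rw [hφ.map_star, ← hdc, h'.star_smul]
      exact congrArg (d • ·) (star_star c).symm
    have ht : s * d * d ∈ S := S.mul_mem (S.mul_mem hs hd) hd
    set t := s * d * d with htd
    refine ⟨t * (t * t), S.mul_mem ht (S.mul_mem ht ht), ?_⟩
    rintro M (⟨i, j, b, hji, hij, hb⟩ | ⟨i, b, hb⟩)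
    · exact matMem_longRootUnit_conj_root h h' hφ p hc s d hdc' hji hij
          (level_mul_le_top _ _ hb)
    · by_cases hip : i ≠ p.swap
      · exact matMem_longRootUnit_conj_longRoot h h' hφ p hc s d hip (level_mul_le h _ _ hb)
      -- The exceptional long root is the one opposite to p. The commutator formula through another
      -- pair k replaces it by short roots and a long root along `bas k`.
      · rw [not_not] at hip
        obtain ⟨k, hk1, hk2⟩ := exists_ne_ne_swap (by omega) p
        have hki : k ≠ i := by rw [hip]; exact hk2
        have hki' : k ≠ i.swap := by rw [hip]; simpa using hk1
        have hik : k.swap ≠ i := by rintro e; apply hki'; rw [← e]; simp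
        have hik' : k.swap ≠ i.swap := fun e => hki (by simpa using congrArg Sum.swap e)
        obtain ⟨a, ha, b', hb', b'', hb'', e⟩ :=
          exists_longRoot_eq_commutator h' hφ hki hki' t hb
        rw [← hM, e]
        have h1 := fun {b} hb => matMem_longRootUnit_conj_longRoot (b := b) h h' hφ p hc s d hk2 hb
        have h2 := fun {b} hb => matMem_longRootUnit_conj_root (b := b) h h' hφ p hc s d hdc' hik
          hik' hb
        have h3 := matMem_longRootUnit_conj_root h h' hφ p hc s d hdc' hki.symm
          (ne_swap_comm hki') hb''
        exact ((h1 (neg_mem hb')).conj (((h2 ha).conj (h1 hb')).conj (h2 (neg_mem ha)))).conj h3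

/-- Conjugation by an elementary element sends elements of high level to elements of given
level. -/
theorem exists_level_conj (hn : 3 ≤ n) {g : GL (Fin n ⊕ Fin n) R'}
    (hg : g ∈ EQ n (φ lam) Λ') {s : A} (hs : s ∈ S) :
    ∃ t ∈ S, ∀ γ ∈ levelGroup n lam Λ φ t, g * γ * g⁻¹ ∈ levelGroup n lam Λ φ s := by
  have key : ∀ g : GL (Fin n ⊕ Fin n) R',
      IsRoot n (φ lam) (⊤ : AddSubgroup R') (conjParam Λ') g.val → ∀ s ∈ S,
      ∃ t ∈ S, ∀ γ ∈ levelGroup n lam Λ φ t, g * γ * g⁻¹ ∈ levelGroup n lam Λ φ s := by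
    intro g hg s hs
    obtain ⟨t, ht, hM⟩ := exists_level_conj_root h h' hφ hn hg hs
    refine ⟨t, ht, ?_⟩
    suffices hle : levelGroup n lam Λ φ t ≤
        (levelGroup n lam Λ φ s).comap (MulAut.conj g).toMonoidHom from fun γ hγ => hle hγ
    rw [levelGroup, rootGroup, Subgroup.closure_le]
    intro γ hγ
    exact (matMem_val (g := g * γ * g⁻¹)).1 (hM _ hγ)
  rw [EQ_eq_rootGroup h'.toIsFormRing, rootGroup] at hg
  induction hg using Subgroup.closure_induction'' generalizing s with
  | mem x hx => exact key x hx s hs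
  | inv_mem x hx => exact key _ (IsRoot.inv hx) s hs
  | one => exact ⟨s, hs, by simp⟩
  | mul x y _ _ ihx ihy =>
    obtain ⟨t, ht, hxt⟩ := ihx hs
    obtain ⟨u, hu, hyu⟩ := ihy ht
    refine ⟨u, hu, fun γ hγ => ?_⟩
    have := hxt _ (hyu γ hγ)
    simpa only [_root_.mul_inv_rev, mul_assoc] using this

end Conjugation

end QuadraticGroup

end

noncomputable section

namespace QuadraticGroup

open Matrix MulOpposite Polynomial

/-! ### The polynomial form ring -/

section PolynomialStar

variable {R : Type*} [Ring R] [StarRing R]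

/-- The involution of `R[X]` which acts on the coefficients and fixes `X`. -/
def polyStar (p : R[X]) : R[X] := p.sum fun i a => monomial i (star a)

theorem coeff_polyStar (p : R[X]) (k : ℕ) : (polyStar p).coeff k = star (p.coeff k) := by
  simp only [polyStar, Polynomial.sum, finsetSum_coeff, coeff_monomial]
  rw [Finset.sum_ite_eq' p.support k]
  split_ifs with hk
  · rfl
  · rw [notMem_support_iff.1 hk, star_zero]

instance : StarRing R[X] where
  star := polyStar
  star_involutive p := by ext k; simp [coeff_polyStar]
  star_mul p q := by
    ext k
    change (polyStar (p * q)).coeff k = (polyStar q * polyStar p).coeff k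
    rw [coeff_polyStar, coeff_mul, coeff_mul, star_sum, ← Finset.Nat.sum_antidiagonal_swap]
    exact Finset.sum_congr rfl fun x _ => by simp [coeff_polyStar]
  star_add p q := by
    ext k
    change (polyStar (p + q)).coeff k = (polyStar p + polyStar q).coeff k
    simp [coeff_polyStar]

theorem coeff_star (p : R[X]) (k : ℕ) : (star p).coeff k = star (p.coeff k) := coeff_polyStar p k

theorem star_C (a : R) : star (C a) = C (star a) := by
  ext k; rw [coeff_star, coeff_C, coeff_C]; split_ifs <;> simp

theorem star_monomial (i : ℕ) (a : R) : star (monomial i a) = monomial i (star a) := by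
  ext k; rw [coeff_star, coeff_monomial, coeff_monomial]; split_ifs <;> simp

theorem star_X : star (X : R[X]) = X := by
  rw [← monomial_one_one_eq_X, star_monomial, star_one]

end PolynomialStar

/-- The polynomials with coefficients in `B`. -/
def polyForm {R : Type*} [Ring R] (B : AddSubgroup R) : AddSubgroup R[X] where
  carrier := {p | ∀ k, p.coeff k ∈ B}
  add_mem' hp hq k := by rw [coeff_add]; exact B.add_mem (hp k) (hq k)
  zero_mem' k := by simp
  neg_mem' hp k := by rw [coeff_neg]; exact B.neg_mem (hp k)

theorem mem_polyForm {R : Type*} [Ring R] {B : AddSubgroup R} {p : R[X]} :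
    p ∈ polyForm B ↔ ∀ k, p.coeff k ∈ B := Iff.rfl

theorem C_mem_polyForm {R : Type*} [Ring R] {B : AddSubgroup R} {a : R} (ha : a ∈ B) :
    C a ∈ polyForm B := fun k => by
  rw [coeff_C]; split_ifs
  · exact ha
  · exact zero_mem _

theorem X_mul_mem_polyForm {R : Type*} [Ring R] {B : AddSubgroup R} {p : R[X]}
    (hp : p ∈ polyForm B) : X * p ∈ polyForm B := fun k => by
  cases k with
  | zero => simp
  | succ k => rw [coeff_X_mul]; exact hp k

theorem divX_mem_polyForm {R : Type*} [Ring R] {B : AddSubgroup R} {p : R[X]}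
    (hp : p ∈ polyForm B) : divX p ∈ polyForm B := fun k => by
  rw [coeff_divX]; exact hp _

section Form

variable {R : Type*} [Ring R] [StarRing R] {lam : R} {Λ : AddSubgroup R}

theorem conjParam_polyForm : conjParam (polyForm Λ) = polyForm (conjParam Λ) := by
  ext p
  simp only [mem_conjParam, mem_polyForm, coeff_star]

theorem IsFormRing.polynomial (h : IsFormRing lam Λ) : IsFormRing (C lam) (polyForm Λ) where
  center p := by ext k; simp [h.center]
  unitary := by rw [star_C, ← C_mul, h.unitary, C_1]
  form := by
    have hmin : ∀ p : R[X], p - C lam * star p ∈ polyForm Λ := fun p k => by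
      rw [coeff_sub, coeff_C_mul, coeff_star]
      exact h.form.min_le _
    have hmax : ∀ p ∈ polyForm Λ, p = -(C lam * star p) := fun p hp => by
      ext k
      rw [coeff_neg, coeff_C_mul, coeff_star]
      exact h.form.le_max _ (hp k)
    refine ⟨hmin, hmax, fun x hx f => ?_⟩
    -- The condition is quadratic in f: the mixed terms for f + g have the form y − λȳ, so only
    -- monomials need the form parameter axiom of `R`.
    induction f using Polynomial.induction_on' with
    | add f g hf hg =>
      have e : star (f + g) * x * (f + g) = star f * x * f + star g * x * g +
          (star f * x * g - C lam * star (star f * x * g)) := by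
        have e2 : star g * x * f = - (C lam * star (star f * x * g)) := by
          nth_rw 1 [hmax x hx]
          have hc : ∀ p : R[X], C lam * p = p * C lam := fun p => by ext k; simp [h.center]
          rw [star_mul, star_mul, star_star, mul_neg, neg_mul, ← mul_assoc, ← hc]
          simp only [mul_assoc]
        rw [sub_eq_add_neg, ← e2, star_add]
        simp only [mul_add, add_mul]
        abel
      rw [e]
      exact add_mem (add_mem hf hg) (hmin _)
    | monomial i a =>
      have e : star (monomial i a) * x * monomial i a = C (star a) * x * C a * X ^ (i + i) := by
        rw [star_monomial, ← C_mul_X_pow_eq_monomial, ← C_mul_X_pow_eq_monomial, pow_add]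
        simp only [mul_assoc]
        rw [X_pow_mul (p := x * _)]
        simp only [mul_assoc]
      intro k
      rw [e, coeff_mul_X_pow', coeff_mul_C, coeff_C_mul]
      split_ifs
      · exact h.form.conj_mem _ (hx _) a
      · exact zero_mem _

variable {A : Type*} [CommRing A] [Algebra A R]

theorem IsFormAlgebra.polynomial (h : IsFormAlgebra A lam Λ) :
    IsFormAlgebra A (C lam) (polyForm Λ) where
  __ := h.toIsFormRing.polynomial
  star_smul a p := by ext k; simp [coeff_star, h.star_smul]
  smul_mem a p hp k := by rw [coeff_smul]; exact h.smul_mem a _ (hp k)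

variable {R' : Type*} [Ring R'] [StarRing R'] [Algebra A R'] {Λ' : AddSubgroup R'}
  {S : Submonoid A} {φ : R →ₐ[A] R'}

-- Finitely many coefficients have a common denominator. The subgroup B stays general so as to serve
-- the whole ring, Λ and `conjParam Λ`.
omit [StarRing R] [StarRing R'] in
theorem exists_smul_eq_map {B : AddSubgroup R} {B' : AddSubgroup R'}
    (hB : ∀ (a : A), ∀ x ∈ B, a • x ∈ B) (h : ∀ y ∈ B', ∃ s ∈ S, ∃ x ∈ B, s • y = φ x) (p : R'[X])
    (hp : p ∈ polyForm B') : ∃ s ∈ S, ∃ q ∈ polyForm B, s • p = mapAlgHom φ q := by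
  suffices hs : ∀ I : Finset ℕ, ∃ s ∈ S, ∃ q ∈ polyForm B,
      s • ∑ i ∈ I, monomial i (p.coeff i) = mapAlgHom φ q by
    have := hs p.support
    rwa [← as_sum_support p] at this
  intro I
  induction I using Finset.induction_on with
  | empty => exact ⟨1, S.one_mem, 0, zero_mem _, by simp⟩
  | insert i I hi ih =>
    obtain ⟨s, hs, q, hq, hsq⟩ := ih
    obtain ⟨t, ht, x, hx, htx⟩ := h _ (hp i)
    refine ⟨s * t, S.mul_mem hs ht, s • monomial i x + t • q, add_mem ?_ ?_, ?_⟩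
    · intro k
      rw [coeff_smul, coeff_monomial]
      split_ifs
      · exact hB _ _ hx
      · rw [smul_zero]; exact zero_mem _
    · intro k
      rw [coeff_smul]
      exact hB _ _ (hq k)
    · rw [Finset.sum_insert hi, smul_add, map_add, map_smul, map_smul, ← hsq, mul_smul, mul_comm s,
        mul_smul t s]
      congr 2
      rw [smul_monomial, htx, coe_mapAlgHom, map_monomial]
      rfl

omit [StarRing R] [StarRing R'] in
theorem exists_smul_eq_zero (h : ∀ x, φ x = 0 → ∃ s ∈ S, s • x = 0) (p : R[X])
    (hp : mapAlgHom φ p = 0) : ∃ s ∈ S, s • p = 0 := by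
  have hco : ∀ k, φ (p.coeff k) = 0 := fun k => by
    have := congrArg (fun q => coeff q k) hp
    simpa using this
  suffices hs : ∀ I : Finset ℕ, ∃ s ∈ S, ∀ i ∈ I, s • p.coeff i = 0 by
    obtain ⟨s, hs, hI⟩ := hs p.support
    refine ⟨s, hs, ?_⟩
    ext k
    rw [coeff_smul, coeff_zero]
    by_cases hk : k ∈ p.support
    · exact hI k hk
    · rw [notMem_support_iff.1 hk, smul_zero]
  intro I
  induction I using Finset.induction_on with
  | empty => exact ⟨1, S.one_mem, by simp⟩
  | insert i I hi ih =>
    obtain ⟨s, hs, hI⟩ := ih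
    obtain ⟨t, ht, htx⟩ := h _ (hco i)
    refine ⟨s * t, S.mul_mem hs ht, fun k hk => ?_⟩
    rcases Finset.mem_insert.1 hk with rfl | hk
    · rw [mul_smul, htx, smul_zero]
    · rw [mul_comm, mul_smul, hI k hk, smul_zero]

theorem IsFormLocalization.polynomial (h : IsFormAlgebra A lam Λ)
    (hφ : IsFormLocalization S Λ Λ' φ) :
    IsFormLocalization S (polyForm Λ) (polyForm Λ') (mapAlgHom φ) where
  map_star p := by ext k; simp [coeff_star, hφ.map_star]
  map_mem p hp k := by simpa using hφ.map_mem _ (hp k)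
  isUnit s hs := by
    rw [Polynomial.algebraMap_apply]
    exact (hφ.isUnit s hs).map C
  surj p := by
    obtain ⟨s, hs, q, -, hq⟩ := exists_smul_eq_map (B := ⊤) (B' := ⊤) (φ := φ) (S := S)
      (fun _ _ _ => trivial)
      (fun y _ => by obtain ⟨s, hs, x, hx⟩ := hφ.surj y; exact ⟨s, hs, x, trivial, hx⟩) p
      (fun _ => trivial)
    exact ⟨s, hs, q, hq⟩
  surj_form p hp := exists_smul_eq_map h.smul_mem hφ.surj_form p hp
  eq_zero p hp := exists_smul_eq_zero hφ.eq_zero p hp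

end Form

/-! ### Homomorphisms of form rings -/

section Functoriality

/-- The homomorphism of general linear groups induced by a ring homomorphism. -/
def glMap {R B : Type*} [Ring R] [Ring B] {n : ℕ} (f : R →+* B) :
    GL (Fin n ⊕ Fin n) R →* GL (Fin n ⊕ Fin n) B := Units.map f.mapMatrix.toMonoidHom

theorem glMap_val {R B : Type*} [Ring R] [Ring B] {n : ℕ} (f : R →+* B)
    (g : GL (Fin n ⊕ Fin n) R) : (glMap f g).val = g.val.map f := rfl

theorem glMap_glMap {R B D : Type*} [Ring R] [Ring B] [Ring D] {n : ℕ} (f : R →+* B) (f' : B →+* D)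
    (g : GL (Fin n ⊕ Fin n) R) : glMap f' (glMap f g) = glMap (f'.comp f) g := rfl

theorem glMap_congr {R B : Type*} [Ring R] [Ring B] {n : ℕ} {f f' : R →+* B} (h : ∀ x, f x = f' x)
    (g : GL (Fin n ⊕ Fin n) R) : glMap f g = glMap f' g := by rw [RingHom.ext h]

variable {R B D : Type*} [Ring R] [StarRing R] [Ring B] [StarRing B] [Ring D] [StarRing D]
  {lam : R} {Λ : AddSubgroup R} {lam' : B} {Λ' : AddSubgroup B} {lam'' : D} {Λ'' : AddSubgroup D}

/-- `f` is a homomorphism of form rings. -/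
structure IsFormHom (lam : R) (Λ : AddSubgroup R) (lam' : B) (Λ' : AddSubgroup B) (f : R →+* B) :
    Prop where
  map_star : ∀ x, f (star x) = star (f x)
  map_lam : f lam = lam'
  map_mem : ∀ x ∈ Λ, f x ∈ Λ'

theorem IsFormHom.comp {f' : B →+* D} {f : R →+* B} (hf' : IsFormHom lam' Λ' lam'' Λ'' f')
    (hf : IsFormHom lam Λ lam' Λ' f) : IsFormHom lam Λ lam'' Λ'' (f'.comp f) where
  map_star x := by simp [hf.map_star, hf'.map_star]
  map_lam := by simp [hf.map_lam, hf'.map_lam]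
  map_mem x hx := hf'.map_mem _ (hf.map_mem x hx)

variable {n : ℕ} {f : R →+* B}

theorem IsFormHom.map_rk (hf : IsFormHom lam Λ lam' Λ' f) (i j : Fin n ⊕ Fin n) (a : R) :
    (rk lam (bas i) a (bas j)).map f = rk lam' (bas i) (f a) (bas j) := by
  rw [rk_bas, rk_bas]
  have : f (wt lam j) = wt lam' j := by rcases j with j | j <;> simp [wt, hf.map_lam]
  rw [← this, ← map_mul]
  exact Matrix.map_single _ _ _ f

theorem IsFormHom.map_root (hf : IsFormHom lam Λ lam' Λ' f) (i j : Fin n ⊕ Fin n) (a : R) :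
    (root lam i a j).map f = root lam' i (f a) j := by
  have := hf.map_rk j i (star lam * star a)
  rw [map_mul, hf.map_star, hf.map_star, hf.map_lam] at this
  rw [root, root, tau, tau, ← this, ← hf.map_rk i j a]
  change f.mapMatrix _ = _
  rw [map_sub, map_add, map_one]
  rfl

theorem IsFormHom.map_longRoot (hf : IsFormHom lam Λ lam' Λ' f) (i : Fin n ⊕ Fin n) (a : R) :
    (longRoot lam i a).map f = longRoot lam' i (f a) := by
  rw [longRoot, longRoot, ell, ell, ← hf.map_rk i i a]
  change f.mapMatrix _ = _
  rw [map_add, map_one]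
  rfl

theorem IsFormHom.isRoot (hf : IsFormHom lam Λ lam' Λ' f) {P L : Set R} {P' L' : Set B}
    (hP : ∀ a ∈ P, f a ∈ P') (hL : ∀ a ∈ L, f a ∈ L')
    {M : Matrix (Fin n ⊕ Fin n) (Fin n ⊕ Fin n) R} (hM : IsRoot n lam P L M) :
    IsRoot n lam' P' L' (M.map f) := by
  cases hM with
  | short i j a hij hij' ha =>
    rw [hf.map_root]
    exact .short i j _ hij hij' (hP a ha)
  | long i a ha =>
    rw [hf.map_longRoot]
    exact .long i _ (hL a ha)

theorem IsFormHom.mem_conjParam (hf : IsFormHom lam Λ lam' Λ' f) {a : R} (ha : a ∈ conjParam Λ) :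
    f a ∈ conjParam Λ' := by
  rw [QuadraticGroup.mem_conjParam, ← hf.map_star]
  exact hf.map_mem _ ha

theorem IsFormHom.glMap_mem_EQ (hf : IsFormHom lam Λ lam' Λ' f) (h : IsFormRing lam Λ)
    (h' : IsFormRing lam' Λ') {g : GL (Fin n ⊕ Fin n) R} (hg : g ∈ EQ n lam Λ) :
    glMap f g ∈ EQ n lam' Λ' := by
  rw [EQ_eq_rootGroup h, rootGroup] at hg
  rw [EQ_eq_rootGroup h', rootGroup]
  suffices hle : Subgroup.closure {σ : GL (Fin n ⊕ Fin n) R |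
      IsRoot n lam (⊤ : AddSubgroup R) (conjParam Λ) σ.val} ≤
      (Subgroup.closure {σ : GL (Fin n ⊕ Fin n) B |
        IsRoot n lam' (⊤ : AddSubgroup B) (conjParam Λ') σ.val}).comap (glMap f) from hle hg
  rw [Subgroup.closure_le]
  intro σ hσ
  exact Subgroup.subset_closure
    (hf.isRoot (P' := (⊤ : AddSubgroup B)) (fun _ _ => trivial) (fun a ha => hf.mem_conjParam ha) hσ)

end Functoriality

/-! ### Evaluation of polynomials at scalars -/

section Scalars

variable {R B : Type*} [Ring R] [StarRing R] [Ring B] [StarRing B]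
  {lam : R} {Λ : AddSubgroup R} {lam' : B} {Λ' : AddSubgroup B}

/-- `t` is a symmetric central element which stabilizes the form parameter. -/
structure IsScalar (Λ : AddSubgroup R) (t : R) : Prop where
  commute : ∀ x, Commute x t
  star_eq : star t = t
  mul_mem : ∀ x ∈ Λ, t * x ∈ Λ

theorem IsScalar.add {t u : R} (ht : IsScalar Λ t) (hu : IsScalar Λ u) : IsScalar Λ (t + u) where
  commute x := (ht.commute x).add_right (hu.commute x)
  star_eq := by rw [star_add, ht.star_eq, hu.star_eq]
  mul_mem x hx := by rw [add_mul]; exact add_mem (ht.mul_mem x hx) (hu.mul_mem x hx)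

theorem isScalar_zero : IsScalar Λ (0 : R) :=
  ⟨fun x => Commute.zero_right x, star_zero R, fun x _ => by rw [zero_mul]; exact zero_mem _⟩

theorem isScalar_one : IsScalar Λ (1 : R) :=
  ⟨fun x => Commute.one_right x, star_one R, fun x hx => by rwa [one_mul]⟩

theorem IsScalar.smul {A : Type*} [CommRing A] [Algebra A R] (h : IsFormAlgebra A lam Λ) (a : A)
    {t : R} (ht : IsScalar Λ t) : IsScalar Λ (a • t) where
  commute x := (ht.commute x).smul_right a
  star_eq := by rw [h.star_smul, ht.star_eq]
  mul_mem x hx := by rw [smul_mul_assoc]; exact h.smul_mem a _ (ht.mul_mem x hx)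

theorem isScalar_X : IsScalar (polyForm Λ) (X : R[X]) :=
  ⟨fun p => (commute_X p).symm, star_X, fun _ hp => X_mul_mem_polyForm hp⟩

theorem IsScalar.C {t : R} (ht : IsScalar Λ t) : IsScalar (polyForm Λ) (C t) where
  commute p := by
    ext k
    rw [coeff_mul_C, coeff_C_mul]
    exact ht.commute _
  star_eq := by rw [star_C, ht.star_eq]
  mul_mem p hp k := by rw [coeff_C_mul]; exact ht.mul_mem _ (hp k)

/-- The evaluation of polynomials at a scalar. -/
abbrev evalHom (f : R →+* B) {t : B} (ht : IsScalar Λ' t) : R[X] →+* B :=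
  eval₂RingHom' f t fun a => ht.commute (f a)

/-- Symmetry of t makes evaluation commute with the involutions, and stability of the form parameter
under t keeps all terms x tᵏ inside it. -/
theorem isFormHom_evalHom {f : R →+* B} (hf : IsFormHom lam Λ lam' Λ' f) {t : B}
    (ht : IsScalar Λ' t) : IsFormHom (Polynomial.C lam) (polyForm Λ) lam' Λ' (evalHom f ht) := by
  have hpow : ∀ k : ℕ, ∀ x ∈ Λ', x * t ^ k ∈ Λ' := fun k => by
    induction k with
    | zero => simp
    | succ k ih =>
      intro x hx
      rw [pow_succ, ← mul_assoc, ht.commute]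
      exact ht.mul_mem _ (ih x hx)
  refine ⟨fun p => ?_, by simp [eval₂RingHom', hf.map_lam], fun p hp => ?_⟩
  · induction p using Polynomial.induction_on' with
    | add p q hp hq => rw [star_add, map_add, map_add, star_add, hp, hq]
    | monomial k a =>
      rw [star_monomial]
      simp only [eval₂RingHom', RingHom.coe_mk, MonoidHom.coe_mk, OneHom.coe_mk, eval₂_monomial,
        star_mul, star_pow, ht.star_eq, hf.map_star]
      exact (ht.commute _).pow_right k
  · change p.eval₂ f t ∈ Λ'
    rw [eval₂_eq_sum_range]
    exact sum_mem fun k _ => hpow k _ (hf.map_mem _ (hp k))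

theorem isFormHom_C : IsFormHom lam Λ (Polynomial.C lam) (polyForm Λ) (Polynomial.C : R →+* R[X]) :=
  ⟨fun x => (star_C x).symm, rfl, fun _ hx => C_mem_polyForm hx⟩

theorem isFormHom_id : IsFormHom lam Λ lam Λ (RingHom.id R) := ⟨fun _ => rfl, rfl, fun _ hx => hx⟩

end Scalars

end QuadraticGroup

end

noncomputable section

namespace QuadraticGroup

open Matrix MulOpposite Polynomial

/-! ### The substitution X ↦ tX -/

section Scale

variable {A R R' : Type*} [CommRing A] [Ring R] [Algebra A R] [Ring R'] [Algebra A R']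

/-- The substitution `X ↦ t * X`. -/
def scale (t : A) : R[X] →+* R[X] :=
  eval₂RingHom' C (t • X) fun a => ((commute_X (C a)).symm).smul_right t

theorem scale_C (t : A) (a : R) : scale t (C a) = C a := by simp [scale, eval₂RingHom']

theorem scale_X (t : A) : scale t (X : R[X]) = t • X := by simp [scale, eval₂RingHom']

theorem scale_scale (t u : A) (p : R[X]) : scale t (scale u p) = scale (t * u) p := by
  have : (scale t).comp (scale u) = (scale (t * u) : R[X] →+* R[X]) := by
    refine Polynomial.ringHom_ext (fun a => by simp [scale_C]) ?_
    rw [RingHom.comp_apply, scale_X, scale_X, ← algebraMap_smul R u (X : R[X]), smul_eq_C_mul,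
      map_mul, scale_C, scale_X, ← smul_eq_C_mul, algebraMap_smul, smul_smul, mul_comm]
  exact congrArg (fun f : R[X] →+* R[X] => f p) this

theorem coeff_scale (t : A) (p : R[X]) (k : ℕ) : (scale t p).coeff k = t ^ k • p.coeff k := by
  induction p using Polynomial.induction_on' with
  | add p q hp hq => rw [map_add, coeff_add, hp, hq, coeff_add, smul_add]
  | monomial i a =>
    rw [← C_mul_X_pow_eq_monomial, map_mul, map_pow, scale_C, scale_X, _root_.smul_pow, mul_smul_comm,
      coeff_smul, coeff_C_mul_X_pow]
    split_ifs with h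
    · rw [h]
    · rw [smul_zero, smul_zero]

theorem mapAlgHom_scale (φ : R →ₐ[A] R') (t : A) (p : R[X]) :
    mapAlgHom φ (scale t p) = scale t (mapAlgHom φ p) := by
  ext k
  rw [coeff_scale, coe_mapAlgHom, coeff_map, coeff_map, coeff_scale]
  exact map_smul φ _ _

theorem scale_smul (t u : A) (p : R[X]) : scale t (u • p) = u • scale t p := by
  ext k
  rw [coeff_scale, coeff_smul, coeff_smul, coeff_scale, smul_comm]

theorem scale_mem_polyForm {B : AddSubgroup R} (hB : ∀ (a : A), ∀ x ∈ B, a • x ∈ B) (t : A)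
    {p : R[X]} (hp : p ∈ polyForm B) : scale t p ∈ polyForm B := fun k => by
  rw [coeff_scale]; exact hB _ _ (hp k)

end Scale

/-! ### The dilation principle -/

section Dilation

variable {A R R' : Type*} [CommRing A] [Ring R] [Algebra A R] [Ring R'] [Algebra A R']
  [StarRing R] [StarRing R'] {n : ℕ} {lam : R} {Λ : AddSubgroup R} {Λ' : AddSubgroup R'}
  {S : Submonoid A} {φ : R →ₐ[A] R'}

/-- The substitution `X ↦ 0`. -/
def evalZero (R : Type*) [Ring R] : R[X] →+* R[X] := C.comp constantCoeff

theorem evalZero_apply {R : Type*} [Ring R] (p : R[X]) : evalZero R p = C (p.coeff 0) := rfl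

-- The difference p(tuX) − p(0) is divisible by tuX. With t = sd, where d is a denominator of `divX
-- p`, the factor d clears the denominators and s gives the level. The statement is uniform in u so
-- that two values of t can be merged for a product.
omit [StarRing R] [StarRing R'] in
theorem exists_scale_sub_mem_level {B : AddSubgroup R} {B' : AddSubgroup R'}
    (hB : ∀ (a : A), ∀ x ∈ B, a • x ∈ B) (h : ∀ y ∈ B', ∃ s ∈ S, ∃ x ∈ B, s • y = φ x) {p : R'[X]}
    (hp : p ∈ polyForm B') {s : A} (hs : s ∈ S) :
    ∃ t ∈ S, ∀ u : A, scale (t * u) p - evalZero R' p ∈ level (mapAlgHom φ) s (polyForm B) := by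
  obtain ⟨d, hd, q, hq, hdq⟩ := exists_smul_eq_map hB h _ (divX_mem_polyForm hp)
  refine ⟨s * d, S.mul_mem hs hd, fun u => ⟨u • (X * scale (s * d * u) q), ?_, ?_⟩⟩
  · exact fun k => by
      rw [coeff_smul]
      exact hB _ _ (X_mul_mem_polyForm (scale_mem_polyForm hB _ hq) k)
  · change s • mapAlgHom φ _ = _
    have e : scale (s * d * u) p - evalZero R' p = (s * d * u) • (X * scale (s * d * u) (divX p)) := by
      conv_lhs => rw [← divX_mul_X_add p]
      rw [map_add, map_add, scale_C, evalZero_apply (C _), coeff_C_zero, add_sub_add_right_eq_sub,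
        evalZero_apply, coeff_mul_X_zero, C_0, sub_zero, ← X_mul, map_mul, scale_X, smul_mul_assoc]
    rw [e, map_smul, map_mul, mapAlgHom_scale, ← hdq, scale_smul]
    simp only [coe_mapAlgHom, Polynomial.map_X, mul_smul_comm, smul_smul]
    congr 1
    ring

omit [StarRing R] [StarRing R'] in
theorem glMap_scale_comm (g : GL (Fin n ⊕ Fin n) R[X]) (t : A) :
    glMap (mapAlgHom φ).toRingHom (glMap (scale t) g) =
      glMap (scale t) (glMap (mapAlgHom φ).toRingHom g) := by
  rw [glMap_glMap, glMap_glMap]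
  exact glMap_congr (fun p => mapAlgHom_scale φ t p) g

theorem isFormHom_evalZero : IsFormHom (C lam) (polyForm Λ) (C lam) (polyForm Λ) (evalZero R) where
  map_star p := by rw [evalZero_apply, evalZero_apply, star_C, coeff_star]
  map_lam := by rw [evalZero_apply, coeff_C_zero]
  map_mem p hp := C_mem_polyForm (hp 0)

theorem isFormHom_scale (h : IsFormAlgebra A lam Λ) (t : A) :
    IsFormHom (C lam) (polyForm Λ) (C lam) (polyForm Λ) (scale t : R[X] →+* R[X]) :=
  isFormHom_evalHom isFormHom_C (isScalar_X.smul h.polynomial t)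

/-- For a generator, g(tX)g(0)⁻¹ is a root element with parameter p(tX) − p(0). For a product xy,
the second factor y(tX)y(0)⁻¹ appears conjugated by the elementary matrix x(0), which
`exists_level_conj` controls. -/
theorem exists_scale_mem_levelGroup (h : IsFormAlgebra A lam Λ) (h' : IsFormAlgebra A (φ lam) Λ')
    (hφ : IsFormLocalization S Λ Λ' φ) (hn : 3 ≤ n) {g : GL (Fin n ⊕ Fin n) R'[X]}
    (hg : g ∈ EQ n (C (φ lam)) (polyForm Λ')) {s : A} (hs : s ∈ S) :
    ∃ t ∈ S, ∀ u : A, glMap (scale (t * u)) g * (glMap (evalZero R') g)⁻¹ ∈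
      levelGroup n (C lam) (polyForm Λ) (mapAlgHom φ) s := by
  have hlam : mapAlgHom φ (C lam) = C (φ lam) := by simp
  have H := h.polynomial
  have H' : IsFormAlgebra A (mapAlgHom φ (C lam)) (polyForm Λ') := by
    rw [hlam]; exact h'.polynomial
  have Hφ := hφ.polynomial h
  have hconst : ∀ g ∈ EQ n (C (φ lam)) (polyForm Λ'), glMap (evalZero R') g ∈
      EQ n (C (φ lam)) (polyForm Λ') := fun g hg =>
    isFormHom_evalZero.glMap_mem_EQ h'.polynomial.toIsFormRing h'.polynomial.toIsFormRing hg
  have key : ∀ g : GL (Fin n ⊕ Fin n) R'[X],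
      IsRoot n (C (φ lam)) (⊤ : AddSubgroup R'[X]) (conjParam (polyForm Λ')) g.val → ∀ s ∈ S,
      ∃ t ∈ S, ∀ u : A, glMap (scale (t * u)) g * (glMap (evalZero R') g)⁻¹ ∈
        levelGroup n (C lam) (polyForm Λ) (mapAlgHom φ) s := by
    intro g hg s hs
    generalize hM : g.val = M at hg
    cases hg with
    | short i j p hij hij' hp =>
      obtain ⟨t, ht, htu⟩ := exists_scale_sub_mem_level (B := ⊤) (B' := ⊤) (φ := φ) (p := p)
        (fun _ _ _ => trivial) (fun y _ => by
          obtain ⟨s, hs, x, hx⟩ := hφ.surj y; exact ⟨s, hs, x, trivial, hx⟩) (fun _ => trivial) hs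
      refine ⟨t, ht, fun u => Subgroup.subset_closure ?_⟩
      obtain rfl : g = rootUnit (C (φ lam)) i p j hij' := Units.ext hM
      have e : glMap (scale (t * u)) (rootUnit (C (φ lam)) i p j hij') *
          (glMap (evalZero R') (rootUnit (C (φ lam)) i p j hij'))⁻¹ =
          rootUnit (C (φ lam)) i (scale (t * u) p - evalZero R' p) j hij' := by
        rw [mul_inv_eq_iff_eq_mul]
        apply Units.ext
        rw [Units.val_mul, glMap_val, glMap_val]
        change (root _ _ _ _).map _ = root _ _ _ _ * (root _ _ _ _).map _
        rw [(isFormHom_scale h' _).map_root, (isFormHom_evalZero (Λ := Λ')).map_root,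
          root_mul_root hij', sub_add_cancel]
      rw [Set.mem_ofPred_eq, e, hlam]
      obtain ⟨x, -, hx⟩ := htu u
      exact .short i j _ hij hij' ⟨x, trivial, hx⟩
    | long i p hp =>
      obtain ⟨t, ht, htu⟩ := exists_scale_sub_mem_level (B := conjParam Λ) (B' := conjParam Λ')
        (φ := φ) (p := p) (fun a _ hx => h.smul_mem_conjParam a hx) (fun y hy => by
          obtain ⟨s, hs, x, hx, e⟩ := hφ.surj_form _ hy
          refine ⟨s, hs, star x, by rwa [mem_conjParam, star_star], ?_⟩
          rw [hφ.map_star, ← e, h'.star_smul]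
          exact congrArg (s • ·) (star_star y).symm) (by rwa [← conjParam_polyForm]) hs
      refine ⟨t, ht, fun u => Subgroup.subset_closure ?_⟩
      obtain rfl : g = longRootUnit (C (φ lam)) i p := Units.ext hM
      have e : glMap (scale (t * u)) (longRootUnit (C (φ lam)) i p) *
          (glMap (evalZero R') (longRootUnit (C (φ lam)) i p))⁻¹ =
          longRootUnit (C (φ lam)) i (scale (t * u) p - evalZero R' p) := by
        rw [mul_inv_eq_iff_eq_mul]
        apply Units.ext
        rw [Units.val_mul, glMap_val, glMap_val]
        change (longRoot _ _ _).map _ = longRoot _ _ _ * (longRoot _ _ _).map _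
        rw [(isFormHom_scale h' _).map_longRoot, (isFormHom_evalZero (Λ := Λ')).map_longRoot,
          longRoot_mul_longRoot, sub_add_cancel]
      rw [Set.mem_ofPred_eq, e, hlam, conjParam_polyForm]
      exact .long i _ (htu u)
  rw [EQ_eq_rootGroup h'.polynomial.toIsFormRing, rootGroup] at hg
  induction hg using Subgroup.closure_induction'' generalizing s with
  | mem x hx => exact key x hx s hs
  | inv_mem x hx => exact key _ (IsRoot.inv hx) s hs
  | one => exact ⟨s, hs, fun u => by simp⟩
  | mul x y hx hy ihx ihy =>
    have hx' : x ∈ EQ n (C (φ lam)) (polyForm Λ') := by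
      rw [EQ_eq_rootGroup h'.polynomial.toIsFormRing]; exact hx
    have hc := hconst x hx'
    rw [← hlam] at hc
    obtain ⟨s', hs', hss'⟩ := exists_level_conj H H' Hφ hn hc hs
    obtain ⟨t, ht, hxt⟩ := ihx hs
    obtain ⟨t', ht', hyt⟩ := ihy hs'
    refine ⟨t * t', S.mul_mem ht ht', fun u => ?_⟩
    have h1 := hxt (t' * u)
    have h2 := hss' _ (hyt (t * u))
    have h3 := mul_mem h1 h2
    have e1 : t * (t' * u) = t * t' * u := by ring
    have e2 : t' * (t * u) = t * t' * u := by ring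
    rw [e1, e2] at h3
    convert h3 using 1
    rw [map_mul, map_mul]
    group

theorem exists_mem_EQ_of_mem_levelGroup (h : IsFormAlgebra A lam Λ)
    (hφ : IsFormLocalization S Λ Λ' φ) (s : A)
    {g : GL (Fin n ⊕ Fin n) R'} (hg : g ∈ levelGroup n lam Λ φ s) :
    ∃ γ ∈ EQ n lam Λ, glMap φ.toRingHom γ = g := by
  have hf : IsFormHom lam Λ (φ lam) Λ' φ.toRingHom := ⟨hφ.map_star, rfl, hφ.map_mem⟩
  suffices hle : levelGroup n lam Λ φ s ≤ (EQ n lam Λ).map (glMap φ.toRingHom) from hle hg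
  rw [levelGroup, rootGroup, Subgroup.closure_le]
  intro σ hσ
  generalize hM : σ.val = M at hσ
  rw [Set.mem_ofPred_eq, hM] at hσ
  cases hσ with
  | short i j a hij hij' ha =>
    obtain ⟨x, -, rfl⟩ := ha
    refine ⟨rootUnit lam i (s • x) j hij', rootUnit_mem_EQ h.toIsFormRing hij' _, Units.ext ?_⟩
    rw [hM, glMap_val]
    change (root _ _ _ _).map _ = _
    rw [hf.map_root]
    exact congrArg (root (φ lam) i · j) (map_smul φ s x)
  | long i a ha =>
    obtain ⟨x, hx, rfl⟩ := ha
    refine ⟨longRootUnit lam i (s • x), longRootUnit_mem_EQ h.toIsFormRing i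
      (h.smul_mem_conjParam s hx), Units.ext ?_⟩
    rw [hM, glMap_val]
    change (longRoot _ _ _).map _ = _
    rw [hf.map_longRoot]
    exact congrArg (longRoot (φ lam) i ·) (map_smul φ s x)

-- Each difference of entries is killed by an element of S, and X ↦ sX multiplies the k-th
-- coefficient by sᵏ. This kills everything except the constant terms, which agree by `h0`.
omit [StarRing R] [StarRing R'] in
theorem exists_scale_eq_of_glMap_eq (hφ : ∀ x, φ x = 0 → ∃ s ∈ S, s • x = 0)
    {g g' : GL (Fin n ⊕ Fin n) R[X]}
    (hgg' : glMap (mapAlgHom φ).toRingHom g = glMap (mapAlgHom φ).toRingHom g')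
    (h0 : glMap (evalZero R) g = glMap (evalZero R) g') :
    ∃ s ∈ S, glMap (scale s) g = glMap (scale s) g' := by
  have hij : ∀ x : (Fin n ⊕ Fin n) × (Fin n ⊕ Fin n),
      ∃ s ∈ S, s • (g.val x.1 x.2 - g'.val x.1 x.2) = 0 := fun x => by
    refine exists_smul_eq_zero hφ _ ?_
    have := congrArg (fun γ : GL (Fin n ⊕ Fin n) R'[X] => γ.val x.1 x.2) hgg'
    rw [map_sub]
    exact sub_eq_zero.2 this
  choose s hs hsx using hij
  refine ⟨∏ x, s x, prod_mem fun x _ => hs x, ?_⟩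
  apply Units.ext
  ext1 i j
  change scale _ (g.val i j) = scale _ (g'.val i j)
  rw [← sub_eq_zero, ← map_sub]
  ext k
  rw [coeff_scale, coeff_zero]
  cases k with
  | zero =>
    have := congrArg (fun γ : GL (Fin n ⊕ Fin n) R[X] => (γ.val i j).coeff 0) h0
    have h2 : (g.val i j).coeff 0 = (g'.val i j).coeff 0 := by
      have h3 : (evalZero R (g.val i j)).coeff 0 = (evalZero R (g'.val i j)).coeff 0 := this
      simpa [evalZero_apply] using h3
    rw [coeff_sub, h2, sub_self, smul_zero]
  | succ k =>
    have h1 := congrArg (fun p : R[X] => p.coeff (k + 1)) (hsx (i, j))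
    simp only [coeff_smul, coeff_zero] at h1
    obtain ⟨c, hc⟩ := Finset.dvd_prod_of_mem s (Finset.mem_univ (i, j))
    rw [pow_succ, hc, mul_comm (s (i, j)) c, ← mul_assoc, mul_smul, h1, smul_zero]

/-- The dilation principle. -/
theorem exists_scale_mem_EQ (h : IsFormAlgebra A lam Λ) (h' : IsFormAlgebra A (φ lam) Λ')
    (hφ : IsFormLocalization S Λ Λ' φ) (hn : 3 ≤ n) {g : GL (Fin n ⊕ Fin n) R[X]}
    (h0 : glMap (evalZero R) g = 1)
    (hg : glMap (mapAlgHom φ).toRingHom g ∈ EQ n (C (φ lam)) (polyForm Λ')) :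
    ∃ t ∈ S, glMap (scale t) g ∈ EQ n (C lam) (polyForm Λ) := by
  have hlam : mapAlgHom φ (C lam) = C (φ lam) := by simp
  have H := h.polynomial
  have H' : IsFormAlgebra A (mapAlgHom φ (C lam)) (polyForm Λ') := by
    rw [hlam]; exact h'.polynomial
  have Hφ := hφ.polynomial h
  have hcomm : ∀ γ : GL (Fin n ⊕ Fin n) R[X], glMap (evalZero R') (glMap (mapAlgHom φ).toRingHom γ) =
      glMap (mapAlgHom φ).toRingHom (glMap (evalZero R) γ) := fun γ => by
    rw [glMap_glMap, glMap_glMap]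
    exact glMap_congr (fun p => by simp [evalZero_apply]) γ
  have hzs : ∀ (t : A) (γ : GL (Fin n ⊕ Fin n) R[X]), glMap (evalZero R) (glMap (scale t) γ) =
      glMap (evalZero R) γ := fun t γ => by
    rw [glMap_glMap]
    exact glMap_congr (fun p => by simp [evalZero_apply, coeff_scale]) γ
  -- Level 1 is enough: its generators are images of root elements over `R[X]`.
  obtain ⟨t, ht, hlev⟩ := exists_scale_mem_levelGroup h h' hφ hn hg S.one_mem
  have hlev1 := hlev 1
  rw [mul_one, hcomm, h0, map_one, inv_one, mul_one] at hlev1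
  obtain ⟨γ, hγ, hγg⟩ := exists_mem_EQ_of_mem_levelGroup H Hφ 1 hlev1
  -- The lift is normalized to be 1 at X = 0. It then agrees with g(tX) both there and after
  -- localization, and one further dilation makes the two equal.
  set γ' := γ * (glMap (evalZero R) γ)⁻¹ with hγ'
  have hγ'E : γ' ∈ EQ n (C lam) (polyForm Λ) :=
    mul_mem hγ (inv_mem (isFormHom_evalZero.glMap_mem_EQ H.toIsFormRing H.toIsFormRing hγ))
  rw [← glMap_scale_comm] at hγg
  have h1 : glMap (mapAlgHom φ).toRingHom γ' = glMap (mapAlgHom φ).toRingHom (glMap (scale t) g) := by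
    rw [hγ', map_mul, map_inv, ← hcomm, hγg, hcomm, hzs, h0, map_one, inv_one, mul_one]
  have h2 : glMap (evalZero R) γ' = glMap (evalZero R) (glMap (scale t) g) := by
    have hid : glMap (evalZero R) (glMap (evalZero R) γ) = glMap (evalZero R) γ := by
      rw [glMap_glMap]
      exact glMap_congr (fun p => by simp [evalZero_apply]) γ
    rw [hzs, h0, hγ', map_mul, map_inv, hid, mul_inv_cancel]
  obtain ⟨s, hs, e⟩ := exists_scale_eq_of_glMap_eq hφ.eq_zero h1 h2
  refine ⟨s * t, S.mul_mem hs ht, ?_⟩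
  have h3 := (isFormHom_scale h s).glMap_mem_EQ H.toIsFormRing H.toIsFormRing hγ'E
  rw [e, glMap_glMap] at h3
  rwa [glMap_congr (f' := scale (s * t)) (fun p => scale_scale s t p)] at h3

end Dilation

/-! ### The substitutions Y ↦ Y + aX -/

section Shift

variable {A R : Type*} [CommRing A] [Ring R] [Algebra A R]

/-- The substitution `X ↦ Y + a * X`, where `Y` is the inner variable. -/
def shift (a : A) : R[X] →+* R[X][X] :=
  eval₂RingHom' (C.comp C) (C X + a • X) fun x =>
    (((commute_X (C x)).symm.map C)).add_right ((commute_X (C (C x))).symm.smul_right a)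

theorem shift_C (a : A) (x : R) : shift a (C x) = C (C x) := by simp [shift, eval₂RingHom']

theorem shift_X (a : A) : shift a (X : R[X]) = C X + a • X := by simp [shift, eval₂RingHom']

/-- The endomorphism `Y ↦ Y + a * X`, `X ↦ c * X` of `R[Y][X]`. -/
def shiftScale (a c : A) : R[X][X] →+* R[X][X] :=
  eval₂RingHom' (shift a) (c • X) fun p => (commute_X (shift a p)).symm.smul_right c

theorem shiftScale_smul (a c b : A) (p : R[X][X]) :
    shiftScale a c (b • p) = b • shiftScale a c p := by
  have e : algebraMap A R[X][X] b = C (C (algebraMap A R b)) := rfl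
  rw [Algebra.smul_def, Algebra.smul_def, map_mul, e]
  simp [shiftScale, eval₂RingHom', shift_C]

/-- The case c = 1 yields closure of `dilationIdeal` under addition, the case a = 0 closure under
multiplication by c. -/
theorem shiftScale_comp_shift (a c b : A) :
    (shiftScale a c).comp (shift b) = (shift (a + b * c) : R[X] →+* R[X][X]) := by
  refine Polynomial.ringHom_ext (fun x => ?_) ?_
  · simp [shift_C, shiftScale, eval₂RingHom']
  · have e1 : shiftScale a c (C X) = (shift a X : R[X][X]) := by simp [shiftScale, eval₂RingHom']
    have e2 : shiftScale a c (X : R[X][X]) = c • X := by simp [shiftScale, eval₂RingHom']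
    rw [RingHom.comp_apply, shift_X, map_add, shift_X, shiftScale_smul, e1, e2, shift_X, add_smul,
      smul_smul, add_assoc]

end Shift

/-! ### Quillen's ideal -/

section LocalGlobal

variable {A R : Type*} [CommRing A] [Ring R] [Algebra A R] [StarRing R] {n : ℕ} {lam : R}
  {Λ : AddSubgroup R}

theorem isScalar_shift (h : IsFormAlgebra A lam Λ) (a : A) :
    IsScalar (polyForm (polyForm Λ)) (C X + a • X : R[X][X]) :=
  isScalar_X.C.add (isScalar_X.smul h.polynomial.polynomial a)

theorem isFormHom_shift (h : IsFormAlgebra A lam Λ) (a : A) :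
    IsFormHom (C lam) (polyForm Λ) (C (C lam)) (polyForm (polyForm Λ)) (shift a : R[X] →+* R[X][X]) :=
  isFormHom_evalHom (isFormHom_C.comp isFormHom_C) (isScalar_shift h a)

theorem isFormHom_shiftScale (h : IsFormAlgebra A lam Λ) (a c : A) :
    IsFormHom (C (C lam)) (polyForm (polyForm Λ)) (C (C lam)) (polyForm (polyForm Λ))
      (shiftScale a c : R[X][X] →+* R[X][X]) :=
  isFormHom_evalHom (isFormHom_shift h a) (isScalar_X.smul h.polynomial.polynomial c)

/-- The elements `a` for which `g(Y + a * X) * g(Y)⁻¹` is elementary. -/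
def dilationIdeal (h : IsFormAlgebra A lam Λ) (g : GL (Fin n ⊕ Fin n) R[X]) : Ideal A where
  carrier := {a | glMap (shift a) g * (glMap (shift (0 : A)) g)⁻¹ ∈
    EQ n (C (C lam)) (polyForm (polyForm Λ))}
  zero_mem' := by simp
  add_mem' := by
    intro a b ha hb
    have H := h.polynomial.polynomial.toIsFormRing
    -- The product g(Y + bX + aX)g(Y + bX)⁻¹ · g(Y + bX)g(Y)⁻¹ telescopes; the first factor is the
    -- hypothesis on a with Y replaced by Y + bX.
    have h1 := (isFormHom_shiftScale h b 1).glMap_mem_EQ H H ha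
    rw [map_mul, map_inv, glMap_glMap, glMap_glMap, shiftScale_comp_shift, shiftScale_comp_shift,
      mul_one, mul_one, add_zero] at h1
    have h2 := mul_mem h1 hb
    rw [mul_assoc, inv_mul_cancel_left, add_comm] at h2
    exact h2
  smul_mem' := by
    intro c a ha
    have H := h.polynomial.polynomial.toIsFormRing
    have h1 := (isFormHom_shiftScale h 0 c).glMap_mem_EQ H H ha
    rw [map_mul, map_inv, glMap_glMap, glMap_glMap, shiftScale_comp_shift, shiftScale_comp_shift,
      zero_mul, add_zero, zero_add, mul_comm] at h1
    exact h1

/-- Setting Y = 0 in g(Y + X)g(Y)⁻¹ leaves g(X)g(0)⁻¹ = g. -/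
theorem mem_EQ_of_dilationIdeal_eq_top (h : IsFormAlgebra A lam Λ) {g : GL (Fin n ⊕ Fin n) R[X]}
    (h0 : glMap (evalZero R) g = 1) (htop : dilationIdeal h g = ⊤) :
    g ∈ EQ n (C lam) (polyForm Λ) := by
  have h1 : (1 : A) ∈ dilationIdeal h g := htop ▸ trivial
  have hz : IsScalar (polyForm Λ) (0 : R[X]) := isScalar_zero
  have hf := isFormHom_evalHom (isFormHom_evalHom (isFormHom_C (lam := lam) (Λ := Λ)) hz) isScalar_X
  have h2 := hf.glMap_mem_EQ h.polynomial.polynomial.toIsFormRing h.polynomial.toIsFormRing h1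
  rw [map_mul, map_inv, glMap_glMap, glMap_glMap] at h2
  have e1 : (evalHom (evalHom (C : R →+* R[X]) hz) (isScalar_X (Λ := Λ))).comp (shift (1 : A)) =
      RingHom.id R[X] := by
    refine Polynomial.ringHom_ext (fun x => ?_) ?_
    · rw [RingHom.comp_apply, shift_C]; simp [eval₂RingHom']
    · rw [RingHom.comp_apply, shift_X, one_smul]; simp [eval₂RingHom']
  have e2 : (evalHom (evalHom (C : R →+* R[X]) hz) (isScalar_X (Λ := Λ))).comp (shift (0 : A)) =
      evalZero R := by
    refine Polynomial.ringHom_ext (fun x => ?_) ?_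
    · rw [RingHom.comp_apply, shift_C]; simp [eval₂RingHom', evalZero_apply]
    · rw [RingHom.comp_apply, shift_X, zero_smul]; simp [eval₂RingHom', evalZero_apply]
  rw [e1, e2, h0, inv_one, mul_one] at h2
  exact h2

variable {R' : Type*} [Ring R'] [Algebra A R'] [StarRing R'] {Λ' : AddSubgroup R'}
  {S : Submonoid A} {φ : R →ₐ[A] R'}

/-- The dilation principle is applied over `R[Y]` to G(X) = g(Y + X)g(Y)⁻¹, which is 1 at X = 0 and
locally elementary; G(tX) is the matrix in the definition of the ideal. -/
theorem exists_mem_dilationIdeal (h : IsFormAlgebra A lam Λ) (h' : IsFormAlgebra A (φ lam) Λ')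
    (hφ : IsFormLocalization S Λ Λ' φ) (hn : 3 ≤ n) {g : GL (Fin n ⊕ Fin n) R[X]}
    (hg : glMap (mapAlgHom φ).toRingHom g ∈ EQ n (C (φ lam)) (polyForm Λ')) :
    ∃ t ∈ S, t ∈ dilationIdeal h g := by
  have hlam : mapAlgHom φ (C lam) = C (φ lam) := by simp
  have H' : IsFormAlgebra A (mapAlgHom φ (C lam)) (polyForm Λ') := by
    rw [hlam]; exact h'.polynomial
  set G := glMap (shift (1 : A)) g * (glMap (shift (0 : A)) g)⁻¹ with hG
  have hz : ∀ a : A, (evalZero R[X]).comp (shift a) = shift (0 : A) := fun a => by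
    refine Polynomial.ringHom_ext (fun x => ?_) ?_
    · rw [RingHom.comp_apply, shift_C, shift_C]; simp [evalZero_apply]
    · rw [RingHom.comp_apply, shift_X, shift_X]; simp [evalZero_apply]
  have h0 : glMap (evalZero R[X]) G = 1 := by
    rw [hG, map_mul, map_inv, glMap_glMap, glMap_glMap, hz, hz, mul_inv_cancel]
  have hsh : ∀ a : A, (mapAlgHom (mapAlgHom φ)).toRingHom.comp (shift a) =
      (shift a).comp (mapAlgHom φ).toRingHom := fun a => by
    refine Polynomial.ringHom_ext (fun x => ?_) ?_
    · rw [RingHom.comp_apply, RingHom.comp_apply, shift_C]; simp [shift_C]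
    · rw [RingHom.comp_apply, RingHom.comp_apply, shift_X]
      have : (mapAlgHom φ).toRingHom (X : R[X]) = X := by simp
      rw [this, shift_X, map_add]
      change _ + mapAlgHom (mapAlgHom φ) (a • X) = _
      rw [map_smul]
      simp
  have hGE : glMap (mapAlgHom (mapAlgHom φ)).toRingHom G ∈
      EQ n (C (mapAlgHom φ (C lam))) (polyForm (polyForm Λ')) := by
    rw [hlam, hG, map_mul, map_inv, glMap_glMap, glMap_glMap, hsh, hsh, ← glMap_glMap, ← glMap_glMap]
    have hm := fun a : A => (isFormHom_shift h' a).glMap_mem_EQ h'.polynomial.toIsFormRing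
      h'.polynomial.polynomial.toIsFormRing hg
    exact mul_mem (hm 1) (inv_mem (hm 0))
  obtain ⟨t, ht, hmem⟩ := exists_scale_mem_EQ h.polynomial H' (hφ.polynomial h) hn h0 hGE
  refine ⟨t, ht, ?_⟩
  rw [hG, map_mul, map_inv, glMap_glMap, glMap_glMap] at hmem
  have hs : ∀ a : A, (scale t).comp (shift a) = (shift (t * a) : R[X] →+* R[X][X]) := fun a => by
    refine Polynomial.ringHom_ext (fun x => ?_) ?_
    · rw [RingHom.comp_apply, shift_C, shift_C, scale_C]
    · rw [RingHom.comp_apply, shift_X, shift_X, map_add, scale_C, scale_smul, scale_X, smul_smul,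
        mul_comm]
  rw [hs, hs, mul_one, mul_zero] at hmem
  exact hmem

end LocalGlobal

end QuadraticGroup

end

noncomputable section

namespace QuadraticGroup

open Matrix MulOpposite Polynomial

/-! ### Localizations of form rings at scalars -/

section FormLocalization

variable {A R R' : Type*} [CommRing A] [Ring R] [StarRing R] [Algebra A R] [Ring R'] [StarRing R']
  [Algebra A R'] {lam : R} {Λ : AddSubgroup R} {Λ' : AddSubgroup R'} {S : Submonoid A}
  {φ : R →ₐ[A] R'}

/-- The elements of `R'` which become elements of `Λ` after multiplication by an element of `S`. -/
def fractionForm (h : IsFormAlgebra A lam Λ) : AddSubgroup R' where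
  carrier := {y | ∃ s ∈ S, ∃ x ∈ Λ, s • y = φ x}
  zero_mem' := ⟨1, S.one_mem, 0, zero_mem _, by rw [smul_zero, map_zero]⟩
  add_mem' := by
    rintro y z ⟨s, hs, x, hx, hsx⟩ ⟨t, ht, w, hw, htw⟩
    refine ⟨s * t, S.mul_mem hs ht, t • x + s • w,
      add_mem (h.smul_mem t x hx) (h.smul_mem s w hw), ?_⟩
    rw [smul_add, map_add, map_smul, map_smul, ← hsx, ← htw, smul_smul, smul_smul, mul_comm t]
  neg_mem' := by
    rintro y ⟨s, hs, x, hx, hsx⟩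
    exact ⟨s, hs, -x, neg_mem hx, by rw [smul_neg, map_neg, hsx]⟩

theorem IsFormLocalization.smul_cancel (hφ : IsFormLocalization S Λ Λ' φ) {s : A} (hs : s ∈ S)
    {y z : R'} (hyz : s • y = s • z) : y = z := by
  rw [Algebra.smul_def, Algebra.smul_def] at hyz
  exact (hφ.isUnit s hs).mul_left_cancel hyz

theorem IsFormLocalization.star_smul (h : IsFormAlgebra A lam Λ)
    (hφ : IsFormLocalization S Λ Λ' φ) (a : A) (y : R') : star (a • y) = a • star y := by
  have e : algebraMap A R' a = φ (a • 1) := by rw [map_smul, map_one, Algebra.algebraMap_eq_smul_one]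
  rw [Algebra.smul_def, Algebra.smul_def, star_mul, e, ← hφ.map_star, h.star_smul, star_one, ← e,
    Algebra.commutes]

theorem IsFormLocalization.isFormAlgebra (h : IsFormAlgebra A lam Λ)
    (hφ : IsFormLocalization S Λ Λ' φ)
    (hsat : ∀ y, ∀ s ∈ S, ∀ x ∈ Λ, s • y = φ x → y ∈ Λ') : IsFormAlgebra A (φ lam) Λ' := by
  refine ⟨⟨fun y => ?_, ?_, ⟨fun y => ?_, fun y hy => ?_, fun y hy z => ?_⟩⟩, hφ.star_smul h,
    fun a y hy => ?_⟩
  · obtain ⟨s, hs, x, hx⟩ := hφ.surj y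
    refine hφ.smul_cancel hs ?_
    rw [← mul_smul_comm, ← smul_mul_assoc, hx, ← map_mul, ← map_mul, h.center]
  · rw [← hφ.map_star, ← map_mul, h.unitary, map_one]
  · obtain ⟨s, hs, x, hx⟩ := hφ.surj y
    refine hsat _ s hs _ (h.form.min_le x) ?_
    rw [smul_sub, ← mul_smul_comm, ← hφ.star_smul h, hx, ← hφ.map_star, ← map_mul, ← map_sub]
  · obtain ⟨s, hs, x, hx, hsx⟩ := hφ.surj_form y hy
    refine hφ.smul_cancel hs ?_
    rw [smul_neg, ← mul_smul_comm, ← hφ.star_smul h, hsx, ← hφ.map_star, ← map_mul, ← map_neg,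
      ← h.form.le_max x hx]
  · obtain ⟨s, hs, x, hx, hsx⟩ := hφ.surj_form y hy
    obtain ⟨t, ht, w, hw⟩ := hφ.surj z
    refine hsat _ (t * s * t) (S.mul_mem (S.mul_mem ht hs) ht) _ (h.form.conj_mem x hx w) ?_
    rw [map_mul, map_mul, hφ.map_star, ← hsx, ← hw, hφ.star_smul h]
    simp only [smul_mul_assoc, mul_smul_comm, smul_smul, mul_assoc]
  · obtain ⟨s, hs, x, hx, hsx⟩ := hφ.surj_form y hy
    refine hsat _ s hs _ (h.smul_mem a x hx) ?_
    rw [map_smul, ← hsx, smul_comm]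

theorem IsFormLocalization.mem_of_smul_mem (hφ : IsFormLocalization S Λ Λ' φ)
    (hsat : ∀ y, ∀ s ∈ S, ∀ x ∈ Λ, s • y = φ x → y ∈ Λ') {s : A} (hs : s ∈ S) {y : R'}
    (hy : s • y ∈ Λ') : y ∈ Λ' := by
  obtain ⟨t, ht, x, hx, htx⟩ := hφ.surj_form _ hy
  rw [smul_smul] at htx
  exact hsat y _ (S.mul_mem ht hs) x hx htx

end FormLocalization

/-! ### R_m as a localization at form scalars -/

section Datum

variable {R : Type*} [Ring R] [StarRing R] (𝒜 : ℕ → AddSubgroup R) [GradedRing 𝒜]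
  (Λ : AddSubgroup R)

/-- The symmetric central elements of degree zero which stabilize `Λ`. -/
def formScalars : Subring (Subring.center R) where
  carrier := {c | (c : R) ∈ 𝒜 0 ∧ star (c : R) = c ∧ ∀ x ∈ Λ, (c : R) * x ∈ Λ}
  zero_mem' := ⟨zero_mem _, star_zero R, fun x _ => by
    rw [ZeroMemClass.coe_zero, zero_mul]; exact zero_mem _⟩
  one_mem' := ⟨SetLike.GradedOne.one_mem, star_one R, fun x hx => by
    rw [OneMemClass.coe_one, one_mul]; exact hx⟩
  add_mem' := by
    rintro a b ⟨ha, ha', ha''⟩ ⟨hb, hb', hb''⟩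
    refine ⟨add_mem ha hb, by rw [Subring.coe_add, star_add, ha', hb'], fun x hx => ?_⟩
    rw [Subring.coe_add, add_mul]
    exact add_mem (ha'' x hx) (hb'' x hx)
  neg_mem' := by
    rintro a ⟨ha, ha', ha''⟩
    refine ⟨neg_mem ha, by rw [Subring.coe_neg, star_neg, ha'], fun x hx => ?_⟩
    rw [Subring.coe_neg, neg_mul]
    exact neg_mem (ha'' x hx)
  mul_mem' := by
    rintro a b ⟨ha, ha', ha''⟩ ⟨hb, hb', hb''⟩
    refine ⟨by simpa using SetLike.GradedMul.mul_mem ha hb, ?_, fun x hx => ?_⟩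
    · rw [Subring.coe_mul, star_mul, ha', hb', Subring.mem_center_iff.1 a.2]
    · rw [Subring.coe_mul, mul_assoc]
      exact ha'' _ (hb'' x hx)

variable {Λ}

theorem formScalars_smul (a : formScalars 𝒜 Λ) (x : R) : a • x = ((a : Subring.center R) : R) * x :=
  rfl

theorem isFormAlgebra_formScalars {lam : R} (h : IsFormRing lam Λ) :
    IsFormAlgebra (formScalars 𝒜 Λ) lam Λ where
  __ := h
  star_smul a x := by
    rw [formScalars_smul, formScalars_smul, star_mul, a.2.2.1, Subring.mem_center_iff.1 a.1.2]
  smul_mem a x hx := a.2.2.2 x hx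

variable (Λ) in
/-- The inclusion of `formScalars` in the center of the degree zero part. -/
def formScalarsHom : formScalars 𝒜 Λ →+* Subring.center (𝒜 0) where
  toFun a := ⟨⟨(a : Subring.center R), a.2.1⟩, Subring.mem_center_iff.2 fun g =>
    Subtype.ext (Subring.mem_center_iff.1 a.1.2 (g : R))⟩
  map_one' := rfl
  map_mul' a b := by
    apply Subtype.ext; apply Subtype.ext
    simp
  map_zero' := rfl
  map_add' a b := rfl

variable (m : Ideal (Subring.center (𝒜 0))) [m.IsPrime]

variable (Λ) in
/-- The elements of `formScalars` outside `m`. -/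
abbrev scalarDenominators : Submonoid (formScalars 𝒜 Λ) :=
  (m.comap (formScalarsHom 𝒜 Λ)).primeCompl

/-- An element of `formScalars` outside `m` as a denominator. -/
def toDenominator (s : scalarDenominators 𝒜 Λ m) : denominators 𝒜 m :=
  ⟨s.1.1, ⟨formScalarsHom 𝒜 Λ s, s.2, rfl⟩, ⟨formScalarsHom 𝒜 Λ s, s.2, s.1.2.2.1.symm⟩⟩

theorem starDenominator_toDenominator (s : scalarDenominators 𝒜 Λ m) :
    starDenominator 𝒜 m (toDenominator 𝒜 m s) = toDenominator 𝒜 m s :=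
  Subtype.ext (Subtype.ext s.1.2.2.1)

variable (Λ) in
/-- The canonical homomorphism to the ring of fractions. -/
def toLocalAlg : R →ₐ[formScalars 𝒜 Λ] LocalRing 𝒜 m where
  __ := toLocal 𝒜 m
  commutes' _ := rfl

theorem toLocalAlg_apply (x : R) : toLocalAlg 𝒜 Λ m x = LocalizedModule.mk x 1 := rfl

instance (priority := 2000) : SMul (formScalars 𝒜 Λ) (LocalRing 𝒜 m) := Algebra.toSMul

theorem smul_mk_formScalars (a : formScalars 𝒜 Λ) (x : R) (s : denominators 𝒜 m) :
    a • (LocalizedModule.mk x s : LocalRing 𝒜 m) = LocalizedModule.mk (a • x) s := by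
  rw [Algebra.smul_def]
  change LocalizedModule.mk (a : R) 1 * LocalizedModule.mk x s = _
  rw [LocalizedModule.mk_mul_mk, one_mul]
  rfl

theorem smul_mk_self (s : scalarDenominators 𝒜 Λ m) (x : R) :
    (s : formScalars 𝒜 Λ) • (LocalizedModule.mk x (toDenominator 𝒜 m s) : LocalRing 𝒜 m) =
      LocalizedModule.mk x 1 := by
  rw [smul_mk_formScalars]
  exact LocalizedModule.mk_cancel (toDenominator 𝒜 m s) x

/-- Norms and traces stabilize the form parameter. -/
theorem norm_smul_mem {lam : R} (h : IsFormRing lam Λ) {s : R} (hs : s ∈ Subring.center R) {x : R}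
    (hx : x ∈ Λ) : star s * s * x ∈ Λ := by
  rw [mul_assoc, ← Subring.mem_center_iff.1 hs, ← mul_assoc]
  exact h.form.conj_mem x hx s

/-- Since x = −λx̄, the product (s + s̄)x equals sx − λ · conj(sx). -/
theorem trace_smul_mem {lam : R} (h : IsFormRing lam Λ) {s : R} (hs : s ∈ Subring.center R) {x : R}
    (hx : x ∈ Λ) : (s + star s) * x ∈ Λ := by
  have e : (s + star s) * x = s * x - lam * star (s * x) := by
    nth_rw 1 [add_mul, sub_eq_add_neg, h.form.le_max x hx]
    rw [← h.form.le_max x hx]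
    congr 1
    nth_rw 1 [h.form.le_max x hx]
    rw [star_mul, mul_neg, ← mul_assoc, ← h.center, mul_assoc,
      Subring.mem_center_iff.1 (Set.star_mem_center hs)]
  rw [e]
  exact h.form.min_le _

/-- The norm of a denominator. -/
def normDenominator {lam : R} (h : IsFormRing lam Λ) (s : denominators 𝒜 m) :
    scalarDenominators 𝒜 Λ m :=
  ⟨⟨(starDenominator 𝒜 m s * s).1, by
    obtain ⟨⟨c, hc, hcs⟩, ⟨c', hc', hcs'⟩⟩ := s.2
    refine ⟨?_, ?_, fun x hx => norm_smul_mem h s.1.2 hx⟩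
    · change star (s.1 : R) * (s.1 : R) ∈ 𝒜 0
      rw [← hcs', ← hcs]
      exact (c'.1 * c.1 : 𝒜 0).2
    · change star (star (s.1 : R) * (s.1 : R)) = star (s.1 : R) * (s.1 : R)
      rw [star_mul, star_star]⟩, by
    obtain ⟨⟨c, hc, hcs⟩, ⟨c', hc', hcs'⟩⟩ := s.2
    intro hmem
    replace hmem : formScalarsHom 𝒜 Λ _ ∈ m := hmem
    rw [show formScalarsHom 𝒜 Λ ⟨(starDenominator 𝒜 m s * s).1, _⟩ = c' * c from
      Subtype.ext (Subtype.ext (congrArg₂ (· * ·) hcs'.symm hcs.symm))] at hmem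
    exact (Ideal.IsPrime.mem_or_mem ‹m.IsPrime› hmem).elim hc' hc⟩

theorem toDenominator_normDenominator {lam : R} (h : IsFormRing lam Λ) (s : denominators 𝒜 m) :
    toDenominator 𝒜 m (normDenominator 𝒜 m h s) = starDenominator 𝒜 m s * s := rfl

theorem mk_eq_mk_norm {lam : R} (h : IsFormRing lam Λ) (x : R) (s : denominators 𝒜 m) :
    (LocalizedModule.mk x s : LocalRing 𝒜 m) = LocalizedModule.mk (starDenominator 𝒜 m s • x)
      (toDenominator 𝒜 m (normDenominator 𝒜 m h s)) := by
  rw [toDenominator_normDenominator, LocalizedModule.mk_cancel_common_left]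

/-- Denominators of R_m need not be symmetric, but x/s = s̄x/(s̄s) and s̄s is a form scalar outside
m. So inverting the form scalars outside m already gives R_m. -/
theorem isFormLocalization_toLocal {lam : R} (h : IsFormRing lam Λ) :
    IsFormLocalization (scalarDenominators 𝒜 Λ m) Λ (localFormParameter 𝒜 m Λ)
      (toLocalAlg 𝒜 Λ m) where
  map_star x := by
    have h1 : starDenominator 𝒜 m 1 = 1 := Subtype.ext (Subtype.ext (star_one R))
    change _ = localStar 𝒜 m (LocalizedModule.mk x 1)
    rw [localStar_mk, h1, toLocalAlg_apply]
  map_mem x hx := by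
    have h1 : starDenominator 𝒜 m 1 = 1 := Subtype.ext (Subtype.ext (star_one R))
    exact AddSubgroup.subset_closure ⟨x, hx, 1, by rw [h1, one_mul, toLocalAlg_apply]⟩
  isUnit s hs := by
    let s' : scalarDenominators 𝒜 Λ m := ⟨s, hs⟩
    rw [isUnit_iff_exists]
    refine ⟨LocalizedModule.mk 1 (toDenominator 𝒜 m s'), ?_, ?_⟩
    · rw [← Algebra.smul_def]
      exact (smul_mk_self 𝒜 m s' 1).trans (map_one (toLocal 𝒜 m))
    · rw [← Algebra.commutes, ← Algebra.smul_def]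
      exact (smul_mk_self 𝒜 m s' 1).trans (map_one (toLocal 𝒜 m))
  surj y := by
    induction y using LocalizedModule.induction_on with
    | h x s =>
      refine ⟨_, (normDenominator 𝒜 m h s).2, starDenominator 𝒜 m s • x, ?_⟩
      rw [mk_eq_mk_norm 𝒜 m h, smul_mk_self, toLocalAlg_apply]
  surj_form y hy := by
    suffices hle : localFormParameter 𝒜 m Λ ≤ fractionForm (S := scalarDenominators 𝒜 Λ m)
      (φ := toLocalAlg 𝒜 Λ m) (isFormAlgebra_formScalars 𝒜 h) from hle hy
    refine (AddSubgroup.closure_le _).2 ?_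
    rintro _ ⟨x, hx, s, rfl⟩
    refine ⟨_, (normDenominator 𝒜 m h s).2, x, hx, ?_⟩
    rw [← toDenominator_normDenominator 𝒜 m h, smul_mk_self, toLocalAlg_apply]
  eq_zero x hx := by
    rw [toLocalAlg_apply, ← LocalizedModule.zero_mk 1, LocalizedModule.mk_eq] at hx
    obtain ⟨u, hu⟩ := hx
    rw [one_smul, one_smul, smul_zero] at hu
    refine ⟨_, (normDenominator 𝒜 m h u).2, ?_⟩
    change star (u.1 : R) * (u.1 : R) * x = 0
    rw [mul_assoc]
    change star (u.1 : R) * (u • x) = 0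
    rw [hu, mul_zero]

/-- For symmetric s one has x/s = sx/(s̄s), and sx stays in Λ. -/
theorem mem_localFormParameter {lam : R} (h : IsFormRing lam Λ) (y : LocalRing 𝒜 m) :
    ∀ s ∈ scalarDenominators 𝒜 Λ m, ∀ x ∈ Λ, s • y = toLocalAlg 𝒜 Λ m x →
      y ∈ localFormParameter 𝒜 m Λ := fun s hs x hx hsy => by
  have H := isFormAlgebra_formScalars 𝒜 h
  have hφ := isFormLocalization_toLocal 𝒜 m h
  refine AddSubgroup.subset_closure ?_
  let s' : scalarDenominators 𝒜 Λ m := ⟨s, hs⟩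
  refine ⟨s • x, H.smul_mem s x hx, toDenominator 𝒜 m s', hφ.smul_cancel hs ?_⟩
  rw [hsy, starDenominator_toDenominator, toLocalAlg_apply, ← smul_mk_self 𝒜 m s']
  exact (congrArg (fun z => s • z)
    (LocalizedModule.mk_cancel_common_left (toDenominator 𝒜 m s') (toDenominator 𝒜 m s') x)).symm

theorem mem_localFormParameter_of_smul_mem {lam : R} (h : IsFormRing lam Λ) {s : formScalars 𝒜 Λ}
    (hs : s ∈ scalarDenominators 𝒜 Λ m) {y : LocalRing 𝒜 m}
    (hy : s • y ∈ localFormParameter 𝒜 m Λ) : y ∈ localFormParameter 𝒜 m Λ :=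
  (isFormLocalization_toLocal 𝒜 m h).mem_of_smul_mem (mem_localFormParameter 𝒜 m h) hs hy

theorem isFormAlgebra_local {lam : R} (h : IsFormRing lam Λ) :
    IsFormAlgebra (formScalars 𝒜 Λ) (toLocal 𝒜 m lam) (localFormParameter 𝒜 m Λ) :=
  (isFormLocalization_toLocal 𝒜 m h).isFormAlgebra (isFormAlgebra_formScalars 𝒜 h)
    (mem_localFormParameter 𝒜 m h)

end Datum

end QuadraticGroup

end

noncomputable section

namespace QuadraticGroup

open Matrix MulOpposite Polynomial

/-! ### Maximal ideals of the form scalars lie under maximal ideals of C(R_0) -/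

section LyingOver

variable {R : Type*} [Ring R] [StarRing R] (𝒜 : ℕ → AddSubgroup R) [GradedRing 𝒜]
  {Λ : AddSubgroup R}

/-- The central elements of degree zero. -/
def centerZero : Subring (Subring.center R) where
  carrier := {c | (c : R) ∈ 𝒜 0}
  zero_mem' := zero_mem (𝒜 0)
  one_mem' := SetLike.GradedOne.one_mem (A := 𝒜)
  add_mem' := fun ha hb => add_mem (S := AddSubgroup R) ha hb
  neg_mem' := fun ha => neg_mem (S := AddSubgroup R) ha
  mul_mem' := fun {a b} ha hb => by
    have := SetLike.GradedMul.mul_mem (A := 𝒜) ha hb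
    rwa [zero_add] at this

/-- Central elements of degree zero are central in the degree zero part. -/
def centerZeroHom : centerZero 𝒜 →+* Subring.center (𝒜 0) where
  toFun a := ⟨⟨(a : Subring.center R), a.2⟩, Subring.mem_center_iff.2 fun g =>
    Subtype.ext (Subring.mem_center_iff.1 a.1.2 (g : R))⟩
  map_one' := rfl
  map_mul' a b := by
    apply Subtype.ext; apply Subtype.ext
    simp
  map_zero' := rfl
  map_add' a b := rfl

-- For homogeneous y of degree j, compare the components of degree j in cy = yc.
omit [StarRing R] in
theorem decompose_zero_mem_center {c : R} (hc : c ∈ Subring.center R) :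
    GradedRing.projZeroRingHom 𝒜 c ∈ Subring.center R := by
  rw [Subring.mem_center_iff]
  intro y
  induction y using DirectSum.Decomposition.inductionOn 𝒜 with
  | zero => rw [zero_mul, mul_zero]
  | add y z hy hz => rw [add_mul, mul_add, hy, hz]
  | homogeneous y =>
    rename_i j
    have e1 := DirectSum.coe_decompose_mul_add_of_left_mem 𝒜 (b := c) (j := 0) y.2
    have e2 := DirectSum.coe_decompose_mul_add_of_right_mem 𝒜 (a := c) (i := 0) y.2
    rw [GradedRing.projZeroRingHom_apply, ← e1, ← e2, add_zero, zero_add,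
      Subring.mem_center_iff.1 hc]

/-- The degree zero part of a central element. -/
def centerProj : Subring.center R →+* centerZero 𝒜 where
  toFun c := ⟨⟨GradedRing.projZeroRingHom 𝒜 c, decompose_zero_mem_center 𝒜 c.2⟩,
    (DirectSum.decompose 𝒜 (c : R) 0).2⟩
  map_one' := by apply Subtype.ext; apply Subtype.ext; exact map_one (GradedRing.projZeroRingHom 𝒜)
  map_mul' a b := by
    apply Subtype.ext; apply Subtype.ext; exact map_mul (GradedRing.projZeroRingHom 𝒜) _ _
  map_zero' := by
    apply Subtype.ext; apply Subtype.ext; exact map_zero (GradedRing.projZeroRingHom 𝒜)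
  map_add' a b := by
    apply Subtype.ext; apply Subtype.ext; exact map_add (GradedRing.projZeroRingHom 𝒜) _ _

omit [StarRing R] in
theorem centerProj_surjective : Function.Surjective (centerProj 𝒜) := fun c =>
  ⟨c.1, Subtype.ext (Subtype.ext (DirectSum.decompose_of_mem_same 𝒜 c.2))⟩

-- Projecting generators of R over its center to degree zero makes R_0 a finite module over the
-- central elements of degree zero, so every element of C(R_0) is integral over them.
omit [StarRing R] in
theorem isIntegral_centerZeroHom [Module.Finite (Subring.center R) R] :
    (centerZeroHom 𝒜).IsIntegral := by
  let : Algebra (centerZero 𝒜) (Subring.center (𝒜 0)) := (centerZeroHom 𝒜).toAlgebra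
  let : Algebra (centerZero 𝒜) (𝒜 0) := ((Subring.center (𝒜 0)).subtype.comp
    (centerZeroHom 𝒜)).toAlgebra' fun c x => (Subring.mem_center_iff.1 (centerZeroHom 𝒜 c).2 x).symm
  have : RingHomSurjective (centerProj 𝒜) := ⟨centerProj_surjective 𝒜⟩
  let p : R →ₛₗ[centerProj 𝒜] 𝒜 0 :=
    { toFun := GradedRing.projZeroRingHom' 𝒜
      map_add' := map_add _
      map_smul' := fun c x => map_mul (GradedRing.projZeroRingHom' 𝒜) (c : R) x }
  have : Module.Finite (centerZero 𝒜) (𝒜 0) :=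
    Module.Finite.of_surjective p (GradedRing.projZeroRingHom'_surjective 𝒜)
  let f : Subring.center (𝒜 0) →ₐ[centerZero 𝒜] 𝒜 0 :=
    { (Subring.center (𝒜 0)).subtype with commutes' := fun _ => rfl }
  intro x
  exact (isIntegral_algHom_iff f Subtype.val_injective).1
    (IsIntegral.of_finite (centerZero 𝒜) (f x))

theorem formScalars_le_centerZero : formScalars 𝒜 Λ ≤ centerZero 𝒜 := fun _ hc => hc.1

/-- The element z is a root of X² − (z + z̄)X + z̄z, and traces and norms are form scalars. -/
theorem isIntegral_inclusion {lam : R} (h : IsFormRing lam Λ)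
    (hstar : ∀ i, ∀ a ∈ 𝒜 i, star a ∈ 𝒜 i) :
    (Subring.inclusion (formScalars_le_centerZero 𝒜 (Λ := Λ))).IsIntegral := by
  intro z
  have hz : star ((z : Subring.center R) : R) ∈ Subring.center R := Set.star_mem_center z.1.2
  let z' : centerZero 𝒜 := ⟨⟨star ((z : Subring.center R) : R), hz⟩, hstar 0 _ z.2⟩
  let t : formScalars 𝒜 Λ := ⟨(z + z' : centerZero 𝒜), (z + z').2, by
    change star (((z : Subring.center R) : R) + star ((z : Subring.center R) : R)) = _ + _
    rw [star_add, star_star, add_comm], fun x hx => trace_smul_mem h z.1.2 hx⟩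
  let d : formScalars 𝒜 Λ := ⟨(z' * z : centerZero 𝒜), (z' * z).2, by
    change star (star ((z : Subring.center R) : R) * ((z : Subring.center R) : R)) = _ * _
    rw [star_mul, star_star], fun x hx => norm_smul_mem h z.1.2 hx⟩
  refine ⟨X ^ 2 - (C t * X - C d), ?_, ?_⟩
  · apply Polynomial.monic_X_pow_sub
    refine lt_of_le_of_lt (b := 1) ?_ (by norm_num)
    compute_degree
  · have ht : Subring.inclusion (formScalars_le_centerZero 𝒜 (Λ := Λ)) t = z + z' := rfl
    have hd : Subring.inclusion (formScalars_le_centerZero 𝒜 (Λ := Λ)) d = z' * z := rfl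
    rw [eval₂_sub, eval₂_sub, eval₂_mul, eval₂_C, eval₂_C, eval₂_X_pow, eval₂_X, ht, hd]
    ring

theorem exists_isMaximal_comap_eq [Module.Finite (Subring.center R) R] {lam : R}
    (h : IsFormRing lam Λ) (hstar : ∀ i, ∀ a ∈ 𝒜 i, star a ∈ 𝒜 i)
    (𝔫 : Ideal (formScalars 𝒜 Λ)) [𝔫.IsMaximal] :
    ∃ m : Ideal (Subring.center (𝒜 0)), m.IsMaximal ∧ m.comap (formScalarsHom 𝒜 Λ) = 𝔫 := by
  let : Algebra (formScalars 𝒜 Λ) (Subring.center (𝒜 0)) := (formScalarsHom 𝒜 Λ).toAlgebra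
  have : Algebra.IsIntegral (formScalars 𝒜 Λ) (Subring.center (𝒜 0)) :=
    ⟨(isIntegral_inclusion 𝒜 h hstar).trans _ _ (isIntegral_centerZeroHom 𝒜)⟩
  refine Ideal.exists_ideal_over_maximal_of_isIntegral 𝔫 ?_
  intro a ha
  have : a = 0 := by
    apply Subtype.ext; apply Subtype.ext
    exact congrArg (fun z : Subring.center (𝒜 0) => ((z : 𝒜 0) : R)) (RingHom.mem_ker.1 ha)
  rw [this]
  exact zero_mem _

end LyingOver

/-! ### The local-global principle over R[X] -/

section LocalGlobal

variable {R : Type*} [Ring R] [StarRing R] [Module.Finite (Subring.center R) R]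
  (𝒜 : ℕ → AddSubgroup R) [GradedRing 𝒜] {lam : R} {Λ : AddSubgroup R} {n : ℕ}

/-- A matrix over `R[X]` with constant term `1` is elementary if it is so locally. -/
theorem mem_EQ_of_local (h : IsFormRing lam Λ) (hstar : ∀ i, ∀ a ∈ 𝒜 i, star a ∈ 𝒜 i)
    (hn : 3 ≤ n) {g : GL (Fin n ⊕ Fin n) R[X]} (h0 : glMap (evalZero R) g = 1)
    (hloc : ∀ (m : Ideal (Subring.center (𝒜 0))) [m.IsMaximal],
      glMap (mapRingHom (toLocal 𝒜 m)) g ∈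
        EQ n (C (toLocal 𝒜 m lam)) (polyForm (localFormParameter 𝒜 m Λ))) :
    g ∈ EQ n (C lam) (polyForm Λ) := by
  have H := isFormAlgebra_formScalars 𝒜 h
  refine mem_EQ_of_dilationIdeal_eq_top H h0 ?_
  by_contra htop
  -- A maximal ideal containing the proper ideal is contracted from some m, while dilation at m
  -- gives an element of the ideal outside it.
  obtain ⟨𝔫, h𝔫, hle⟩ := Ideal.exists_le_maximal _ htop
  obtain ⟨m, hm, rfl⟩ := exists_isMaximal_comap_eq 𝒜 h hstar 𝔫
  obtain ⟨t, ht, htg⟩ := exists_mem_dilationIdeal H (isFormAlgebra_local 𝒜 m h)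
    (isFormLocalization_toLocal 𝒜 m h) hn (g := g) (hloc m)
  exact ht (hle htg)

end LocalGlobal

/-! ### The homomorphism ε -/

section Epsilon

variable {R : Type*} [Ring R] (𝒜 : ℕ → AddSubgroup R) [GradedRing 𝒜]

theorem epsilon_of_mem {i : ℕ} {a : R} (ha : a ∈ 𝒜 i) : epsilon 𝒜 a = monomial i a := by
  rw [epsilon, DirectSum.decompose_of_mem 𝒜 ha]
  simp

theorem epsilon_add (a b : R) : epsilon 𝒜 (a + b) = epsilon 𝒜 a + epsilon 𝒜 b := by
  rw [epsilon, DirectSum.decompose_add, map_add]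
  rfl

/-- `epsilon` as a ring homomorphism. -/
def epsilonHom : R →+* R[X] where
  toFun := epsilon 𝒜
  map_one' := by rw [epsilon_of_mem 𝒜 SetLike.GradedOne.one_mem]; rfl
  map_zero' := by rw [epsilon_of_mem 𝒜 (zero_mem (𝒜 0)), map_zero]
  map_add' := epsilon_add 𝒜
  map_mul' a b := by
    induction a using DirectSum.Decomposition.inductionOn 𝒜 with
    | zero => rw [zero_mul, epsilon_of_mem 𝒜 (zero_mem (𝒜 0)), map_zero, zero_mul]
    | add x y hx hy => rw [add_mul, epsilon_add, epsilon_add, hx, hy, add_mul]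
    | homogeneous x =>
      induction b using DirectSum.Decomposition.inductionOn 𝒜 with
      | zero => rw [mul_zero, epsilon_of_mem 𝒜 (zero_mem (𝒜 0)), map_zero, mul_zero]
      | add y z hy hz => rw [mul_add, epsilon_add, epsilon_add, hy, hz, mul_add]
      | homogeneous y =>
        rw [epsilon_of_mem 𝒜 x.2, epsilon_of_mem 𝒜 y.2, monomial_mul_monomial,
          epsilon_of_mem 𝒜 (SetLike.GradedMul.mul_mem x.2 y.2)]

theorem coeff_epsilonHom (b : R) (k : ℕ) :
    (epsilonHom 𝒜 b).coeff k = DirectSum.decompose 𝒜 b k := by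
  change (epsilon 𝒜 b).coeff k = _
  induction b using DirectSum.Decomposition.inductionOn 𝒜 with
  | zero => simp [epsilon_of_mem 𝒜 (zero_mem (𝒜 0))]
  | add x y hx hy => simp [epsilon_add, hx, hy]
  | homogeneous x =>
    rw [epsilon_of_mem 𝒜 x.2, coeff_monomial, DirectSum.decompose_coe, DirectSum.coe_of_apply]
    split_ifs <;> rfl

theorem eval_one_epsilonHom (b : R) : (epsilonHom 𝒜 b).eval 1 = b := by
  change (epsilon 𝒜 b).eval 1 = _
  induction b using DirectSum.Decomposition.inductionOn 𝒜 with
  | zero => simp [epsilon_of_mem 𝒜 (zero_mem (𝒜 0))]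
  | add x y hx hy => rw [epsilon_add, eval_add, hx, hy]
  | homogeneous x => rw [epsilon_of_mem 𝒜 x.2, eval_monomial, one_pow, mul_one]

variable [StarRing R] {lam : R} {Λ : AddSubgroup R}

/-- The coefficients of ε(x) are the homogeneous components of x; homogeneity of Λ therefore sends Λ
into the polynomials over Λ. -/
theorem isFormHom_epsilonHom (hstar : ∀ i, ∀ a ∈ 𝒜 i, star a ∈ 𝒜 i) (hlam : lam ∈ 𝒜 0)
    (hΛ : ∀ a ∈ Λ, ∀ i, (DirectSum.decompose 𝒜 a i : R) ∈ Λ) :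
    IsFormHom lam Λ (C lam) (polyForm Λ) (epsilonHom 𝒜) where
  map_star b := by
    change epsilon 𝒜 (star b) = star (epsilon 𝒜 b)
    induction b using DirectSum.Decomposition.inductionOn 𝒜 with
    | zero => rw [star_zero, epsilon_of_mem 𝒜 (zero_mem (𝒜 0)), map_zero, star_zero]
    | add x y hx hy => rw [star_add, epsilon_add, epsilon_add, hx, hy, star_add]
    | homogeneous x =>
      rw [epsilon_of_mem 𝒜 x.2, epsilon_of_mem 𝒜 (hstar _ _ x.2), star_monomial]
  map_lam := epsilon_of_mem 𝒜 hlam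
  map_mem x hx k := by
    rw [coeff_epsilonHom]
    exact hΛ x hx k

variable (Λ) in
/-- `epsilon` as an algebra homomorphism. -/
def epsilonAlgHom : R →ₐ[formScalars 𝒜 Λ] R[X] where
  __ := epsilonHom 𝒜
  commutes' a := epsilon_of_mem 𝒜 a.2.1

end Epsilon

/-! ### Universal property of the localization -/

section Lift

variable {A R R' B : Type*} [CommRing A] [Ring R] [StarRing R] [Algebra A R] [Ring R'] [StarRing R']
  [Algebra A R'] [Ring B] [Algebra A B] {lam : R} {Λ : AddSubgroup R} {Λ' : AddSubgroup R'}
  {S : Submonoid A} {φ : R →ₐ[A] R'}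

/-- Only central scalars are inverted, so the lift exists for modules, and its multiplicativity can
be checked after clearing denominators. -/
theorem IsFormLocalization.exists_lift (hφ : IsFormLocalization S Λ Λ' φ) (f : R →ₐ[A] B)
    (hf : ∀ s ∈ S, IsUnit (algebraMap A B s)) : ∃ F : R' →ₐ[A] B, F.comp φ = f := by
  have hcancel : ∀ s ∈ S, ∀ y z : B, s • y = s • z → y = z := fun s hs y z hyz => by
    rw [Algebra.smul_def, Algebra.smul_def] at hyz
    exact (hf s hs).mul_left_cancel hyz
  have : IsLocalizedModule S φ.toLinearMap :=
    { map_units := fun s => by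
        have := (hφ.isUnit s s.2).map (Algebra.lmul A R')
        rwa [AlgHom.commutes] at this
      surj := fun y => by
        obtain ⟨s, hs, x, hx⟩ := hφ.surj y
        exact ⟨(x, ⟨s, hs⟩), hx⟩
      exists_of_eq := fun {x y} hxy => by
        obtain ⟨s, hs, hx⟩ := hφ.eq_zero (x - y) (by rw [map_sub, sub_eq_zero]; exact hxy)
        rw [smul_sub, sub_eq_zero] at hx
        exact ⟨⟨s, hs⟩, hx⟩ }
  have hu : ∀ s : S, IsUnit (algebraMap A (Module.End A B) s) := fun s => by
    have := (hf s s.2).map (Algebra.lmul A B)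
    rwa [AlgHom.commutes] at this
  let F := IsLocalizedModule.lift S φ.toLinearMap f.toLinearMap hu
  have hF : ∀ x, F (φ x) = f x := fun x =>
    congrArg (fun l : R →ₗ[A] B => l x) (IsLocalizedModule.lift_comp S φ.toLinearMap _ hu)
  refine ⟨AlgHom.ofLinearMap F ?_ fun y z => ?_, AlgHom.ext hF⟩
  · rw [← map_one φ, hF, map_one]
  · obtain ⟨s, hs, x, hx⟩ := hφ.surj y
    obtain ⟨t, ht, w, hw⟩ := hφ.surj z
    refine hcancel _ (S.mul_mem hs ht) _ _ ?_
    have e : (s * t) • (F y * F z) = (s • F y) * (t • F z) := by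
      rw [smul_mul_smul_comm]
    rw [e, ← map_smul, ← map_smul, ← map_smul, hx, hw, hF, hF, ← map_mul, ← hF, map_mul, ← hx, ← hw,
      smul_mul_smul_comm]

variable [StarRing B] {lam' : B} {Λ'' : AddSubgroup B}

theorem IsFormLocalization.isFormHom_lift (h : IsFormAlgebra A lam Λ)
    (hφ : IsFormLocalization S Λ Λ' φ) {F : R' →ₐ[A] B} (hB : IsFormAlgebra A lam' Λ'')
    (hf : IsFormHom lam Λ lam' Λ'' (F.comp φ).toRingHom)
    (hsat : ∀ s ∈ S, ∀ y, s • y ∈ Λ'' → y ∈ Λ'') :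
    IsFormHom (φ lam) Λ' lam' Λ'' F.toRingHom where
  map_star y := by
    obtain ⟨s, hs, x, hx⟩ := hφ.surj y
    have hu : IsUnit (algebraMap A B s) := by
      have := (hφ.isUnit s hs).map F
      rwa [AlgHom.commutes] at this
    refine hu.mul_left_cancel ?_
    rw [← Algebra.smul_def, ← Algebra.smul_def]
    change s • F (star y) = s • star (F y)
    rw [← map_smul, ← hφ.star_smul h, ← hB.star_smul, ← map_smul, hx, ← hφ.map_star]
    exact hf.map_star x
  map_lam := hf.map_lam
  map_mem y hy := by
    obtain ⟨s, hs, x, hx, hsx⟩ := hφ.surj_form y hy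
    refine hsat s hs _ ?_
    change s • F y ∈ Λ''
    rw [← map_smul, hsx]
    exact hf.map_mem x hx

end Lift

/-! ### Assertion 2: deformation along the grading -/

section Graded

variable {R : Type*} [Ring R] [StarRing R] (𝒜 : ℕ → AddSubgroup R) [GradedRing 𝒜] {lam : R}
  {Λ : AddSubgroup R} {n : ℕ}

theorem mem_EQ_of_graded_local [Module.Finite (Subring.center R) R] (h : IsFormRing lam Λ)
    (hstar : ∀ i, ∀ a ∈ 𝒜 i, star a ∈ 𝒜 i) (hlam : lam ∈ 𝒜 0)
    (hΛ : ∀ a ∈ Λ, ∀ i, (DirectSum.decompose 𝒜 a i : R) ∈ Λ) (hn : 3 ≤ n)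
    {α : GL (Fin n ⊕ Fin n) R} (h0 : α.val.map (fun b => plusEval 𝒜 b 0) = 1)
    (hloc : ∀ (m : Ideal (Subring.center (𝒜 0))) [m.IsMaximal],
      localMatrix 𝒜 m α ∈ EQ n (toLocal 𝒜 m lam) (localFormParameter 𝒜 m Λ)) :
    α ∈ EQ n lam Λ := by
  have hε := isFormHom_epsilonHom 𝒜 hstar hlam hΛ
  have hmem : glMap (epsilonHom 𝒜) α ∈ EQ n (C lam) (polyForm Λ) := by
    refine mem_EQ_of_local 𝒜 h hstar hn ?_ fun m _ => ?_
    · refine Units.ext ?_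
      have e : (glMap (evalZero R) (glMap (epsilonHom 𝒜) α)).val =
          (α.val.map fun b => plusEval 𝒜 b 0).map (C : R →+* R[X]) := by
        ext1 i j
        exact congrArg C (coeff_zero_eq_eval_zero (epsilon 𝒜 (α.val i j)))
      rw [e, h0]
      exact map_one (C : R →+* R[X]).mapMatrix
    · have H := isFormAlgebra_formScalars 𝒜 h
      have hφ := isFormLocalization_toLocal 𝒜 m h
      have H' := isFormAlgebra_local 𝒜 m h
      -- Form scalars have degree zero, so ε is linear over them and extends to F : R_m → R_m[X].
      -- Applying F to α_m shows that ε(α) is elementary over R_m[X].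
      obtain ⟨F, hF⟩ := hφ.exists_lift ((mapAlgHom (toLocalAlg 𝒜 Λ m)).comp (epsilonAlgHom 𝒜 Λ))
        (hφ.polynomial H).isUnit
      have hF' := hφ.isFormHom_lift H (F := F) H'.polynomial (by
        rw [hF]
        have h1 : IsFormHom (C lam) (polyForm Λ) (C (toLocal 𝒜 m lam))
          (polyForm (localFormParameter 𝒜 m Λ)) (mapAlgHom (toLocalAlg 𝒜 Λ m)).toRingHom :=
          ⟨(hφ.polynomial H).map_star, by rw [AlgHom.toRingHom_eq_coe, RingHom.coe_coe, coe_mapAlgHom, map_C]; rfl, (hφ.polynomial H).map_mem⟩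
        exact h1.comp hε)
        fun s hs p hp k => mem_localFormParameter_of_smul_mem 𝒜 m h hs (hp k)
      have h2 := hF'.glMap_mem_EQ H'.toIsFormRing H'.polynomial.toIsFormRing (hloc m)
      have e : ∀ x, F (toLocalAlg 𝒜 Λ m x) = mapAlgHom (toLocalAlg 𝒜 Λ m) (epsilonHom 𝒜 x) :=
        fun x => congrArg (fun f : R →ₐ[formScalars 𝒜 Λ] _ => f x) hF
      change glMap F.toRingHom (glMap (toLocal 𝒜 m) α) ∈ _ at h2
      rw [glMap_glMap] at h2
      rw [glMap_glMap]
      rwa [glMap_congr (f' := (mapRingHom (toLocal 𝒜 m)).comp (epsilonHom 𝒜)) e] at h2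
  -- Evaluation at X = 1 recovers α.
  have h1 := (isFormHom_evalHom isFormHom_id (isScalar_one (Λ := Λ))).glMap_mem_EQ h.polynomial h hmem
  rw [glMap_glMap, glMap_congr (f' := RingHom.id R)] at h1
  · exact h1
  · exact eval_one_epsilonHom 𝒜

end Graded

end QuadraticGroup

end

noncomputable section

namespace QuadraticGroup

open Matrix MulOpposite Polynomial

/-! ### Enlarging principal left ideals in semisimple rings -/

section Semisimple

variable {Q : Type*} [Ring Q] [IsSemisimpleRing Q]

/-- The left ideal Qx is generated by an idempotent e = zx, and xe = x because x ∈ Qe. -/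
theorem exists_mul_mul_eq_self (x : Q) : ∃ z, x * z * x = x := by
  obtain ⟨e, he, hx⟩ := IsSemisimpleRing.ideal_eq_span_idempotent (Ideal.span {x})
  obtain ⟨z, hz⟩ := Ideal.mem_span_singleton'.1 (hx ▸ Ideal.mem_span_singleton_self e)
  obtain ⟨r, hr⟩ := Ideal.mem_span_singleton'.1 (hx ▸ Ideal.mem_span_singleton_self x)
  refine ⟨z, ?_⟩
  rw [mul_assoc, hz]
  nth_rw 1 [← hr]
  rw [mul_assoc, he.eq, hr]

/-- The r with rQt = 0 form a two-sided ideal K. Modulo K one has xz = 1, hence zx = 1 by Dedekind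
finiteness; writing t = twt then gives t = t(1 − zx)wt = 0. -/
theorem eq_zero_of_forall_mul_mul_eq_zero {x z t : Q}
    (ht : t * (1 - z * x) = t) (h : ∀ q, (1 - x * z) * q * t = 0) : t = 0 := by
  let K : Ideal Q :=
    { carrier := {r | ∀ q, r * q * t = 0}
      zero_mem' := fun q => by rw [zero_mul, zero_mul]
      add_mem' := fun ha hb q => by rw [add_mul, add_mul, ha q, hb q, add_zero]
      smul_mem' := fun c r hr q => by
        rw [smul_eq_mul, mul_assoc, mul_assoc, ← mul_assoc r, hr q, mul_zero] }
  have hK : K.IsTwoSided := ⟨fun {a} b ha q => by rw [mul_assoc a]; exact ha _⟩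
  have h1 : Ideal.Quotient.mk K x * Ideal.Quotient.mk K z = 1 := by
    rw [← map_mul, ← map_one (Ideal.Quotient.mk K), eq_comm, Ideal.Quotient.eq]
    exact h
  have h2 := mul_eq_one_symm h1
  rw [← map_mul, ← map_one (Ideal.Quotient.mk K), eq_comm, Ideal.Quotient.eq] at h2
  obtain ⟨w, hw⟩ := exists_mul_mul_eq_self t
  have h3 : t * ((1 - z * x) * w * t) = t := by rw [← mul_assoc, ← mul_assoc, ht, hw]
  rw [← h3, h2 w, mul_zero]

/-- In a semisimple ring, a left ideal `Q * x` which does not contain `y` can be enlarged by adding a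
multiple of `y` to `x`. -/
theorem exists_span_lt {x y : Q} (hy : y ∉ Ideal.span {x}) :
    ∃ a, Ideal.span {x} < Ideal.span {x + a * y} := by
  obtain ⟨z, hz⟩ := exists_mul_mul_eq_self x
  by_contra! hcon
  refine hy ?_
  have hx1 : x * (1 - z * x) = 0 := by rw [mul_sub, mul_one, ← mul_assoc, hz, sub_self]
  have hid : (1 - z * x) * (1 - z * x) = 1 - z * x := by
    rw [sub_mul, one_mul, mul_assoc z, hx1, mul_zero, sub_zero]
  have key : y * (1 - z * x) = 0 := by
    refine eq_zero_of_forall_mul_mul_eq_zero (by rw [mul_assoc, hid]) fun c => ?_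
    -- Multiplication by xz sends x + (1 − xz)cy to x. If no strict enlargement exists, then (1 −
    -- xz)cy ∈ Qx for every c.
    have hmem : x ∈ Ideal.span {x + (1 - x * z) * c * y} :=
      Ideal.mem_span_singleton'.2 ⟨x * z, by
        rw [mul_add, hz, ← mul_assoc, ← mul_assoc, mul_sub, mul_one, ← mul_assoc, hz, sub_self,
          zero_mul, zero_mul, add_zero]⟩
    have hle : Ideal.span {x} ≤ Ideal.span {x + (1 - x * z) * c * y} :=
      (Ideal.span_singleton_le_iff_mem _).2 hmem
    have hmem2 : x + (1 - x * z) * c * y ∈ Ideal.span {x} := by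
      have heq := eq_of_le_of_not_lt hle (hcon _)
      rw [heq]
      exact Ideal.mem_span_singleton_self _
    have hmem3 : (1 - x * z) * c * y ∈ Ideal.span {x} := by
      simpa using sub_mem hmem2 (Ideal.mem_span_singleton_self x)
    obtain ⟨r, hr⟩ := Ideal.mem_span_singleton'.1 hmem3
    rw [← mul_assoc, ← hr, mul_assoc, hx1, mul_zero]
  refine Ideal.mem_span_singleton'.2 ⟨y * z, ?_⟩
  rw [mul_sub, mul_one, sub_eq_zero] at key
  rw [mul_assoc, ← key]

end Semisimple

/-! ### Creating a unit coordinate by elementary moves -/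

section Orbit

variable {R Q : Type*} [Ring R] [StarRing R] [Ring Q] [IsSemisimpleRing Q] {lam : R}
  {Λ : AddSubgroup R} {n : ℕ}

theorem root_mulVec (i j : Fin n ⊕ Fin n) (a : R) (v : Fin n ⊕ Fin n → R) :
    root lam i a j *ᵥ v = v + op (a * (wt lam j * v j.swap)) • bas i -
      op (star lam * star a * (wt lam i * v i.swap)) • bas j := by
  rw [tau_mulVec, herm_bas_left, herm_bas_left]

theorem root_mulVec_apply_left {i j : Fin n ⊕ Fin n} (hij : j ≠ i) (a : R)
    (v : Fin n ⊕ Fin n → R) :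
    (root lam i a j *ᵥ v) i = v i + a * (wt lam j * v j.swap) := by
  rw [root_mulVec]
  simp [bas, hij.symm]

theorem root_mulVec_apply_right {i j : Fin n ⊕ Fin n} (hij : j ≠ i) (a : R)
    (v : Fin n ⊕ Fin n → R) :
    (root lam i a j *ᵥ v) j = v j - star lam * star a * (wt lam i * v i.swap) := by
  rw [root_mulVec]
  simp [bas, hij]

theorem root_mulVec_apply_of_ne {i j k : Fin n ⊕ Fin n} (hi : k ≠ i) (hj : k ≠ j) (a : R)
    (v : Fin n ⊕ Fin n → R) : (root lam i a j *ᵥ v) k = v k := by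
  rw [root_mulVec]
  simp [bas, hi, hj]

/-- A unimodular vector has, up to elementary matrices, a coordinate which is a unit in a given
semisimple quotient. -/
theorem exists_EQ_isUnit (h : IsFormRing lam Λ) (hn : 2 ≤ n) {φ : R →+* Q}
    (hφ : Function.Surjective φ) {v r : Fin n ⊕ Fin n → R} (hv : r ⬝ᵥ v = 1) :
    ∃ g ∈ EQ n lam Λ, ∃ k, IsUnit (φ ((g.val *ᵥ v) k)) := by
  let i : Fin n ⊕ Fin n := Sum.inl ⟨0, by omega⟩
  let P : Set (Ideal Q) := {I | ∃ g ∈ EQ n lam Λ, I = Ideal.span {φ ((g.val *ᵥ v) i)}}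
  -- Among all elementary translates of v, choose one whose i-th coordinate generates a maximal left
  -- ideal of Q.
  obtain ⟨I, ⟨⟨g, hg, rfl⟩, hmax⟩⟩ := set_has_maximal_iff_noetherian.2
    (inferInstance : IsNoetherian Q Q) P ⟨_, 1, one_mem _, rfl⟩
  set w := g.val *ᵥ v with hw
  have hstep : ∀ M, MatMem (EQ n lam Λ) M →
      ¬ Ideal.span {φ (w i)} < Ideal.span {φ ((M *ᵥ w) i)} := by
    rintro _ ⟨k, hk, rfl⟩
    refine hmax _ ⟨k * g, mul_mem hk hg, ?_⟩
    rw [hw, mulVec_mulVec, Units.val_mul]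
  -- Any multiple of such a coordinate can be added to the i-th one, so by maximality it already
  -- lies in the ideal. A preliminary move M preserving the i-th coordinate in Q is allowed.
  have hother : ∀ M, MatMem (EQ n lam Λ) M → φ ((M *ᵥ w) i) = φ (w i) → ∀ k, k ≠ i → k ≠ i.swap →
      φ ((M *ᵥ w) k) ∈ Ideal.span {φ (w i)} := by
    intro M hM hMi k hki hki'
    by_contra hcon
    obtain ⟨a, ha⟩ := exists_span_lt hcon
    obtain ⟨b, rfl⟩ := hφ a
    have hks : k.swap ≠ i.swap := fun e => hki (by simpa using congrArg Sum.swap e)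
    have hks' : k.swap ≠ i := fun e => hki' (by simpa using congrArg Sum.swap e)
    refine hstep _ ((matMem_EQ_root h hks (b * star (wt lam k.swap))).mul hM) ?_
    rw [← mulVec_mulVec, root_mulVec_apply_left hks', Sum.swap_swap, ← mul_assoc, mul_assoc b,
      ← wt_central h.center, wt_unitary h.unitary, mul_one, map_add, map_mul, hMi]
    exact ha
  obtain ⟨k, hki, hki'⟩ := exists_ne_ne_swap hn i
  have hks : k.swap ≠ i.swap := fun e => hki (by simpa using congrArg Sum.swap e)
  have hks' : k.swap ≠ i := fun e => hki' (by simpa using congrArg Sum.swap e)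
  have hone : MatMem (EQ n lam Λ) (1 : Matrix (Fin n ⊕ Fin n) (Fin n ⊕ Fin n) R) := matMem_one
  have hall : ∀ j, φ (w j) ∈ Ideal.span {φ (w i)} := by
    intro j
    by_cases hji : j = i
    · rw [hji]; exact Ideal.mem_span_singleton_self _
    by_cases hji' : j ≠ i.swap
    · simpa using hother 1 hone (by rw [one_mulVec]) j hji hji'
    rw [not_not] at hji'
    rw [hji']
    have hik : i.swap ≠ k.swap := hks.symm
    have hik' : i.swap ≠ k := hki'.symm
    obtain ⟨c, hc⟩ := Ideal.mem_span_singleton'.1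
      (by simpa using hother 1 hone (by rw [one_mulVec]) k.swap hks' hks)
    obtain ⟨c, rfl⟩ := hφ c
    -- No short root adds the coordinate at `i.swap` to the one at i. Instead M makes the coordinate
    -- at `k.swap` vanish in Q; then the `i.swap` coordinate can be added to the k-th one without
    -- changing the i-th one in Q.
    have hM := matMem_EQ_root h (i := k.swap) (j := i.swap) (by simpa using hik')
      (-c * star (wt lam i.swap))
    set M := root lam k.swap (-c * star (wt lam i.swap)) i.swap
    have hMi : (M *ᵥ w) i = w i := root_mulVec_apply_of_ne hks'.symm (swap_ne i) _ _
    have hMk : (M *ᵥ w) k = w k := root_mulVec_apply_of_ne (swap_ne k) hki' _ _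
    have hMk' : φ ((M *ᵥ w) k.swap) = 0 := by
      rw [root_mulVec_apply_left hik, Sum.swap_swap, ← mul_assoc, mul_assoc (-c),
        ← wt_central h.center, wt_unitary h.unitary, mul_one, map_add, map_mul, map_neg, neg_mul, hc,
        add_neg_cancel]
    have hN := (matMem_EQ_root h (i := k) (j := i) (ne_swap_comm (by simpa using hki'))
      (star (wt lam i))).mul hM
    have hk2 := hother _ hN (by
      rw [← mulVec_mulVec, root_mulVec_apply_right hki.symm, map_sub, map_mul, map_mul φ (wt lam k),
        hMk', mul_zero, mul_zero, sub_zero, hMi]) k hki hki'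
    rw [← mulVec_mulVec, root_mulVec_apply_left hki.symm, hMk, ← mul_assoc, ← wt_central h.center,
      wt_unitary h.unitary, one_mul, map_add, root_mulVec_apply_right hik, Sum.swap_swap,
      ← mul_assoc, map_sub, map_mul] at hk2
    have hk3 := hother 1 hone (by rw [one_mulVec]) k hki hki'
    rw [one_mulVec] at hk3
    exact (Submodule.sub_mem_iff_left _ (Ideal.mul_mem_left _ _ hk3)).1
      ((Submodule.add_mem_iff_right _ hk3).1 hk2)
  have htop : Ideal.span {φ (w i)} = ⊤ := by
    rw [Ideal.eq_top_iff_one]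
    -- Unimodularity is preserved by g, so 1 is a left combination of coordinates that all lie in
    -- the ideal.
    have hrow : (r ᵥ* (g⁻¹).val) ⬝ᵥ w = 1 := by
      rw [hw, ← dotProduct_mulVec, mulVec_mulVec]
      simp [hv]
    have := congrArg φ hrow
    rw [dotProduct, map_sum, map_one] at this
    rw [← this]
    exact sum_mem fun j _ => by rw [map_mul]; exact Ideal.mul_mem_left _ _ (hall j)
  obtain ⟨a, ha⟩ := Ideal.mem_span_singleton'.1 ((Ideal.eq_top_iff_one _).1 htop)
  exact ⟨g, hg, i, ⟨⟨_, a, mul_eq_one_symm ha, ha⟩, rfl⟩⟩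

end Orbit

/-! ### Artinian quotients and lifting of units -/

section Quotient

variable {C R : Type*} [CommRing C] [Ring R] [Algebra C R]

/-- The two-sided ideal of `R` generated by an ideal of `C`. -/
def extendIdeal (R : Type*) [Ring R] [Algebra C R] (I : Ideal C) : Ideal R where
  __ := I • (⊤ : Submodule C R)
  smul_mem' r x hx := by
    change r * x ∈ I • (⊤ : Submodule C R)
    change x ∈ I • (⊤ : Submodule C R) at hx
    induction hx using Submodule.smul_induction_on' with
    | smul c hc y _ =>
      rw [mul_smul_comm]
      exact Submodule.smul_mem_smul hc trivial
    | add y _ z _ hy hz => rw [mul_add]; exact add_mem hy hz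

theorem mem_extendIdeal {I : Ideal C} {x : R} :
    x ∈ extendIdeal R I ↔ x ∈ I • (⊤ : Submodule C R) := Iff.rfl

instance (I : Ideal C) : (extendIdeal R I).IsTwoSided where
  mul_mem_of_left {x} r hx := by
    rw [mem_extendIdeal] at hx ⊢
    induction hx using Submodule.smul_induction_on' with
    | smul c hc y _ =>
      rw [smul_mul_assoc]
      exact Submodule.smul_mem_smul hc trivial
    | add y _ z _ hy hz => rw [add_mul]; exact add_mem hy hz

theorem isArtinianRing_quotient_extendIdeal [Module.Finite C R] (I : Ideal C)
    [IsArtinianRing (C ⧸ I)] : IsArtinianRing (R ⧸ extendIdeal R I) := by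
  let f : C ⧸ I →+* R ⧸ extendIdeal R I :=
    Ideal.Quotient.lift I ((Ideal.Quotient.mk (extendIdeal R I)).comp (algebraMap C R)) fun c hc => by
      rw [RingHom.comp_apply, Ideal.Quotient.eq_zero_iff_mem, mem_extendIdeal,
        Algebra.algebraMap_eq_smul_one]
      exact Submodule.smul_mem_smul hc trivial
  let _ : Algebra (C ⧸ I) (R ⧸ extendIdeal R I) := f.toAlgebra' fun c x => by
    obtain ⟨c, rfl⟩ := Ideal.Quotient.mk_surjective c
    obtain ⟨x, rfl⟩ := Ideal.Quotient.mk_surjective x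
    change Ideal.Quotient.mk _ (algebraMap C R c) * _ = _ * Ideal.Quotient.mk _ (algebraMap C R c)
    rw [← map_mul, ← map_mul, Algebra.commutes]
  let p : R →ₛₗ[Ideal.Quotient.mk I] (R ⧸ extendIdeal R I) :=
    { toFun := Ideal.Quotient.mk _
      map_add' := map_add _
      map_smul' := fun c x => by
        rw [Algebra.smul_def, map_mul, Algebra.smul_def]
        rfl }
  have : RingHomSurjective (Ideal.Quotient.mk I) := ⟨Ideal.Quotient.mk_surjective⟩
  have : Module.Finite (C ⧸ I) (R ⧸ extendIdeal R I) :=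
    Module.Finite.of_surjective p Ideal.Quotient.mk_surjective
  exact IsArtinianRing.of_finite (C ⧸ I) _

theorem isArtinianRing_quotient_inf (I J : Ideal C) [I.IsMaximal] [J.IsMaximal] :
    IsArtinianRing (C ⧸ (I ⊓ J)) := by
  have h1 : IsSimpleModule C (C ⧸ I) := isSimpleModule_iff_isCoatom.2 (Ideal.isMaximal_def.1 ‹_›)
  have h2 : IsSimpleModule C (C ⧸ J) := isSimpleModule_iff_isCoatom.2 (Ideal.isMaximal_def.1 ‹_›)
  let f : (C ⧸ (I ⊓ J)) →ₗ[C] (C ⧸ I) × (C ⧸ J) :=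
    Submodule.liftQ (I ⊓ J) ((Submodule.mkQ I).prod (Submodule.mkQ J)) (by
      rw [LinearMap.ker_prod, Submodule.ker_mkQ, Submodule.ker_mkQ])
  have hf : Function.Injective f := by
    rw [← LinearMap.ker_eq_bot, Submodule.ker_liftQ_eq_bot]
    rw [LinearMap.ker_prod, Submodule.ker_mkQ, Submodule.ker_mkQ]
  have : IsArtinian C (C ⧸ (I ⊓ J)) := isArtinian_of_injective f hf
  exact isArtinian_of_tower C this

/-- Nakayama's lemma: if f is onto modulo I, some c ∈ 1 + I carries all of R into the image of f. -/
theorem exists_apply_eq_algebraMap [Module.Finite C R] {I : Ideal C} (f : R →ₗ[C] R)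
    (hf : ∀ x, ∃ y, f y - x ∈ extendIdeal R I) : ∃ c, c - 1 ∈ I ∧ ∃ y, f y = algebraMap C R c := by
  obtain ⟨c, hc, hle⟩ := Submodule.exists_sub_one_mem_and_smul_le_of_fg_of_le_sup (I := I)
    (N := LinearMap.range f) (N' := ⊤) (P := ⊤) Module.Finite.fg_top le_rfl fun x _ => by
      obtain ⟨y, hy⟩ := hf x
      rw [← sub_sub_cancel (f y) x]
      exact sub_mem (Submodule.mem_sup_left ⟨y, rfl⟩) (Submodule.mem_sup_right hy)
  obtain ⟨y, hy⟩ := hle (Submodule.smul_mem_pointwise_smul 1 c ⊤ trivial)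
  exact ⟨c, hc, y, by rw [hy, Algebra.algebraMap_eq_smul_one]⟩

theorem exists_mul_eq_algebraMap_of_isUnit [Module.Finite C R] {I : Ideal C} {w : R}
    (hw : IsUnit (Ideal.Quotient.mk (extendIdeal R I) w)) :
    (∃ c, c - 1 ∈ I ∧ ∃ r, r * w = algebraMap C R c) ∧
      ∃ c, c - 1 ∈ I ∧ ∃ r, w * r = algebraMap C R c := by
  obtain ⟨u, hu⟩ := hw
  obtain ⟨r, hr⟩ := Ideal.Quotient.mk_surjective (u⁻¹).val
  constructor
  · refine exists_apply_eq_algebraMap (LinearMap.mulRight C w) fun x => ⟨x * r, ?_⟩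
    rw [LinearMap.mulRight_apply, ← Ideal.Quotient.eq, map_mul, map_mul, hr, ← hu, mul_assoc,
      Units.inv_mul, mul_one]
  · refine exists_apply_eq_algebraMap (LinearMap.mulLeft C w) fun x => ⟨r * x, ?_⟩
    rw [LinearMap.mulLeft_apply, ← Ideal.Quotient.eq, map_mul, map_mul, hr, ← hu, ← mul_assoc,
      Units.mul_inv, one_mul]

/-- A left inverse lifts through the radical, and it is two-sided because Artinian rings are
Dedekind finite. -/
theorem isUnit_of_isUnit_quotient_jacobson {B : Type*} [Ring B] [IsArtinianRing B] {w : B}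
    (hw : IsUnit (Ideal.Quotient.mk (Ring.jacobson B) w)) : IsUnit w := by
  obtain ⟨u, hu⟩ := hw
  obtain ⟨r, hr⟩ := Ideal.Quotient.mk_surjective (u⁻¹).val
  obtain ⟨s, hs⟩ := Ideal.exists_mul_sub_mem_of_sub_one_mem_jacobson (I := ⊥) (r * w) (by
    rw [Ideal.jacobson_bot, ← Ideal.Quotient.eq, map_mul, hr, ← hu, Units.inv_mul, map_one])
  rw [Ideal.mem_bot, sub_eq_zero, ← mul_assoc] at hs
  exact ⟨⟨w, s * r, mul_eq_one_symm hs, hs⟩, rfl⟩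

end Quotient

end QuadraticGroup

end

noncomputable section

namespace QuadraticGroup

open Matrix MulOpposite Polynomial

/-! ### The trivial grading, which provides the localizations used for normality -/

section TrivialGrading

/-- The grading of a ring which is concentrated in degree zero. -/
def trivialGrading (R : Type*) [Ring R] (i : ℕ) : AddSubgroup R := if i = 0 then ⊤ else ⊥

variable {R : Type*} [Ring R]

theorem mem_trivialGrading_zero (a : R) : a ∈ trivialGrading R 0 := by
  rw [trivialGrading, if_pos rfl]; trivial

theorem eq_zero_of_mem_trivialGrading {i : ℕ} (hi : i ≠ 0) {a : R} (ha : a ∈ trivialGrading R i) :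
    a = 0 := by
  rwa [trivialGrading, if_neg hi, AddSubgroup.mem_bot] at ha

instance : GradedRing (trivialGrading R) where
  one_mem := mem_trivialGrading_zero 1
  mul_mem i j a b ha hb := by
    by_cases hi : i = 0
    · by_cases hj : j = 0
      · subst hi hj; exact mem_trivialGrading_zero _
      · rw [eq_zero_of_mem_trivialGrading hj hb, mul_zero]; exact zero_mem _
    · rw [eq_zero_of_mem_trivialGrading hi ha, zero_mul]; exact zero_mem _
  decompose' a := DirectSum.of (fun i => trivialGrading R i) 0 ⟨a, mem_trivialGrading_zero a⟩
  left_inv a := by simp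
  right_inv x := by
    induction x using DirectSum.induction_on with
    | zero => simp only [map_zero]; exact map_zero (DirectSum.of (fun i => trivialGrading R i) 0)
    | of i x =>
      rw [DirectSum.coeAddMonoidHom_of]
      by_cases hi : i = 0
      · subst hi; rfl
      · obtain ⟨x, hx⟩ := x
        obtain rfl := eq_zero_of_mem_trivialGrading hi hx
        have e : (⟨0, hx⟩ : trivialGrading R i) = 0 := rfl
        rw [e, map_zero]
        exact map_zero (DirectSum.of (fun i => trivialGrading R i) 0)
    | add x y hx hy =>
      refine Eq.trans ?_ (congrArg₂ (· + ·) hx hy)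
      refine Eq.trans (congrArg (DirectSum.of (fun i => trivialGrading R i) 0) ?_)
        (map_add (DirectSum.of (fun i => trivialGrading R i) 0) _ _)
      exact Subtype.ext (map_add _ x y)

theorem star_mem_trivialGrading [StarRing R] (i : ℕ) (a : R) (ha : a ∈ trivialGrading R i) :
    star a ∈ trivialGrading R i := by
  by_cases hi : i = 0
  · subst hi; exact mem_trivialGrading_zero _
  · rw [eq_zero_of_mem_trivialGrading hi ha, star_zero]; exact zero_mem _

end TrivialGrading

/-! ### A coordinate that is a unit in R_m -/

section UnitCoordinate

theorem isUnit_toLocal {R : Type*} [Ring R] [StarRing R] (𝒜 : ℕ → AddSubgroup R) [GradedRing 𝒜]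
    (m : Ideal (Subring.center (𝒜 0))) [m.IsPrime] (s : denominators 𝒜 m) :
    IsUnit (toLocal 𝒜 m (s.1 : R)) := by
  rw [isUnit_iff_exists]
  have h1 : toLocal 𝒜 m (s.1 : R) = LocalizedModule.mk (s • (1 : R)) 1 :=
    congrArg (fun z : R => LocalizedModule.mk z (1 : denominators 𝒜 m)) (mul_one (s.1 : R)).symm
  refine ⟨LocalizedModule.mk 1 s, ?_, ?_⟩
  · rw [h1, LocalizedModule.mk_mul_mk, mul_one, one_mul]
    exact (LocalizedModule.mk_cancel s 1).trans (map_one (toLocal 𝒜 m))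
  · rw [h1, LocalizedModule.mk_mul_mk, mul_one, one_mul]
    exact (LocalizedModule.mk_cancel s 1).trans (map_one (toLocal 𝒜 m))

variable {R : Type*} [Ring R] [StarRing R]

/-- The involution of the center. -/
def centerStar (R : Type*) [Ring R] [StarRing R] : Subring.center R →+* Subring.center R where
  toFun c := ⟨star (c : R), Set.star_mem_center c.2⟩
  map_one' := Subtype.ext (star_one R)
  map_mul' a b := Subtype.ext (by
    change star ((a : R) * b) = star (a : R) * star (b : R)
    rw [← Subring.mem_center_iff.1 a.2, star_mul])
  map_zero' := Subtype.ext (star_zero R)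
  map_add' a b := Subtype.ext (star_add (a : R) b)

theorem centerStar_surjective : Function.Surjective (centerStar R) := fun c =>
  ⟨centerStar R c, Subtype.ext (star_star (c : R))⟩

/-- The center in degree zero of the trivial grading. -/
def centerTrivialHom (R : Type*) [Ring R] :
    Subring.center R →+* Subring.center (trivialGrading R 0) where
  toFun a := ⟨⟨a, mem_trivialGrading_zero _⟩, Subring.mem_center_iff.2 fun g =>
    Subtype.ext (Subring.mem_center_iff.1 a.2 (g : R))⟩
  map_one' := rfl
  map_mul' a b := by
    apply Subtype.ext; apply Subtype.ext
    simp
  map_zero' := rfl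
  map_add' a b := rfl

omit [StarRing R] in
theorem centerTrivialHom_surjective : Function.Surjective (centerTrivialHom R) := fun c =>
  ⟨⟨c.1, Subring.mem_center_iff.2 fun g => congrArg (fun z : trivialGrading R 0 => (z : R))
    (Subring.mem_center_iff.1 c.2 ⟨g, mem_trivialGrading_zero g⟩)⟩, rfl⟩

variable {lam : R} {Λ : AddSubgroup R} {n : ℕ}

/-- Denominators must avoid m and its conjugate, so the reduction is modulo the intersection I of
both. The ring R/IR is Artinian and semisimple modulo its radical; a unit there has one-sided
inverses up to elements of 1 + I, and these are denominators. -/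
theorem exists_EQ_isUnit_toLocal [Module.Finite (Subring.center R) R] (h : IsFormRing lam Λ)
    (hn : 2 ≤ n) (m : Ideal (Subring.center (trivialGrading R 0))) [m.IsMaximal]
    {v r : Fin n ⊕ Fin n → R} (hv : r ⬝ᵥ v = 1) :
    ∃ g ∈ EQ n lam Λ, ∃ k, IsUnit (toLocal (trivialGrading R) m ((g.val *ᵥ v) k)) := by
  let m₁ : Ideal (Subring.center R) := m.comap (centerTrivialHom R)
  let m₂ : Ideal (Subring.center R) := m₁.comap (centerStar R)
  have : m₁.IsMaximal := Ideal.comap_isMaximal_of_surjective _ centerTrivialHom_surjective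
  have : m₂.IsMaximal := Ideal.comap_isMaximal_of_surjective _ centerStar_surjective
  have := isArtinianRing_quotient_inf m₁ m₂
  have := isArtinianRing_quotient_extendIdeal (R := R) (m₁ ⊓ m₂)
  let φ := (Ideal.Quotient.mk (Ring.jacobson (R ⧸ extendIdeal R (m₁ ⊓ m₂)))).comp
    (Ideal.Quotient.mk (extendIdeal R (m₁ ⊓ m₂)))
  obtain ⟨g, hg, k, hk⟩ := exists_EQ_isUnit h hn (φ := φ)
    (Ideal.Quotient.mk_surjective.comp Ideal.Quotient.mk_surjective) hv
  refine ⟨g, hg, k, ?_⟩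
  have hden : ∀ c : Subring.center R, c - 1 ∈ m₁ ⊓ m₂ → c ∈ denominators (trivialGrading R) m := by
    intro c hc
    have hne : ∀ I : Ideal (Subring.center R), I.IsMaximal → c - 1 ∈ I → c ∉ I := fun I hI h1 h2 =>
      hI.ne_top ((Ideal.eq_top_iff_one I).2 (by simpa using sub_mem h2 h1))
    exact ⟨⟨centerTrivialHom R c, hne m₁ ‹_› hc.1, rfl⟩,
      ⟨centerTrivialHom R (centerStar R c), hne m₂ ‹_› hc.2, rfl⟩⟩
  obtain ⟨⟨c, hc, a, ha⟩, ⟨d, hd, b, hb⟩⟩ :=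
    exists_mul_eq_algebraMap_of_isUnit (isUnit_of_isUnit_quotient_jacobson hk)
  obtain ⟨u, hu⟩ := isUnit_toLocal _ m ⟨c, hden c hc⟩
  obtain ⟨u', hu'⟩ := isUnit_toLocal _ m ⟨d, hden d hd⟩
  rw [isUnit_iff_exists_and_exists]
  constructor
  · refine ⟨toLocal _ m b * (u'⁻¹).val, ?_⟩
    rw [← mul_assoc, ← map_mul, hb]
    exact (congrArg (fun z => z * (u'⁻¹).val) hu'.symm).trans u'.mul_inv
  · refine ⟨(u⁻¹).val * toLocal _ m a, ?_⟩
    rw [mul_assoc, ← map_mul, ha]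
    exact (congrArg (fun z => (u⁻¹).val * z) hu.symm).trans u.inv_mul

end UnitCoordinate

/-! ### Assertion 1: normality -/

section Normality

variable {R : Type*} [Ring R] [StarRing R] {lam : R} {Λ : AddSubgroup R} {n : ℕ}

theorem matMem_EQ_tau_of_mulVec_eq_bas (h : IsFormRing lam Λ) {E : GL (Fin n ⊕ Fin n) R}
    (hE : E ∈ EQ n lam Λ) {v w : Fin n ⊕ Fin n → R} {i : Fin n ⊕ Fin n}
    (hv : E.val *ᵥ v = bas i) (hvw : herm lam v w = 0) (hw : IsIsotropic Λ w) (a : R) :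
    MatMem (EQ n lam Λ) (tau lam v a w) := by
  have hG := EQ_le_GQ h hE
  have key := matMem_EQ_tau h i a (w := E.val *ᵥ w) (by rw [← hv, herm_mulVec hG.1, hvw])
    (hw.mulVec hG)
  rw [← hv, ← mul_tau_mul_inv hG.1] at key
  exact (key.of_mul_right (matMem_val.2 (inv_mem hE))).of_mul_left (matMem_val.2 hE)

theorem matMem_EQ_ell_of_mulVec_eq_bas (h : IsFormRing lam Λ) {E : GL (Fin n ⊕ Fin n) R}
    (hE : E ∈ EQ n lam Λ) {v : Fin n ⊕ Fin n → R} {i : Fin n ⊕ Fin n}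
    (hv : E.val *ᵥ v = bas i) {a : R} (ha : a ∈ conjParam Λ) :
    MatMem (EQ n lam Λ) (ell lam v a) := by
  have hG := EQ_le_GQ h hE
  have key := matMem_EQ_longRoot h i ha
  rw [longRoot, ← hv, ← mul_ell_mul_inv hG.1] at key
  exact (key.of_mul_right (matMem_val.2 (inv_mem hE))).of_mul_left (matMem_val.2 hE)

variable {B : Type*} [Ring B] [StarRing B] {lam' : B} {Λ' : AddSubgroup B} {f : R →+* B}

theorem IsFormHom.map_rk_comp (hf : IsFormHom lam Λ lam' Λ' f) (u v : Fin n ⊕ Fin n → R) (a : R) :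
    (rk lam u a v).map f = rk lam' (f ∘ u) (f a) (f ∘ v) := by
  ext i j
  rcases j with j | j <;> simp [rk, flat, hf.map_star, hf.map_lam]

theorem IsFormHom.map_tau (hf : IsFormHom lam Λ lam' Λ' f) (u v : Fin n ⊕ Fin n → R) (a : R) :
    (tau lam u a v).map f = tau lam' (f ∘ u) (f a) (f ∘ v) := by
  have := hf.map_rk_comp v u (star lam * star a)
  rw [map_mul, hf.map_star, hf.map_star, hf.map_lam] at this
  rw [tau, tau, ← this, ← hf.map_rk_comp u v a]
  change f.mapMatrix _ = _
  rw [map_sub, map_add, map_one]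
  rfl

theorem IsFormHom.map_ell (hf : IsFormHom lam Λ lam' Λ' f) (u : Fin n ⊕ Fin n → R) (a : R) :
    (ell lam u a).map f = ell lam' (f ∘ u) (f a) := by
  rw [ell, ell, ← hf.map_rk_comp u u a]
  change f.mapMatrix _ = _
  rw [map_add, map_one]
  rfl

theorem IsFormHom.map_herm (hf : IsFormHom lam Λ lam' Λ' f) (u v : Fin n ⊕ Fin n → R) :
    herm lam' (f ∘ u) (f ∘ v) = f (herm lam u v) := by
  simp [herm, flat, dotProduct, hf.map_star, hf.map_lam]

theorem IsFormHom.isIsotropic (hf : IsFormHom lam Λ lam' Λ' f) {v : Fin n ⊕ Fin n → R}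
    (hv : IsIsotropic Λ v) : IsIsotropic Λ' (f ∘ v) := by
  have : sesq (f ∘ v) (f ∘ v) = f (sesq v v) := by simp [sesq, hf.map_star]
  rw [IsIsotropic, this]
  exact hf.map_mem _ hv

omit [StarRing R] [StarRing B] in
theorem glMap_mulVec (f : R →+* B) (g : GL (Fin n ⊕ Fin n) R) (v : Fin n ⊕ Fin n → R) :
    (glMap f g).val *ᵥ (f ∘ v) = f ∘ (g.val *ᵥ v) := by
  ext i
  exact (RingHom.map_mulVec f g.val v i).symm

omit [StarRing R] [StarRing B] in
theorem comp_bas (f : R →+* B) (i : Fin n ⊕ Fin n) : f ∘ bas i = bas i := by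
  ext j
  simp only [bas, Function.comp_apply, Pi.single_apply]
  split_ifs <;> simp

theorem IsFormHom.map_hermitian (hf : IsFormHom lam Λ lam' Λ' f)
    {σ : Matrix (Fin n ⊕ Fin n) (Fin n ⊕ Fin n) R}
    (hσ : σ.conjTranspose * psi n lam * σ = psi n lam) :
    (σ.map f).conjTranspose * psi n lam' * σ.map f = psi n lam' := by
  have e : (psi n lam).map f = psi n lam' := by
    rw [psi, psi, Matrix.fromBlocks_map, ← hf.map_lam]
    congr 1
    · ext; simp
    · exact map_one f.mapMatrix
    · ext i j
      by_cases hij : i = j <;> simp [hij]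
    · ext; simp
  have e2 : (σ.map f).conjTranspose = σ.conjTranspose.map f :=
    (Matrix.conjTranspose_map f hf.map_star).symm
  rw [e2, ← e, ← Matrix.map_mul, ← Matrix.map_mul, hσ]

theorem IsFormHom.glMap_mul_root_mul_inv (hf : IsFormHom lam Λ lam' Λ' f)
    {σ : GL (Fin n ⊕ Fin n) R} (hσ : σ ∈ GQ n lam Λ) (i j : Fin n ⊕ Fin n) (b : B) :
    (glMap f σ).val * root lam' i b j * ((glMap f σ)⁻¹).val =
      tau lam' (f ∘ (σ.val *ᵥ bas i)) b (f ∘ (σ.val *ᵥ bas j)) := by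
  have h : (glMap f σ).val.conjTranspose * psi n lam' * (glMap f σ).val = psi n lam' :=
    hf.map_hermitian hσ.1
  rw [root, mul_tau_mul_inv h, ← glMap_mulVec, ← glMap_mulVec, comp_bas, comp_bas]

theorem IsFormHom.glMap_mul_longRoot_mul_inv (hf : IsFormHom lam Λ lam' Λ' f)
    {σ : GL (Fin n ⊕ Fin n) R} (hσ : σ ∈ GQ n lam Λ) (i : Fin n ⊕ Fin n) (b : B) :
    (glMap f σ).val * longRoot lam' i b * ((glMap f σ)⁻¹).val =
      ell lam' (f ∘ (σ.val *ᵥ bas i)) b := by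
  have h : (glMap f σ).val.conjTranspose * psi n lam' * (glMap f σ).val = psi n lam' :=
    hf.map_hermitian hσ.1
  rw [longRoot, mul_ell_mul_inv h, ← glMap_mulVec, comp_bas]

theorem IsFormHom.matMem_EQ_tau (hf : IsFormHom lam Λ lam' Λ' f) (h' : IsFormRing lam' Λ')
    {E : GL (Fin n ⊕ Fin n) B} (hE : E ∈ EQ n lam' Λ') {u v : Fin n ⊕ Fin n → R}
    {i : Fin n ⊕ Fin n} (hEi : E.val *ᵥ (f ∘ u) = bas i) (huv : herm lam u v = 0)
    (hv : IsIsotropic Λ v) (a : R) : MatMem (EQ n lam' Λ') ((tau lam u a v).map f) := by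
  rw [hf.map_tau]
  refine matMem_EQ_tau_of_mulVec_eq_bas h' hE hEi ?_ (hf.isIsotropic hv) _
  rw [hf.map_herm, huv, map_zero]

theorem IsFormHom.matMem_EQ_ell (hf : IsFormHom lam Λ lam' Λ' f) (h' : IsFormRing lam' Λ')
    {E : GL (Fin n ⊕ Fin n) B} (hE : E ∈ EQ n lam' Λ') {u : Fin n ⊕ Fin n → R}
    {i : Fin n ⊕ Fin n} (hEi : E.val *ᵥ (f ∘ u) = bas i) {a : R} (ha : a ∈ conjParam Λ) :
    MatMem (EQ n lam' Λ') ((ell lam u a).map f) := by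
  rw [hf.map_ell]
  exact matMem_EQ_ell_of_mulVec_eq_bas h' hE hEi (hf.mem_conjParam ha)

omit [StarRing R] in
theorem row_dotProduct_mulVec_bas (σ : GL (Fin n ⊕ Fin n) R) (i : Fin n ⊕ Fin n) :
    (bas i ᵥ* (σ⁻¹).val) ⬝ᵥ (σ.val *ᵥ bas i) = 1 := by
  rw [← dotProduct_mulVec, mulVec_mulVec, Units.inv_mul, one_mulVec, bas, single_dotProduct,
    Pi.single_eq_same, one_mul]

variable [Module.Finite (Subring.center R) R]

/-- An elementary matrix over R gives v a coordinate that is a unit in R_m, and one over R_m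
finishes the move; their product is used as a constant matrix over R_m[X]. -/
theorem exists_EQ_local_mulVec_eq_bas (h : IsFormRing lam Λ) (hn : 2 ≤ n)
    (m : Ideal (Subring.center (trivialGrading R 0))) [m.IsMaximal]
    {v r : Fin n ⊕ Fin n → R} (hv : IsIsotropic Λ v) (hr : r ⬝ᵥ v = 1) (i : Fin n ⊕ Fin n) :
    ∃ E ∈ EQ n (C (toLocal (trivialGrading R) m lam))
        (polyForm (localFormParameter (trivialGrading R) m Λ)),
      E.val *ᵥ (mapRingHom (toLocal (trivialGrading R) m) ∘ C ∘ v) = bas i := by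
  have hφ := isFormLocalization_toLocal (trivialGrading R) m h
  have h' := (isFormAlgebra_local (trivialGrading R) m h).toIsFormRing
  set f := toLocal (trivialGrading R) m
  have hf : IsFormHom lam Λ (f lam) (localFormParameter (trivialGrading R) m Λ) f :=
    ⟨hφ.map_star, rfl, hφ.map_mem⟩
  obtain ⟨g, hg, k, hk⟩ := exists_EQ_isUnit_toLocal h hn m hr
  obtain ⟨g', hg', hgi⟩ := exists_EQ_mulVec_eq_bas h' hn
    (hf.isIsotropic (hv.mulVec (EQ_le_GQ h hg))) hk i
  refine ⟨glMap C (g' * glMap f g), isFormHom_C.glMap_mem_EQ h' h'.polynomial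
    (mul_mem hg' (hf.glMap_mem_EQ h h' hg)), ?_⟩
  have e : mapRingHom f ∘ C ∘ v = C ∘ f ∘ v := by ext1 j; simp
  rw [e, glMap_mulVec, Units.val_mul, ← mulVec_mulVec, glMap_mulVec, hgi, comp_bas]

/-- Conjugates of elementary matrices are elementary if they deform locally to the identity. -/
theorem conj_mem_EQ_of_local (h : IsFormRing lam Λ) (hn : 3 ≤ n) (σ : GL (Fin n ⊕ Fin n) R)
    {γ : GL (Fin n ⊕ Fin n) R[X]} (h0 : glMap (evalZero R) γ = 1)
    (hloc : ∀ (m : Ideal (Subring.center (trivialGrading R 0))) [m.IsMaximal],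
      MatMem (EQ n (C (toLocal (trivialGrading R) m lam))
        (polyForm (localFormParameter (trivialGrading R) m Λ)))
        (((glMap C σ).val * γ.val * ((glMap C σ)⁻¹).val).map
          (mapRingHom (toLocal (trivialGrading R) m)))) :
    σ * glMap (evalHom (RingHom.id R) (isScalar_one (Λ := Λ))) γ * σ⁻¹ ∈ EQ n lam Λ := by
  have hmem : glMap C σ * γ * (glMap C σ)⁻¹ ∈ EQ n (C lam) (polyForm Λ) := by
    refine mem_EQ_of_local (trivialGrading R) h star_mem_trivialGrading hn ?_ fun m _ => ?_
    · rw [map_mul, map_mul, h0, mul_one, map_inv, mul_inv_cancel]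
    · exact matMem_val.1 (hloc m)
  have h1 := (isFormHom_evalHom isFormHom_id (isScalar_one (Λ := Λ))).glMap_mem_EQ h.polynomial h hmem
  rw [map_mul, map_mul, map_inv, glMap_glMap, glMap_congr (f' := RingHom.id R)] at h1
  · exact h1
  · intro x; simp

omit [Module.Finite (Subring.center R) R] in
theorem isFormHom_map_toLocal (h : IsFormRing lam Λ)
    (m : Ideal (Subring.center (trivialGrading R 0))) [m.IsMaximal] :
    IsFormHom (C lam) (polyForm Λ) (C (toLocal (trivialGrading R) m lam))
      (polyForm (localFormParameter (trivialGrading R) m Λ))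
      (mapRingHom (toLocal (trivialGrading R) m)) :=
  have hφ := (isFormLocalization_toLocal (trivialGrading R) m h).polynomial
    (isFormAlgebra_formScalars _ h)
  ⟨hφ.map_star, map_C _, hφ.map_mem⟩

omit [Module.Finite (Subring.center R) R] in
theorem evalHom_one_C_mul_X (a : R) :
    evalHom (RingHom.id R) (isScalar_one (Λ := Λ)) (C a * X) = a := by simp

omit [StarRing R] [Module.Finite (Subring.center R) R] in
theorem evalZero_C_mul_X (a : R) : evalZero R (C a * X) = 0 := by
  rw [evalZero_apply]; simp

/-- The parameter a is deformed to aX, joining the identity at X = 0 to the given element at X = 1.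
Locally the conjugate is a transvection along σe_i, which is elementary once that vector is moved to
a basis vector. -/
theorem conj_rootUnit_mem_EQ (h : IsFormRing lam Λ) (hn : 3 ≤ n) {σ : GL (Fin n ⊕ Fin n) R}
    (hσ : σ ∈ GQ n lam Λ) {i j : Fin n ⊕ Fin n} (hij : j ≠ i.swap) (a : R) :
    σ * rootUnit lam i a j hij * σ⁻¹ ∈ EQ n lam Λ := by
  have hev := isFormHom_evalHom (isFormHom_id (lam := lam) (Λ := Λ)) isScalar_one
  have hev0 := isFormHom_evalZero (lam := lam) (Λ := Λ)
  have hC := isFormHom_C (lam := lam) (Λ := Λ)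
  have hiso : ∀ i, IsIsotropic Λ (σ.val *ᵥ bas i) := fun i => (isIsotropic_bas i).mulVec hσ
  have e : rootUnit lam i a j hij = glMap (evalHom (RingHom.id R) (isScalar_one (Λ := Λ)))
      (rootUnit (C lam) i (C a * X) j hij) := by
    refine Units.ext ?_
    change _ = (root (C lam) i (C a * X) j).map _
    rw [hev.map_root, evalHom_one_C_mul_X]
    rfl
  rw [e]
  refine conj_mem_EQ_of_local h hn σ ?_ fun m _ => ?_
  · refine Units.ext ?_
    change (root (C lam) i (C a * X) j).map _ = _
    rw [hev0.map_root, evalZero_C_mul_X, root_zero]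
    rfl
  · have h' := (isFormAlgebra_local (trivialGrading R) m h).toIsFormRing.polynomial
    have hm := isFormHom_map_toLocal h m
    have e2 : (glMap C σ).val * (rootUnit (C lam) i (C a * X) j hij).val * ((glMap C σ)⁻¹).val =
        tau (C lam) (C ∘ (σ.val *ᵥ bas i)) (C a * X) (C ∘ (σ.val *ᵥ bas j)) :=
      hC.glMap_mul_root_mul_inv hσ i j _
    obtain ⟨E, hE, hEi⟩ := exists_EQ_local_mulVec_eq_bas h (by omega) m (hiso i)
      (row_dotProduct_mulVec_bas σ i) i
    rw [e2]
    refine hm.matMem_EQ_tau h' hE hEi ?_ (hC.isIsotropic (hiso j)) _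
    rw [hC.map_herm, herm_mulVec hσ.1, herm_bas_of_ne hij, map_zero]

theorem conj_longRootUnit_mem_EQ (h : IsFormRing lam Λ) (hn : 3 ≤ n) {σ : GL (Fin n ⊕ Fin n) R}
    (hσ : σ ∈ GQ n lam Λ) (i : Fin n ⊕ Fin n) {a : R} (ha : a ∈ conjParam Λ) :
    σ * longRootUnit lam i a * σ⁻¹ ∈ EQ n lam Λ := by
  have hev := isFormHom_evalHom (isFormHom_id (lam := lam) (Λ := Λ)) isScalar_one
  have hev0 := isFormHom_evalZero (lam := lam) (Λ := Λ)
  have hC := isFormHom_C (lam := lam) (Λ := Λ)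
  have e : longRootUnit lam i a = glMap (evalHom (RingHom.id R) (isScalar_one (Λ := Λ)))
      (longRootUnit (C lam) i (C a * X)) := by
    refine Units.ext ?_
    change _ = (longRoot (C lam) i (C a * X)).map _
    rw [hev.map_longRoot, evalHom_one_C_mul_X]
    rfl
  rw [e]
  refine conj_mem_EQ_of_local h hn σ ?_ fun m _ => ?_
  · refine Units.ext ?_
    change (longRoot (C lam) i (C a * X)).map _ = _
    rw [hev0.map_longRoot, evalZero_C_mul_X, longRoot_zero]
    rfl
  · have h' := (isFormAlgebra_local (trivialGrading R) m h).toIsFormRing.polynomial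
    have hm := isFormHom_map_toLocal h m
    have e2 : (glMap C σ).val * (longRootUnit (C lam) i (C a * X)).val * ((glMap C σ)⁻¹).val =
        ell (C lam) (C ∘ (σ.val *ᵥ bas i)) (C a * X) :=
      hC.glMap_mul_longRoot_mul_inv hσ i _
    obtain ⟨E, hE, hEi⟩ := exists_EQ_local_mulVec_eq_bas h (by omega) m
      ((isIsotropic_bas i).mulVec hσ) (row_dotProduct_mulVec_bas σ i) i
    rw [e2]
    refine hm.matMem_EQ_ell h' hE hEi ?_
    rw [mem_conjParam, star_mul, star_X, star_C]
    exact X_mul_mem_polyForm (C_mem_polyForm ha)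

/-- The elementary quadratic group is normalized by the general quadratic group. -/
theorem conj_mem_EQ (h : IsFormRing lam Λ) (hn : 3 ≤ n) {σ : GL (Fin n ⊕ Fin n) R}
    (hσ : σ ∈ GQ n lam Λ) {g : GL (Fin n ⊕ Fin n) R} (hg : g ∈ EQ n lam Λ) :
    σ * g * σ⁻¹ ∈ EQ n lam Λ := by
  suffices hle : EQ n lam Λ ≤ (EQ n lam Λ).comap (MulAut.conj σ).toMonoidHom from hle hg
  conv_lhs => rw [EQ_eq_rootGroup h, rootGroup]
  rw [Subgroup.closure_le]
  intro g hg
  change σ * g * σ⁻¹ ∈ EQ n lam Λ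
  have hg : IsRoot n lam _ _ g.val := hg
  generalize hM : g.val = M at hg
  cases hg with
  | short i j a hij hij' ha =>
    rw [show g = rootUnit lam i a j hij' from Units.ext hM]
    exact conj_rootUnit_mem_EQ h hn hσ hij' a
  | long i a ha =>
    rw [show g = longRootUnit lam i a from Units.ext hM]
    exact conj_longRootUnit_mem_EQ h hn hσ i ha

end Normality

end QuadraticGroup

end

theorem mainTheorem11 {R : Type*} [Ring R] [StarRing R]
    [Module.Finite (Subring.center R) R]
    (𝒜 : ℕ → AddSubgroup R) [GradedRing 𝒜]
    (hstar : ∀ i, ∀ a ∈ 𝒜 i, star a ∈ 𝒜 i)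
    (lam : R) (hlamCenter : lam ∈ Subring.center R) (hlamZero : lam ∈ 𝒜 0)
    (hlamUnitary : lam * star lam = 1)
    (Λ : AddSubgroup R) (hΛ : QuadraticGroup.IsFormParameter lam Λ)
    (hΛgraded : ∀ a ∈ Λ, ∀ i, (DirectSum.decompose 𝒜 a i : R) ∈ Λ)
    (n : ℕ) (hn : 6 ≤ 2 * n) :
    (QuadraticGroup.EQ n lam Λ ≤ QuadraticGroup.GQ n lam Λ ∧
      ((QuadraticGroup.EQ n lam Λ).subgroupOf (QuadraticGroup.GQ n lam Λ)).Normal) ↔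
    (∀ α ∈ QuadraticGroup.GQ n lam Λ,
      α.val.map (fun b => QuadraticGroup.plusEval 𝒜 b 0) = 1 →
      (∀ (m : Ideal (Subring.center (𝒜 0))) [m.IsMaximal],
        QuadraticGroup.localMatrix 𝒜 m α ∈
          QuadraticGroup.EQ n (QuadraticGroup.toLocal 𝒜 m lam)
            (QuadraticGroup.localFormParameter 𝒜 m Λ)) →
      α ∈ QuadraticGroup.EQ n lam Λ) := by
  have h : QuadraticGroup.IsFormRing lam Λ :=
    ⟨fun x => (Subring.mem_center_iff.1 hlamCenter x).symm, hlamUnitary, hΛ⟩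
  -- Each assertion is proved outright. Normality uses the trivial grading, whereas the second
  -- assertion uses the given one.
  refine iff_of_true ⟨QuadraticGroup.EQ_le_GQ h, ⟨fun g hg σ => ?_⟩⟩ fun α _ h0 hloc => ?_
  · exact QuadraticGroup.conj_mem_EQ h (by omega) σ.2 hg
  · exact QuadraticGroup.mem_EQ_of_graded_local 𝒜 h hstar hlamZero hΛgraded (by omega) h0 hloc
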